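/- **Setting.** Let $\mathbb T=\mathbb R/\mathbb Z$, with points represented in $[0,1)$, let $m$ be Lebesgue measure on $\mathbb T$, $m^2=m\otimes m$, and let $a\in(0,1)$. Put $\sigma(\xi)=a$, $\tau(\xi)=\xi/a$ for $\xi\in[0,a)$ and $\sigma(\xi)=1-a$, $\tau(\xi)=(\xi-a)/(1-a)$ for $\xi\in[a,1)$, so that $\tau'=1/\sigma$. Let $T:\mathbb T^2\to\mathbb T^2$ be the generalized baker map $T(\xi,x)=(\tau(\xi),ax)$ for $\xi\in[0,a)$ and $T(\xi,x)=(\tau(\xi),a+(1-a)x)$ for $\xi\in[a,1)$. Let $f_x:\mathbb R\to\mathbb R$ $(x\in\mathbb T)$ be uniformly bounded $C^3$ maps with $f_x'>0$ and negative Schwarzian derivative $f_x'''/f_x'-\frac32(f_x''/f_x')^2<0$, depending continuously on $x$, and let $f(\xi,x,y)=(T(\xi,x),f_x(y))$ on $\mathbb T^2\times\mathbb R$. Assume that there are compact intervals $I\subseteq J^\circ$, $J=[s',t']$, with $f(\mathbb T^2\times J)\subseteq\mathbb T^2\times I^\circ$ and $\inf_{(x,y)\in\mathbb T\times J}\tau'(x)f_{\tau(x)}'(y)>1$,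 and that $(x,y)\mapsto f_x(y)$ is $C^2$ on $\mathbb T\times J$. Let $\varphi^-\le\varphi^+$ be the lower and upper bounding graphs of the global attractor $\bigcap_{n\ge0}f^n(\mathbb T^2\times\mathbb R)$, and assume that they take values in $I$. Let $\varphi^*(\theta)$ be the supremum of those $y\in[\varphi^-(\theta),\varphi^+(\theta)]$ for which the $y$-coordinate of $f^n(\theta,y)$ minus $\varphi^-(T^n\theta)$ tends to $0$ as $n\to\infty$. Let $(m^2)_{\varphi^*}$ be the image of $m^2$ under $\theta\mapsto(\theta,\varphi^*(\theta))$, and $((m^2)_{\varphi^*})_\xi$ its conditional measures on the surfaces $\{\xi\}\times\mathbb T\times\mathbb R$. Let $\widetilde{\mathcal G\varphi^\pm}$ be the filled-in closure of the graph of $\varphi^\pm$, i.e. the set of $(\theta,y)$ with $y_1\le y\le y_2$ for some $y_1,y_2$ such that $(\theta,y_1),(\theta,y_2)$ lie in the closure of the graph. Put $\varphi^{+-}(\theta)=\inf(\widetilde{\mathcal G\varphi^+})_\theta$ and $\varphi^{-+}(\theta)=\sup(\widetilde{\mathcal G\varphi^-})_\theta$. For $\xi\in\mathbb T$, $u\in[0,1]$,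 $y\in J$ let $f$ act on $(\xi,u,y)$ by the formulas above (so that the second coordinate stays in $[0,1]$), and let $$X_3=-\sum_{k\ge0}\Big(\prod_{j<k}\Gamma\circ f^j\Big)\,A\circ f^k,\qquad \Gamma(\xi,u,y)=\frac{\sigma(\xi)}{f_u'(y)},\quad A(\xi,u,y)=\frac{\partial_u f_u(y)}{f_u'(y)}.$$ A *strong stable fibre* in the $\xi$-plane is the graph of a maximal solution $\ell:D\to J$ of $\ell'(u)=X_3(\xi,u,\ell(u))$, $\ell(x)=y$, for some $(x,y)\in[0,1]\times J$, where $D\subseteq[0,1]$ is an interval containing $x$. **Claim.** Assume case A: $\widetilde{\mathcal G\varphi^+}\cap\widetilde{\mathcal G\varphi^-}=\emptyset$. Then exactly one of the following two possibilities occurs. * **A1)** For $m$-a.e. $\xi$, the topological support of $((m^2)_{\varphi^*})_\xi$ is disjoint from $\widetilde{\mathcal G\varphi^-}$ and $\widetilde{\mathcal G\varphi^+}$ and lies between these two sets: over each base point of the $\xi$-plane, its points are strictly above those of $\widetilde{\mathcal G\varphi^-}$ and strictly below those of $\widetilde{\mathcal G\varphi^+}$. * **A2)** For $\varphi=\varphi^{+-}$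 or for $\varphi=\varphi^{-+}$: the measure $(m^2)_{\varphi^*}$ is supported by the graph of $\varphi$; $\varphi$ depends only on the coordinate $x$ and is, as a function of $x\in\mathbb T$, of class $C^{1+\mathrm{Lip}}$; and for $m$-a.e. $\xi$ there is a unique strong stable fibre $\gamma^*_\xi$ in the $\xi$-plane that supports $((m^2)_{\varphi^*})_\xi$, and it coincides with the restriction of the graph of $\varphi$ to the $\xi$-plane, i.e. $\gamma^*_\xi=\{(u,\varphi(\xi,u)):u\in[0,1]\}$. -/

import Mathlib

noncomputable section

namespace BakerSkew

open MeasureTheory ProbabilityTheory Set Filter Topology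

/-- The representative in `[0, 1)` of a point of the one-dimensional torus. -/
def rep (ξ : UnitAddCircle) : ℝ := (AddCircle.equivIco (1 : ℝ) 0 ξ : ℝ)

/-- The expanding circle map: `ξ / a` on `[0, a)`, `(ξ - a) / (1 - a)` on `[a, 1)`. -/
def tau (a : ℝ) (ξ : UnitAddCircle) : UnitAddCircle :=
  ((if rep ξ < a then a⁻¹ * rep ξ else (1 - a)⁻¹ * (rep ξ - a) : ℝ) : UnitAddCircle)

/-- The contraction rate `σ(ξ) = 1 / τ'(ξ)`. -/
def sigma (a : ℝ) (ξ : UnitAddCircle) : ℝ := if rep ξ < a then a else 1 - a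

/-- The contracting affine branch selected by `ξ`, on real arguments (it will be used on the closed
interval `[0, 1]`, where it is continuous). -/
def branch (a : ℝ) (ξ : UnitAddCircle) (u : ℝ) : ℝ :=
  if rep ξ < a then a * u else a + (1 - a) * u

/-- The generalized baker map of the two-dimensional torus. -/
def baker (a : ℝ) (θ : UnitAddCircle × UnitAddCircle) : UnitAddCircle × UnitAddCircle :=
  (tau a θ.1, ((branch a θ.1 (rep θ.2) : ℝ) : UnitAddCircle))

/-- The skew product `(ξ, x, y) ↦ (T (ξ, x), f_x y)`. -/
def skew (a : ℝ) (f : UnitAddCircle → ℝ → ℝ) (p : (UnitAddCircle × UnitAddCircle) × ℝ) :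
    (UnitAddCircle × UnitAddCircle) × ℝ :=
  (baker a p.1, f p.1.2 p.2)

/-- The global attractor `⋂ₙ fⁿ(𝕋² × ℝ)`. -/
def globalAttractor (a : ℝ) (f : UnitAddCircle → ℝ → ℝ) :
    Set ((UnitAddCircle × UnitAddCircle) × ℝ) :=
  ⋂ n : ℕ, ((skew a f)^[n]) '' univ

/-- The upper bounding graph `φ⁺` of the global attractor. -/
def phiPlus (a : ℝ) (f : UnitAddCircle → ℝ → ℝ) (θ : UnitAddCircle × UnitAddCircle) : ℝ :=
  sSup {y | (θ, y) ∈ globalAttractor a f}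

/-- The lower bounding graph `φ⁻` of the global attractor. -/
def phiMinus (a : ℝ) (f : UnitAddCircle → ℝ → ℝ) (θ : UnitAddCircle × UnitAddCircle) : ℝ :=
  sInf {y | (θ, y) ∈ globalAttractor a f}

/-- The separating graph `φ*`: the upper end of the set of those points of the attractor over `θ`
whose forward orbit is asymptotic to `φ⁻`. -/
def phiStar (a : ℝ) (f : UnitAddCircle → ℝ → ℝ) (θ : UnitAddCircle × UnitAddCircle) : ℝ :=
  sSup {y | y ∈ Icc (phiMinus a f θ) (phiPlus a f θ) ∧
    Tendsto (fun n : ℕ => |((skew a f)^[n] (θ, y)).2 - phiMinus a f ((baker a)^[n] θ)|)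
      atTop (𝓝 0)}

/-- The graph of a function on the torus. -/
def graphSet (φ : UnitAddCircle × UnitAddCircle → ℝ) : Set ((UnitAddCircle × UnitAddCircle) × ℝ) :=
  {p | p.2 = φ p.1}

/-- The filled-in closure of the graph of a function on the torus. -/
def filledClosure (φ : UnitAddCircle × UnitAddCircle → ℝ) :
    Set ((UnitAddCircle × UnitAddCircle) × ℝ) :=
  {p | ∃ y₁ y₂ : ℝ, (p.1, y₁) ∈ closure (graphSet φ) ∧ (p.1, y₂) ∈ closure (graphSet φ) ∧
    y₁ ≤ p.2 ∧ p.2 ≤ y₂}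

/-- `φ⁺⁻`, the lower bounding graph of the filled-in closure of the graph of `φ⁺`. -/
def phiPlusMinus (a : ℝ) (f : UnitAddCircle → ℝ → ℝ) (θ : UnitAddCircle × UnitAddCircle) : ℝ :=
  sInf {y | (θ, y) ∈ filledClosure (phiPlus a f)}

/-- `φ⁻⁺`, the upper bounding graph of the filled-in closure of the graph of `φ⁻`. -/
def phiMinusPlus (a : ℝ) (f : UnitAddCircle → ℝ → ℝ) (θ : UnitAddCircle × UnitAddCircle) : ℝ :=
  sSup {y | (θ, y) ∈ filledClosure (phiMinus a f)}

/-- The Schwarzian derivative. -/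
def schwarzian (g : ℝ → ℝ) (y : ℝ) : ℝ :=
  iteratedDeriv 3 g y / deriv g y - 3 / 2 * (iteratedDeriv 2 g y / deriv g y) ^ 2

/-- The standing assumptions on the skew product, with `I = [s, t]` and `J = [s', t']`. -/
structure Standing (a : ℝ) (f : UnitAddCircle → ℝ → ℝ) (s' s t t' : ℝ) : Prop where
  a_pos : 0 < a
  a_lt_one : a < 1
  /-- the fibre maps are uniformly bounded -/
  bounded : ∃ M : ℝ, ∀ x y, |f x y| ≤ M
  contDiff_fibre : ∀ x, ContDiff ℝ 3 (f x)
  deriv_pos : ∀ x y, 0 < deriv (f x) y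
  schwarzian_neg : ∀ x y, schwarzian (f x) y < 0
  /-- `x ↦ f_x` is continuous (for uniform convergence on compact sets) -/
  continuous_f : Continuous fun p : UnitAddCircle × ℝ => f p.1 p.2
  s'_lt_s : s' < s
  s_le_t : s ≤ t
  t_lt_t' : t < t'
  /-- `f (𝕋² × J) ⊆ 𝕋² × interior I` -/
  mapsTo_J : ∀ x, ∀ y ∈ Icc s' t', f x y ∈ Ioo s t
  /-- the infimum of `τ'(x) f_{τ x}'(y)` over `𝕋 × J` is larger than one -/
  partially_hyperbolic : ∃ c : ℝ, 1 < c ∧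
    ∀ x, ∀ y ∈ Icc s' t', c ≤ (sigma a x)⁻¹ * deriv (f (tau a x)) y
  /-- `(x, y) ↦ f_x y` is of class `C²` on `𝕋 × J` -/
  contDiffOn_J : ContDiffOn ℝ 2 (fun p : ℝ × ℝ => f (p.1 : UnitAddCircle) p.2)
    (univ ×ˢ Icc s' t')
  /-- the graphs `φ⁻` and `φ⁺` take values in `I` -/
  phiMinus_mem : ∀ θ, phiMinus a f θ ∈ Icc s t
  phiPlus_mem : ∀ θ, phiPlus a f θ ∈ Icc s t

/-! ### Strong stable fibres -/

/-- The skew product in the coordinates `(ξ, u, y)` with `u` in the closed unit interval. -/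
def skewLift (a : ℝ) (f : UnitAddCircle → ℝ → ℝ) (p : UnitAddCircle × ℝ × ℝ) :
    UnitAddCircle × ℝ × ℝ :=
  (tau a p.1, branch a p.1 p.2.1, f (p.2.1 : UnitAddCircle) p.2.2)

/-- `Γ(ξ, u, y) = σ(ξ) / f_u'(y)`. -/
def Gam (a : ℝ) (f : UnitAddCircle → ℝ → ℝ) (p : UnitAddCircle × ℝ × ℝ) : ℝ :=
  sigma a p.1 / deriv (f (p.2.1 : UnitAddCircle)) p.2.2

/-- `A(ξ, u, y) = (∂f_u(y)/∂u) / f_u'(y)`. -/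
def slopeA (f : UnitAddCircle → ℝ → ℝ) (p : UnitAddCircle × ℝ × ℝ) : ℝ :=
  deriv (fun u : ℝ => f (u : UnitAddCircle) p.2.2) p.2.1 /
    deriv (f (p.2.1 : UnitAddCircle)) p.2.2

/-- The slope `X₃` of the strong stable direction `(0, 1, X₃)`:
`X₃ = - ∑ₖ (∏_{j<k} Γ ∘ fʲ) · A ∘ fᵏ`. -/
def X₃ (a : ℝ) (f : UnitAddCircle → ℝ → ℝ) (p : UnitAddCircle × ℝ × ℝ) : ℝ :=
  -∑' k : ℕ, (∏ j ∈ Finset.range k, Gam a f ((skewLift a f)^[j] p)) *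
    slopeA f ((skewLift a f)^[k] p)

/-- `ℓ` solves, on the interval `D ⊆ [0, 1]` around `x` and with values in `J = [s', t']`, the
initial value problem `ℓ x = y`, `ℓ'(u) = X₃(ξ, u, ℓ u)`. -/
structure IsFibreSolution (a : ℝ) (f : UnitAddCircle → ℝ → ℝ) (s' t' : ℝ)
    (ξ : UnitAddCircle) (x y : ℝ) (D : Set ℝ) (l : ℝ → ℝ) : Prop where
  subset_unit : D ⊆ Icc 0 1
  interval : D.OrdConnected
  mem : x ∈ D
  initial : l x = y
  mapsTo : ∀ u ∈ D, l u ∈ Icc s' t'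
  hasDeriv : ∀ u ∈ D, HasDerivWithinAt l (X₃ a f (ξ, u, l u)) D u

/-- `γ` is a strong stable fibre in the `ξ`-plane: the graph of the maximal solution through some
point of `[0, 1] × J`, i.e. of the solution that extends every other one. -/
def IsStrongStableFibre (a : ℝ) (f : UnitAddCircle → ℝ → ℝ) (s' t' : ℝ)
    (ξ : UnitAddCircle) (γ : Set (ℝ × ℝ)) : Prop :=
  ∃ x ∈ Icc (0 : ℝ) 1, ∃ y ∈ Icc s' t', ∃ (D : Set ℝ) (l : ℝ → ℝ),
    IsFibreSolution a f s' t' ξ x y D l ∧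
    (∀ (D' : Set ℝ) (l' : ℝ → ℝ), IsFibreSolution a f s' t' ξ x y D' l' →
      D' ⊆ D ∧ EqOn l' l D') ∧
    γ = {q | q.1 ∈ D ∧ q.2 = l q.1}

/-! ### The lifted measure and its conditional measures -/

/-- The measure `(m²)_{φ*}`, the image of Lebesgue measure on `𝕋²` under `θ ↦ (θ, φ* θ)`, with
coordinates grouped as `(ξ, (x, y))`. -/
def liftedMeasure (a : ℝ) (f : UnitAddCircle → ℝ → ℝ) :
    Measure (UnitAddCircle × (UnitAddCircle × ℝ)) :=
  Measure.map (fun θ : UnitAddCircle × UnitAddCircle => (θ.1, (θ.2, phiStar a f θ)))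
    (volume : Measure (UnitAddCircle × UnitAddCircle))

instance (a : ℝ) (f : UnitAddCircle → ℝ → ℝ) : IsFiniteMeasure (liftedMeasure a f) := by
  unfold liftedMeasure; infer_instance

/-- The conditional measure of `(m²)_{φ*}` on the `ξ`-plane. -/
def condMeasure (a : ℝ) (f : UnitAddCircle → ℝ → ℝ) (ξ : UnitAddCircle) :
    Measure (UnitAddCircle × ℝ) :=
  (liftedMeasure a f).condKernel ξ

/-- The strong stable fibre `γ` supports the conditional measure on the `ξ`-plane. -/
def FibreSupports (a : ℝ) (f : UnitAddCircle → ℝ → ℝ) (ξ : UnitAddCircle)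
    (γ : Set (ℝ × ℝ)) : Prop :=
  condMeasure a f ξ
    ((fun q : ℝ × ℝ => (((q.1 : UnitAddCircle)), q.2)) '' γ)ᶜ = 0

/-- `γ` is the fibre `γ*_ξ`: the unique strong stable fibre in the `ξ`-plane that supports the
conditional measure. -/
def IsGammaStar (a : ℝ) (f : UnitAddCircle → ℝ → ℝ) (s' t' : ℝ) (ξ : UnitAddCircle)
    (γ : Set (ℝ × ℝ)) : Prop :=
  IsStrongStableFibre a f s' t' ξ γ ∧ FibreSupports a f ξ γ ∧
    ∀ γ', IsStrongStableFibre a f s' t' ξ γ' → FibreSupports a f ξ γ' → γ' = γ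

/-- A function on the circle of class `C^{1+Lip}`. -/
def IsC1Lip (h : UnitAddCircle → ℝ) : Prop :=
  ContDiff ℝ 1 (fun u : ℝ => h (u : UnitAddCircle)) ∧
    ∃ K : NNReal, LipschitzWith K (deriv fun u : ℝ => h (u : UnitAddCircle))

/-- For a.e. `ξ` the topological support of the conditional measure is disjoint from the filled-in
closures of the graphs of `φ⁻` and `φ⁺`, and lies between them. -/
def CaseA1 (a : ℝ) (f : UnitAddCircle → ℝ → ℝ) : Prop :=
  ∀ᵐ ξ ∂(volume : Measure UnitAddCircle), ∀ q ∈ (condMeasure a f ξ).support,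
    ((ξ, q.1), q.2) ∉ filledClosure (phiMinus a f) ∧
    ((ξ, q.1), q.2) ∉ filledClosure (phiPlus a f) ∧
    (∀ y, ((ξ, q.1), y) ∈ filledClosure (phiMinus a f) → y < q.2) ∧
    (∀ y, ((ξ, q.1), y) ∈ filledClosure (phiPlus a f) → q.2 < y)

/-- The lifted measure is supported by the graph of `φ`, which depends only on `x`, is of class
`C^{1+Lip}`, and coincides on a.e. `ξ`-plane with `γ*_ξ`. -/
def IsStableCarrier (a : ℝ) (f : UnitAddCircle → ℝ → ℝ) (s' t' : ℝ)
    (φ : UnitAddCircle × UnitAddCircle → ℝ) : Prop :=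
  liftedMeasure a f {p | p.2.2 = φ (p.1, p.2.1)}ᶜ = 0 ∧
  (∃ h : UnitAddCircle → ℝ, (∀ θ, φ θ = h θ.2) ∧ IsC1Lip h) ∧
  ∀ᵐ ξ ∂(volume : Measure UnitAddCircle), IsGammaStar a f s' t' ξ
    {q | q.1 ∈ Icc (0 : ℝ) 1 ∧ q.2 = φ (ξ, (q.1 : UnitAddCircle))}

/-- The lifted measure is carried by `φ⁺⁻` or by `φ⁻⁺`, as a stable graph. -/
def CaseA2 (a : ℝ) (f : UnitAddCircle → ℝ → ℝ) (s' t' : ℝ) : Prop :=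
  IsStableCarrier a f s' t' (phiPlusMinus a f) ∨ IsStableCarrier a f s' t' (phiMinusPlus a f)

end BakerSkew

end

noncomputable section

namespace BakerSkew

open MeasureTheory ProbabilityTheory Set Filter Topology

/-! ### The circle, the expanding map and the baker map -/

/-! Three mechanisms compare `φ*` with the bounding graphs `φ⁺` and `φ⁻` inside the ξ-planes. The
bounding graphs depend on `x` only, being monotone limits of the pullback maps.

Negative Schwarzian derivative: the fibre maps increase cross ratios (`crossRatio_lt`), uniformly on
separated quadruples. If the orbit of a point above `φ*` stayed away from `φ⁺`, the cross ratio of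
`φ⁻`, a second point above `φ*`, the given point and `φ⁺` would be bounded and yet multiplied
infinitely often by a factor larger than one. So every such orbit comes arbitrarily close to `φ⁺`
infinitely often (`frequently_near_phiPlus`).

Domination: `f' ≥ cσ` with `c > 1` makes vertical expansion stronger than the horizontal scaling
inside a ξ-plane, so steep cones are invariant. If `φ*` rose too steeply from `x` to `x'`, a point
near the first value, recurrently close to `φ⁺`, would stay below a point asymptotic to `φ⁻`.
Horizontal distances tend to zero, so in the limit the filled-in closures would meet. In case A,
`φ*` is therefore Lipschitz in `x`, uniformly in `ξ` (`exists_phiStar_lipschitz`).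

Ergodicity: the set of ξ in whose plane `φ*` has zero gap to `φ⁺` is forward invariant under `τ`,
hence null or conull (`GraphPair.dichotomy`). In the null case `φ*` stays strictly below the closure
of the graph of `φ⁺`. In the conull case the contraction of the baker map makes almost-touching
points dense in almost every plane, and by Lipschitz continuity `φ*` is the lower boundary `φ⁺⁻` of
that closure. The reflection `y ↦ -y` gives the same for `φ⁻`.

Gaps on both sides give A1. Otherwise `φ*` agrees in a.e. plane with an invariant Lipschitz graph
`h` independent of ξ. Iterating a Taylor estimate gives `|h v - h u - X₃ (v - u)| ≤ C |v - u|²`,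
from which `C^{1+Lip}` regularity and the fibre equation follow. Vertical expansion identifies every
fibre meeting this graph with it. The cases exclude each other because A2 puts a nonempty support
inside a filled-in closure. -/

lemma rep_mem (ξ : UnitAddCircle) : rep ξ ∈ Ico (0 : ℝ) 1 := by
  have h := (AddCircle.equivIco (1 : ℝ) 0 ξ).2
  simpa only [rep, zero_add] using h

lemma coe_rep (ξ : UnitAddCircle) : ((rep ξ : ℝ) : UnitAddCircle) = ξ := AddCircle.coe_equivIco

lemma rep_coe {u : ℝ} (hu : u ∈ Ico (0 : ℝ) 1) : rep (u : UnitAddCircle) = u := by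
  have hu' : u ∈ Ico (0 : ℝ) (0 + 1) := by simpa using hu
  unfold rep
  rw [AddCircle.equivIco_coe_eq hu']

lemma rep_zero : rep 0 = 0 := by
  have := rep_coe (u := 0) ⟨le_rfl, one_pos⟩
  simpa using this

lemma measurable_rep : Measurable rep :=
  measurable_subtype_coe.comp (AddCircle.measurableEquivIco 1 0).measurable

lemma coe_one : ((1 : ℝ) : UnitAddCircle) = 0 := AddCircle.coe_period 1

lemma coe_add_one (u : ℝ) : ((u + 1 : ℝ) : UnitAddCircle) = u := AddCircle.coe_add_period 1 u

lemma continuous_coe : Continuous fun u : ℝ => (u : UnitAddCircle) := AddCircle.continuous_mk' 1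

lemma exists_coe_eq (x : UnitAddCircle) : ∃ u ∈ Ico (0 : ℝ) 1, (u : UnitAddCircle) = x :=
  ⟨rep x, rep_mem x, coe_rep x⟩

lemma tau_coe (a : ℝ) {u : ℝ} (hu : u ∈ Ico (0 : ℝ) 1) :
    tau a (u : UnitAddCircle) =
      ((if u < a then a⁻¹ * u else (1 - a)⁻¹ * (u - a) : ℝ) : UnitAddCircle) := by
  rw [tau, rep_coe hu]

lemma sigma_pos {a : ℝ} (h0 : 0 < a) (h1 : a < 1) (ξ : UnitAddCircle) : 0 < sigma a ξ := by
  unfold sigma; split_ifs <;> linarith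

lemma sigma_le {a : ℝ} (ξ : UnitAddCircle) : sigma a ξ ≤ max a (1 - a) := by
  unfold sigma; split_ifs
  · exact le_max_left _ _
  · exact le_max_right _ _

lemma le_sigma {a : ℝ} (ξ : UnitAddCircle) : min a (1 - a) ≤ sigma a ξ := by
  unfold sigma; split_ifs
  · exact min_le_left _ _
  · exact min_le_right _ _

lemma branch_sub (a : ℝ) (ξ : UnitAddCircle) (u v : ℝ) :
    branch a ξ u - branch a ξ v = sigma a ξ * (u - v) := by
  unfold branch sigma; split_ifs <;> ring

lemma hasDerivAt_branch (a : ℝ) (ξ : UnitAddCircle) (u : ℝ) :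
    HasDerivAt (branch a ξ) (sigma a ξ) u := by
  have : branch a ξ = fun u => sigma a ξ * u + branch a ξ 0 := by
    funext u
    have := branch_sub a ξ u 0
    linarith
  rw [this]
  simpa using ((hasDerivAt_id u).const_mul (sigma a ξ)).add_const (branch a ξ 0)

lemma continuous_branch (a : ℝ) (ξ : UnitAddCircle) : Continuous (branch a ξ) :=
  continuous_iff_continuousAt.2 fun u => (hasDerivAt_branch a ξ u).continuousAt

lemma branch_mem_Icc {a : ℝ} (h0 : 0 < a) (h1 : a < 1) (ξ : UnitAddCircle) {u : ℝ}
    (hu : u ∈ Icc (0 : ℝ) 1) : branch a ξ u ∈ Icc (0 : ℝ) 1 := by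
  obtain ⟨hu0, hu1⟩ := hu
  unfold branch; split_ifs <;> constructor <;> nlinarith

lemma branch_mem_Ico {a : ℝ} (h0 : 0 < a) (h1 : a < 1) (ξ : UnitAddCircle) {u : ℝ}
    (hu : u ∈ Ico (0 : ℝ) 1) : branch a ξ u ∈ Ico (0 : ℝ) 1 := by
  obtain ⟨hu0, hu1⟩ := hu
  unfold branch; split_ifs <;> constructor <;> nlinarith

lemma branch_lt_iff {a : ℝ} (h0 : 0 < a) (h1 : a < 1) (ξ : UnitAddCircle) {u : ℝ}
    (hu : u ∈ Ico (0 : ℝ) 1) : branch a ξ u < a ↔ rep ξ < a := by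
  obtain ⟨hu0, hu1⟩ := hu
  unfold branch; split_ifs with h
  · simp only [h, iff_true]; nlinarith
  · simp only [h, iff_false, not_lt]; nlinarith

lemma tau_branch_of_Ico {a : ℝ} (h0 : 0 < a) (h1 : a < 1) (ξ : UnitAddCircle) {u : ℝ}
    (hu : u ∈ Ico (0 : ℝ) 1) : tau a ((branch a ξ u : ℝ) : UnitAddCircle) = u := by
  have h1' : (1 - a) ≠ 0 := by linarith
  rw [tau_coe a (branch_mem_Ico h0 h1 ξ hu)]
  by_cases h : rep ξ < a
  · rw [if_pos ((branch_lt_iff h0 h1 ξ hu).2 h), branch, if_pos h]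
    congr 1; field_simp
  · rw [if_neg (mt (branch_lt_iff h0 h1 ξ hu).1 h), branch, if_neg h]
    congr 1; field_simp; ring

lemma tau_zero (a : ℝ) (h0 : 0 < a) : tau a 0 = 0 := by
  have := tau_coe a (u := 0) ⟨le_rfl, one_pos⟩
  simpa [h0] using this

lemma tau_coe_self {a : ℝ} (h0 : 0 < a) (h1 : a < 1) : tau a (a : UnitAddCircle) = 0 := by
  rw [tau_coe a ⟨h0.le, h1⟩]; simp

/-- The endpoint `u = 1` is included because both branches send it to `a` or `1`, which `τ` maps to
`0`, the class of `1`. -/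
lemma tau_branch {a : ℝ} (h0 : 0 < a) (h1 : a < 1) (ξ : UnitAddCircle) {u : ℝ}
    (hu : u ∈ Icc (0 : ℝ) 1) : tau a ((branch a ξ u : ℝ) : UnitAddCircle) = u := by
  rcases hu.2.lt_or_eq with h | rfl
  · exact tau_branch_of_Ico h0 h1 ξ ⟨hu.1, h⟩
  · rw [coe_one]
    unfold branch; split_ifs with h
    · rw [mul_one, tau_coe_self h0 h1]
    · rw [mul_one, add_sub_cancel, coe_one, tau_zero a h0]

lemma sigma_branch {a : ℝ} (h0 : 0 < a) (h1 : a < 1) (ξ : UnitAddCircle) {u : ℝ}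
    (hu : u ∈ Ico (0 : ℝ) 1) : sigma a ((branch a ξ u : ℝ) : UnitAddCircle) = sigma a ξ := by
  unfold sigma
  rw [rep_coe (branch_mem_Ico h0 h1 ξ hu)]
  simp only [branch_lt_iff h0 h1 ξ hu]

lemma branch_rep_tau {a : ℝ} (h0 : 0 < a) (h1 : a < 1) (x : UnitAddCircle) :
    branch a x (rep (tau a x)) = rep x := by
  obtain ⟨u, hu, rfl⟩ := exists_coe_eq x
  have h1' : 0 < 1 - a := by linarith
  rw [tau_coe a hu, branch, rep_coe hu]
  by_cases h : u < a
  · rw [if_pos h, if_pos h, rep_coe]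
    · field_simp
    · refine ⟨mul_nonneg (by positivity) hu.1, ?_⟩
      rw [inv_mul_lt_iff₀ h0]; linarith
  · rw [if_neg h, if_neg h, rep_coe]
    · field_simp; ring
    · refine ⟨mul_nonneg (by positivity) (by linarith), ?_⟩
      rw [inv_mul_lt_iff₀ h1']; linarith [hu.2]

lemma tau_baker {a : ℝ} (h0 : 0 < a) (h1 : a < 1) (θ : UnitAddCircle × UnitAddCircle) :
    tau a (baker a θ).2 = θ.2 := by
  rw [baker, tau_branch_of_Ico h0 h1 _ (rep_mem _), coe_rep]

lemma rep_baker {a : ℝ} (h0 : 0 < a) (h1 : a < 1) (θ : UnitAddCircle × UnitAddCircle) :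
    rep (baker a θ).2 = branch a θ.1 (rep θ.2) :=
  rep_coe (branch_mem_Ico h0 h1 _ (rep_mem _))

lemma branch_congr {a : ℝ} {ξ ξ' : UnitAddCircle} (h : rep ξ < a ↔ rep ξ' < a) :
    branch a ξ = branch a ξ' := by
  funext u; simp only [branch, h]

/-- The baker map is onto, and its inverse acts on the second coordinate by `τ`: the interval
containing `x` tells which branch was used. -/
lemma exists_baker_eq {a : ℝ} (h0 : 0 < a) (h1 : a < 1) (θ : UnitAddCircle × UnitAddCircle) :
    ∃ θ', baker a θ' = θ ∧ θ'.2 = tau a θ.2 := by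
  refine ⟨(((branch a θ.2 (rep θ.1) : ℝ) : UnitAddCircle), tau a θ.2), ?_, rfl⟩
  have hb := branch_lt_iff h0 h1 θ.2 (rep_mem θ.1)
  refine Prod.ext ?_ ?_
  · simp only [baker]
    rw [tau_branch_of_Ico h0 h1 _ (rep_mem _), coe_rep]
  · simp only [baker]
    rw [branch_congr (ξ' := θ.2), branch_rep_tau h0 h1, coe_rep]
    rw [rep_coe (branch_mem_Ico h0 h1 _ (rep_mem _)), hb]

lemma continuous_tau {a : ℝ} (h0 : 0 < a) (h1 : a < 1) : Continuous (tau a) := by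
  have h1' : (1 - a) ≠ 0 := by linarith
  -- On the second interval the lift is raised by `1`, which the circle ignores and which makes the
  -- real function continuous at `a`.
  let F : ℝ → UnitAddCircle := fun u =>
    ((if u ≤ a then a⁻¹ * u else 1 + (1 - a)⁻¹ * (u - a) : ℝ) : UnitAddCircle)
  have hF : Continuous F := by
    refine continuous_coe.comp (Continuous.if_le (by fun_prop) (by fun_prop) continuous_id
      continuous_const ?_)
    intro x hx
    subst hx
    simp [h0.ne']
  have hp : F 0 = F (0 + 1) := by
    have : ¬ (0 + 1 : ℝ) ≤ a := by linarith
    have e : (1 - a)⁻¹ * (0 + 1 - a) = 1 := by rw [zero_add]; exact inv_mul_cancel₀ h1'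
    simp only [F, if_neg this, if_pos h0.le, e, mul_zero]
    rw [coe_add_one, coe_one]; simp
  have : tau a = AddCircle.liftIco (1 : ℝ) 0 F := by
    funext x
    obtain ⟨u, hu, rfl⟩ := exists_coe_eq x
    rw [AddCircle.liftIco_coe_apply (by simpa using hu), tau_coe a hu]
    simp only [F]
    rcases lt_trichotomy u a with h | h | h
    · rw [if_pos h, if_pos h.le]
    · subst h
      simp only [lt_irrefl, if_false, le_refl, if_true, sub_self, mul_zero,
        inv_mul_cancel₀ h0.ne', coe_one]
      simp
    · rw [if_neg h.not_gt, if_neg h.not_ge, add_comm, coe_add_one]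
  rw [this]
  exact AddCircle.liftIco_continuous hp hF.continuousOn

lemma measurable_baker {a : ℝ} (h0 : 0 < a) (h1 : a < 1) : Measurable (baker a) := by
  have h2 : Measurable fun θ : UnitAddCircle × UnitAddCircle => rep θ.2 :=
    measurable_rep.comp measurable_snd
  refine ((continuous_tau h0 h1).measurable.comp measurable_fst).prodMk
    (continuous_coe.measurable.comp (Measurable.ite
      (measurableSet_lt (measurable_rep.comp measurable_fst) measurable_const) ?_ ?_))
  · exact h2.const_mul a
  · exact (h2.const_mul (1 - a)).const_add a

/-- A local section of the expanding map near `0`, passing through `0` or through `a`. -/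
lemma exists_local_section {a : ℝ} (h0 : 0 < a) (h1 : a < 1) (ξ : UnitAddCircle) {u : ℝ}
    (hu : u = 0 ∨ u = 1) {t : ℝ} (ht : |t| < 1) :
    ∃ t' : ℝ, |t' - branch a ξ u| ≤ |t| ∧ tau a (t' : UnitAddCircle) = t := by
  have h1' : 0 < 1 - a := by linarith
  obtain ⟨ht1, ht2⟩ := abs_lt.1 ht
  have key0 : ∃ t' : ℝ, |t'| ≤ |t| ∧ tau a (t' : UnitAddCircle) = t := by
    rcases le_or_gt 0 t with h | h
    · refine ⟨a * t, ?_, ?_⟩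
      · rw [abs_mul, abs_of_pos h0]; nlinarith [abs_nonneg t]
      · rw [tau_coe a ⟨by positivity, by nlinarith⟩, if_pos (by nlinarith),
          inv_mul_cancel_left₀ h0.ne']
    · refine ⟨(1 - a) * t, ?_, ?_⟩
      · rw [abs_mul, abs_of_pos h1']; nlinarith [abs_nonneg t]
      · rw [← coe_add_one, tau_coe a ⟨by nlinarith, by nlinarith⟩, if_neg (by nlinarith),
          ← coe_add_one t]
        congr 1; field_simp; ring
  have keya : ∃ t' : ℝ, |t' - a| ≤ |t| ∧ tau a (t' : UnitAddCircle) = t := by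
    rcases le_or_gt 0 t with h | h
    · refine ⟨a + (1 - a) * t, ?_, ?_⟩
      · rw [add_sub_cancel_left, abs_mul, abs_of_pos h1']; nlinarith [abs_nonneg t]
      · rw [tau_coe a ⟨by positivity, by nlinarith⟩, if_neg (by nlinarith)]
        congr 1; field_simp; ring
    · refine ⟨a + a * t, ?_, ?_⟩
      · rw [add_sub_cancel_left, abs_mul, abs_of_pos h0]; nlinarith [abs_nonneg t]
      · rw [tau_coe a ⟨by nlinarith, by nlinarith⟩, if_pos (by nlinarith), ← coe_add_one t]
        congr 1; field_simp; ring
  rcases hu with rfl | rfl <;> unfold branch <;> split_ifs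
  · simpa using key0
  · simpa using keya
  · simpa using keya
  · obtain ⟨t', h, h'⟩ := key0
    refine ⟨t' + 1, ?_, ?_⟩
    · have : t' + 1 - (a + (1 - a) * 1) = t' := by ring
      rwa [this]
    · rwa [coe_add_one]

/-! ### Escape of orbits of the expanding map from the two intervals. -/

lemma rep_tau_of_lt {a : ℝ} (h0 : 0 < a) (h1 : a < 1) {ξ : UnitAddCircle} (h : rep ξ < a) :
    rep ξ = a * rep (tau a ξ) := by
  have := branch_rep_tau h0 h1 ξ
  rw [branch, if_pos h] at this
  exact this.symm

lemma rep_tau_of_ge {a : ℝ} (h0 : 0 < a) (h1 : a < 1) {ξ : UnitAddCircle} (h : ¬ rep ξ < a) :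
    1 - rep ξ = (1 - a) * (1 - rep (tau a ξ)) := by
  have := branch_rep_tau h0 h1 ξ
  rw [branch, if_neg h] at this
  linarith

/-- Induction along the forward orbit of a nonzero point until it enters `[a, 1)`. -/
lemma induction_until_ge {a : ℝ} (h0 : 0 < a) (h1 : a < 1) {P : UnitAddCircle → Prop}
    (base : ∀ ξ, ¬ rep ξ < a → P ξ) (step : ∀ ξ, rep ξ < a → P (tau a ξ) → P ξ)
    {ξ : UnitAddCircle} (hξ : ξ ≠ 0) : P ξ := by
  have key : ∀ n : ℕ, ∀ ξ, a ^ n ≤ rep ξ → P ξ := by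
    intro n
    induction n with
    | zero => intro ξ h; rw [pow_zero] at h; exact absurd (rep_mem ξ).2 h.not_gt
    | succ n ih =>
      intro ξ h
      by_cases hlt : rep ξ < a
      · refine step ξ hlt (ih _ ?_)
        rw [rep_tau_of_lt h0 h1 hlt, pow_succ'] at h
        exact le_of_mul_le_mul_left h h0
      · exact base ξ hlt
  have hpos : 0 < rep ξ := by
    refine (rep_mem ξ).1.lt_of_ne fun h => hξ ?_
    rw [← coe_rep ξ, ← h]; simp
  obtain ⟨n, hn⟩ := exists_pow_lt_of_lt_one hpos h1
  exact key n ξ hn.le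

/-- Induction along the forward orbit of a point until it enters `[0, a)`. -/
lemma induction_until_lt {a : ℝ} (h0 : 0 < a) (h1 : a < 1) {P : UnitAddCircle → Prop}
    (base : ∀ ξ, rep ξ < a → P ξ) (step : ∀ ξ, ¬ rep ξ < a → P (tau a ξ) → P ξ)
    (ξ : UnitAddCircle) : P ξ := by
  have key : ∀ n : ℕ, ∀ ξ, (1 - a) ^ n ≤ 1 - rep ξ → P ξ := by
    intro n
    induction n with
    | zero => intro ξ h; rw [pow_zero] at h; exact base ξ (by linarith)
    | succ n ih =>
      intro ξ h
      by_cases hlt : rep ξ < a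
      · exact base ξ hlt
      · refine step ξ hlt (ih _ ?_)
        rw [rep_tau_of_ge h0 h1 hlt, pow_succ'] at h
        exact le_of_mul_le_mul_left h (by linarith)
  obtain ⟨n, hn⟩ := exists_pow_lt_of_lt_one (sub_pos.2 (rep_mem ξ).2) (by linarith : 1 - a < 1)
  exact key n ξ hn.le

/-! ### Lebesgue measure on the circle and ergodicity of the expanding map -/

lemma measurePreserving_coe :
    MeasurePreserving (fun u : ℝ => (u : UnitAddCircle)) (volume.restrict (Ico (0 : ℝ) 1))
      volume := by
  have h := UnitAddCircle.measurePreserving_mk 0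
  rw [zero_add] at h
  rwa [Measure.restrict_congr_set (Ico_ae_eq_Ioc (μ := (volume : Measure ℝ)) (a := 0) (b := 1))]

lemma measurePreserving_rep :
    MeasurePreserving rep volume (volume.restrict (Ico (0 : ℝ) 1)) := by
  refine ⟨measurable_rep, ?_⟩
  rw [← measurePreserving_coe.map_eq, Measure.map_map measurable_rep
    measurePreserving_coe.measurable]
  conv_rhs => rw [← Measure.map_id (μ := volume.restrict (Ico (0 : ℝ) 1))]
  refine Measure.map_congr ?_
  filter_upwards [ae_restrict_mem measurableSet_Ico] with u hu
  simpa using rep_coe hu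

lemma ae_circle_iff {P : UnitAddCircle → Prop} :
    (∀ᵐ ξ, P ξ) ↔ ∀ᵐ u : ℝ, u ∈ Ico (0 : ℝ) 1 → P u := by
  rw [← ae_restrict_iff' measurableSet_Ico]
  constructor
  · exact fun h => measurePreserving_coe.quasiMeasurePreserving.ae h
  · intro h
    filter_upwards [measurePreserving_rep.quasiMeasurePreserving.ae h] with ξ hξ
    rwa [coe_rep] at hξ

lemma quasiMeasurePreserving_affine {c : ℝ} (hc : c ≠ 0) (d : ℝ) :
    Measure.QuasiMeasurePreserving (fun u : ℝ => c * u + d) := by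
  have h1 : Measure.QuasiMeasurePreserving (fun u : ℝ => c * u) := by
    refine ⟨measurable_const_mul c, ?_⟩
    rw [Real.map_volume_mul_left hc]
    exact Measure.smul_absolutelyContinuous
  exact (measurePreserving_add_right (volume : Measure ℝ) d).quasiMeasurePreserving.comp h1

lemma ae_comp_tau {a : ℝ} (h0 : 0 < a) (h1 : a < 1) {P : UnitAddCircle → Prop}
    (h : ∀ᵐ ξ, P ξ) : ∀ᵐ ξ, P (tau a ξ) := by
  rw [ae_circle_iff] at h ⊢
  have h1' : 0 < 1 - a := by linarith
  filter_upwards [(quasiMeasurePreserving_affine (inv_ne_zero h0.ne') 0).ae h,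
    (quasiMeasurePreserving_affine (inv_ne_zero h1'.ne') (-((1 - a)⁻¹ * a))).ae h] with u hu hu' hm
  rw [tau_coe a hm]
  split_ifs with hlt
  · rw [add_zero] at hu
    refine hu ⟨mul_nonneg (by positivity) hm.1, ?_⟩
    rw [inv_mul_lt_iff₀ h0]; linarith
  · have e : (1 - a)⁻¹ * u + -((1 - a)⁻¹ * a) = (1 - a)⁻¹ * (u - a) := by ring
    rw [e] at hu'
    refine hu' ⟨mul_nonneg (by positivity) (by linarith), ?_⟩
    rw [inv_mul_lt_iff₀ h1']; linarith [hm.2]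

lemma ae_iterate_tau {a : ℝ} (h0 : 0 < a) (h1 : a < 1) {P : UnitAddCircle → Prop}
    (h : ∀ᵐ ξ, P ξ) : ∀ᵐ ξ, ∀ n, P ((tau a)^[n] ξ) := by
  rw [ae_all_iff]
  intro n
  induction n with
  | zero => exact h
  | succ n ih =>
    filter_upwards [ae_comp_tau h0 h1 ih] with ξ hξ
    rwa [Function.iterate_succ_apply]

/-- The maps `ξ ↦ branch a η (rep ξ)` are the inverse branches of `τ`. Being affine they pull null
sets back to null sets, so a property holding a.e. also holds at the chosen preimage of a.e. point.
-/
lemma ae_comp_branch {a : ℝ} (h0 : 0 < a) (h1 : a < 1) {P : UnitAddCircle → Prop}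
    (h : ∀ᵐ ξ, P ξ) (η : UnitAddCircle) :
    ∀ᵐ ξ, P ((branch a η (rep ξ) : ℝ) : UnitAddCircle) := by
  rw [ae_circle_iff] at h ⊢
  have hb : branch a η = fun u => sigma a η * u + branch a η 0 := by
    funext u; linarith [branch_sub a η u 0]
  filter_upwards [(quasiMeasurePreserving_affine (sigma_pos h0 h1 η).ne' (branch a η 0)).ae h]
    with u hu hm
  rw [rep_coe hm, hb]
  refine hu ?_
  have := branch_mem_Ico h0 h1 η hm
  rwa [hb] at this

/-- A forward invariant measurable set of the expanding map is null or conull. -/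
theorem null_or_conull_of_forward_invariant {a : ℝ} (h0 : 0 < a) (h1 : a < 1)
    {E : Set UnitAddCircle} (hE : MeasurableSet E) (hinv : ∀ ξ ∈ E, tau a ξ ∈ E) :
    (∀ᵐ ξ, ξ ∉ E) ∨ ∀ᵐ ξ, ξ ∈ E := by
  have h1' : 0 < 1 - a := by linarith
  set A : Set ℝ := Ico (0 : ℝ) 1 ∩ (fun u : ℝ => (u : UnitAddCircle)) ⁻¹' E with hAdef
  have hA : MeasurableSet A := measurableSet_Ico.inter (continuous_coe.measurable hE)
  have hAfin : ∀ B : Set ℝ, volume (A ∩ B) ≠ ⊤ := fun B =>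
    ((measure_mono (inter_subset_left.trans inter_subset_left)).trans_lt
      (by simp : volume (Ico (0 : ℝ) 1) < ⊤)).ne
  set F : ℝ → ℝ → ℝ := fun s t => (volume (A ∩ Ico s t)).toReal with hF
  have hadd : ∀ s t r, s ≤ t → t ≤ r → F s t + F t r = F s r := by
    intro s t r hst htr
    simp only [hF]
    rw [← ENNReal.toReal_add (hAfin _) (hAfin _), ← measure_union, ← inter_union_distrib_left,
      Ico_union_Ico_eq_Ico hst htr]
    · refine Disjoint.inter_left' _ (Disjoint.inter_right' _ ?_)
      rw [Set.disjoint_left]; rintro x ⟨_, h⟩ ⟨h', _⟩; linarith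
    · exact hA.inter measurableSet_Ico
  -- Forward invariance puts the part of `A` in a branch image inside the image of `A`, and the
  -- branch scales lengths by `σ`.
  have hscale : ∀ (η : UnitAddCircle) (s t : ℝ), 0 ≤ s → t ≤ 1 →
      F (branch a η s) (branch a η t) ≤ sigma a η * F s t := by
    intro η s t hs ht
    have hσ := sigma_pos h0 h1 η
    have hsub : A ∩ Ico (branch a η s) (branch a η t) ⊆
        (fun u => u + -branch a η 0) ⁻¹' ((fun u => (sigma a η)⁻¹ * u) ⁻¹' (A ∩ Ico s t)) := by
      rintro u ⟨⟨hu, huE⟩, hu1, hu2⟩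
      set v := (sigma a η)⁻¹ * (u + -branch a η 0) with hv
      have huv : branch a η v = u := by
        have := branch_sub a η v 0
        rw [sub_zero, hv, mul_inv_cancel_left₀ hσ.ne'] at this
        linarith
      have hsv : s ≤ v := by
        have := branch_sub a η v s
        rw [huv] at this
        by_contra! hc
        nlinarith
      have hvt : v < t := by
        have := branch_sub a η t v
        rw [huv] at this
        by_contra! hc
        nlinarith
      have hv1 : v ∈ Ico (0 : ℝ) 1 := ⟨hs.trans hsv, hvt.trans_le ht⟩
      refine ⟨⟨hv1, ?_⟩, hsv, hvt⟩
      have := hinv _ huE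
      simp only at this
      rwa [← huv, tau_branch_of_Ico h0 h1 η hv1] at this
    have hvol : volume ((fun u => u + -branch a η 0) ⁻¹'
        ((fun u => (sigma a η)⁻¹ * u) ⁻¹' (A ∩ Ico s t))) =
        ENNReal.ofReal (sigma a η) * volume (A ∩ Ico s t) := by
      rw [measure_preimage_add_right, Real.volume_preimage_mul_left (inv_ne_zero hσ.ne'), inv_inv,
        abs_of_pos hσ]
    have := (measure_mono hsub).trans_eq hvol
    calc F (branch a η s) (branch a η t)
        ≤ (ENNReal.ofReal (sigma a η) * volume (A ∩ Ico s t)).toReal :=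
          ENNReal.toReal_mono (ENNReal.mul_ne_top ENNReal.ofReal_ne_top (hAfin _)) this
      _ = sigma a η * F s t := by rw [ENNReal.toReal_mul, ENNReal.toReal_ofReal hσ.le]
  set m := F 0 1 with hm
  have hlow : ∀ s t, 0 ≤ s → t ≤ 1 → F (a * s) (a * t) ≤ a * F s t := by
    intro s t hs ht
    have := hscale 0 s t hs ht
    simpa only [branch, sigma, rep_zero, if_pos h0] using this
  have hup : ∀ s t, 0 ≤ s → t ≤ 1 →
      F (a + (1 - a) * s) (a + (1 - a) * t) ≤ (1 - a) * F s t := by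
    intro s t hs ht
    have := hscale (a : UnitAddCircle) s t hs ht
    simpa only [branch, sigma, rep_coe (⟨h0.le, h1⟩ : a ∈ Ico (0 : ℝ) 1), lt_irrefl,
      if_false] using this
  -- The upper bounds over complementary pieces add up to the total mass, so each of them is an
  -- equality.
  have heq : ∀ t ∈ Icc (0 : ℝ) 1, F 0 (a * t) = a * F 0 t ∧
      F 0 (a + (1 - a) * t) = a * m + (1 - a) * F 0 t := by
    rintro t ⟨ht0, ht1⟩
    have e1 := hlow 0 t le_rfl ht1
    have e2 := hlow t 1 ht0 le_rfl
    have e3 := hup 0 t le_rfl ht1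
    have e4 := hup t 1 ht0 le_rfl
    rw [mul_zero] at e1
    rw [mul_one] at e2
    rw [mul_zero, add_zero] at e3
    rw [mul_one, add_sub_cancel] at e4
    have s1 := hadd 0 (a * t) a (by positivity) (by nlinarith)
    have s2 := hadd a (a + (1 - a) * t) 1 (by nlinarith) (by nlinarith)
    have s3 := hadd 0 a 1 h0.le h1.le
    have s4 := hadd 0 t 1 ht0 ht1
    have s5 := hadd 0 a (a + (1 - a) * t) h0.le (by nlinarith)
    constructor
    · nlinarith
    · nlinarith
  -- By these equalities the deviation of the distribution function of `A` from a linear one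
  -- reproduces itself under both branches, scaled by `a` or `1 - a`; iteration forces it to vanish.
  have hGbound : ∀ n : ℕ, ∀ t ∈ Icc (0 : ℝ) 1, |F 0 t - m * t| ≤ (max a (1 - a)) ^ n := by
    have hm1 : ∀ t ∈ Icc (0 : ℝ) 1, 0 ≤ F 0 t ∧ F 0 t ≤ 1 := by
      rintro t ht
      refine ⟨ENNReal.toReal_nonneg, ?_⟩
      have : volume (A ∩ Ico 0 t) ≤ 1 := by
        refine (measure_mono (inter_subset_left.trans inter_subset_left)).trans ?_
        simp
      simpa using ENNReal.toReal_mono ENNReal.one_ne_top this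
    intro n
    induction n with
    | zero =>
      intro t ht
      have i1 := hm1 t ht
      have i2 := hm1 1 ⟨zero_le_one, le_rfl⟩
      rw [pow_zero, abs_le]
      have : 0 ≤ m * t := mul_nonneg i2.1 ht.1
      have : m * t ≤ 1 := mul_le_one₀ i2.2 ht.1 ht.2
      constructor <;> linarith
    | succ n ih =>
      intro t ht
      have hr : 0 ≤ (max a (1 - a)) ^ n := pow_nonneg (h0.le.trans (le_max_left _ _)) n
      rcases le_or_gt t a with h | h
      · have hs : a⁻¹ * t ∈ Icc (0 : ℝ) 1 := ⟨mul_nonneg (by positivity) ht.1, by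
          rw [inv_mul_le_iff₀ h0]; linarith⟩
        obtain ⟨e, -⟩ := heq _ hs
        rw [mul_inv_cancel_left₀ h0.ne'] at e
        have : F 0 t - m * t = a * (F 0 (a⁻¹ * t) - m * (a⁻¹ * t)) := by
          rw [e]; field_simp
        rw [this, abs_mul, abs_of_pos h0, pow_succ']
        exact mul_le_mul (le_max_left _ _) (ih _ hs) (abs_nonneg _)
          (h0.le.trans (le_max_left _ _))
      · have hs : (1 - a)⁻¹ * (t - a) ∈ Icc (0 : ℝ) 1 :=
          ⟨mul_nonneg (by positivity) (by linarith), by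
            rw [inv_mul_le_iff₀ h1']; linarith [ht.2]⟩
        obtain ⟨-, e⟩ := heq _ hs
        rw [mul_inv_cancel_left₀ h1'.ne', add_sub_cancel] at e
        have : F 0 t - m * t =
            (1 - a) * (F 0 ((1 - a)⁻¹ * (t - a)) - m * ((1 - a)⁻¹ * (t - a))) := by
          rw [e]; field_simp; ring
        rw [this, abs_mul, abs_of_pos h1', pow_succ']
        exact mul_le_mul (le_max_right _ _) (ih _ hs) (abs_nonneg _)
          (h0.le.trans (le_max_left _ _))
  have hG : ∀ t ∈ Icc (0 : ℝ) 1, F 0 t = m * t := by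
    intro t ht
    have hlim : Tendsto (fun n : ℕ => (max a (1 - a)) ^ n) atTop (𝓝 0) :=
      tendsto_pow_atTop_nhds_zero_of_lt_one (h0.le.trans (le_max_left _ _))
        (max_lt h1 (by linarith))
    have := ge_of_tendsto' hlim fun n => hGbound n t ht
    linarith [abs_eq_zero.1 (le_antisymm this (abs_nonneg _))]
  have hmeas : volume.restrict A = volume A • volume.restrict (Ico (0 : ℝ) 1) := by
    have hAtop : volume A ≠ ⊤ := by simpa using hAfin univ
    have : IsFiniteMeasure (volume.restrict A) := ⟨by
      rw [Measure.restrict_apply_univ]; exact hAtop.lt_top⟩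
    refine Measure.ext_of_Ici _ _ fun t => ?_
    rw [Measure.smul_apply, Measure.restrict_apply measurableSet_Ici,
      Measure.restrict_apply measurableSet_Ici, smul_eq_mul]
    have hmA : ENNReal.ofReal m = volume A := by
      rw [hm, hF]
      simp only
      rw [ENNReal.ofReal_toReal (hAfin _)]
      congr 1
      exact inter_eq_left.2 inter_subset_left
    rcases lt_or_ge t 0 with ht | ht
    · have i1 : A ⊆ Ici t := fun u hu => ht.le.trans hu.1.1
      have i2 : Ico (0 : ℝ) 1 ⊆ Ici t := fun u hu => ht.le.trans hu.1
      rw [inter_eq_right.2 i1, inter_eq_right.2 i2]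
      simp
    rcases lt_or_ge 1 t with ht1 | ht1
    · have e : ∀ B : Set ℝ, B ⊆ Ico (0 : ℝ) 1 → Ici t ∩ B = ∅ := by
        intro B hB
        rw [Set.eq_empty_iff_forall_notMem]
        rintro u ⟨hu, hu'⟩
        exact absurd (hB hu').2 (not_lt.2 (ht1.le.trans hu))
      rw [e A inter_subset_left, e _ Subset.rfl]; simp
    · have e1 : Ici t ∩ A = A ∩ Ico t 1 := by
        ext u
        constructor
        · rintro ⟨hu, hu'⟩; exact ⟨hu', hu, hu'.1.2⟩
        · rintro ⟨hu, hu'⟩; exact ⟨hu'.1, hu⟩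
      have e2 : Ici t ∩ Ico (0 : ℝ) 1 = Ico t 1 := by
        ext u
        constructor
        · rintro ⟨hu, hu'⟩; exact ⟨hu, hu'.2⟩
        · rintro ⟨hu, hu'⟩; exact ⟨hu, ht.trans hu, hu'⟩
      have e3 : F t 1 = m * (1 - t) := by
        have := hadd 0 t 1 ht ht1
        rw [hG t ⟨ht, ht1⟩] at this
        linarith
      rw [e1, e2, Real.volume_Ico, ← hmA, ← ENNReal.ofReal_mul ENNReal.toReal_nonneg, ← e3,
        ENNReal.ofReal_toReal (hAfin _)]
  -- `A` has constant density with respect to Lebesgue measure on `[0, 1)`. Testing this on `A`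
  -- itself leaves only the masses `0` and `1`.
  have hsq : volume A = volume A * volume A := by
    have := congrArg (fun μ => μ A) hmeas
    simp only [Measure.smul_apply, smul_eq_mul] at this
    rwa [Measure.restrict_apply hA, inter_self, Measure.restrict_apply hA,
      inter_eq_left.2 inter_subset_left] at this
  rcases eq_or_ne (volume A) 0 with hz | hz
  · left
    rw [ae_circle_iff]
    rw [measure_eq_zero_iff_ae_notMem] at hz
    filter_upwards [hz] with u hu hm hE'
    exact hu ⟨hm, hE'⟩
  · right
    have h1A : volume A = 1 := by
      have htop : volume A ≠ ⊤ := by simpa using hAfin univ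
      have := (ENNReal.mul_right_inj hz htop).1 ((mul_one _).trans hsq)
      exact this.symm
    have hdiff : volume (Ico (0 : ℝ) 1 \ A) = 0 := by
      rw [measure_sdiff inter_subset_left hA.nullMeasurableSet (by rw [h1A]; simp), h1A]
      simp
    rw [ae_circle_iff]
    rw [measure_eq_zero_iff_ae_notMem] at hdiff
    filter_upwards [hdiff] with u hu hm
    by_contra hE'
    exact hu ⟨hm, fun h => hE' h.2⟩

/-! ### Maps of negative Schwarzian derivative expand cross ratios -/

/-- The cross ratio of four points `p < z < y < s`. -/
def crossRatio (p z y s : ℝ) : ℝ := (s - p) * (y - z) / ((z - p) * (s - y))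

section Schwarzian

variable {g : ℝ → ℝ}

/-- The function `v = (g')^(-1/2)` satisfies `v'' = -S(g) v / 2 > 0`, so it is strictly convex. The
inequality is the strict tangent line inequality for `v`, integrated. -/
lemma sq_mul_deriv_lt (hg : ContDiff ℝ 3 g) (hpos : ∀ y, 0 < deriv g y)
    (hS : ∀ y, schwarzian g y < 0) {x y : ℝ} (hxy : x < y) :
    deriv g x * deriv g y * (y - x) ^ 2 < (g y - g x) ^ 2 := by
  have hd0 : ∀ y, HasDerivAt g (deriv g y) y := fun y =>
    (hg.differentiable (by norm_num) y).hasDerivAt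
  have hd1 : ∀ y, HasDerivAt (deriv g) (iteratedDeriv 2 g y) y := by
    intro y
    have := (hg.differentiable_iteratedDeriv 1 (by norm_num) y).hasDerivAt
    rw [iteratedDeriv_one] at this
    rw [iteratedDeriv_succ, iteratedDeriv_one]
    exact this
  have hd2 : ∀ y, HasDerivAt (iteratedDeriv 2 g) (iteratedDeriv 3 g y) y := by
    intro y
    have := (hg.differentiable_iteratedDeriv 2 (by norm_num) y).hasDerivAt
    rwa [← iteratedDeriv_succ] at this
  set v : ℝ → ℝ := fun y => (deriv g y) ^ (-(1 / 2) : ℝ) with hv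
  set w : ℝ → ℝ := fun y => -(1 / 2) * iteratedDeriv 2 g y * (deriv g y) ^ (-(3 / 2) : ℝ) with hw
  have hvpos : ∀ y, 0 < v y := fun y => Real.rpow_pos_of_pos (hpos y) _
  have hvsq : ∀ y, v y ^ 2 * deriv g y = 1 := by
    intro y
    rw [hv]
    simp only
    rw [← Real.rpow_natCast, ← Real.rpow_mul (hpos y).le]
    norm_num
    rw [Real.rpow_neg_one, inv_mul_cancel₀ (hpos y).ne']
  have hvd : ∀ y, HasDerivAt v (w y) y := by
    intro y
    have := (hd1 y).rpow_const (p := (-(1 / 2) : ℝ)) (Or.inl (hpos y).ne')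
    have e : (-(1 / 2) : ℝ) - 1 = -(3 / 2) := by norm_num
    rw [e] at this
    refine this.congr_deriv ?_
    rw [hw]
    ring
  have hwd : ∀ y, HasDerivAt w
      (-(1 / 2) * (deriv g y) ^ (-(1 / 2) : ℝ) * schwarzian g y) y := by
    intro y
    have h2 := (hd1 y).rpow_const (p := (-(3 / 2) : ℝ)) (Or.inl (hpos y).ne')
    have h3 := ((hd2 y).const_mul (-(1 / 2) : ℝ)).mul h2
    refine h3.congr_deriv ?_
    have e1 : (deriv g y) ^ (-(1 / 2) : ℝ) = (deriv g y) ^ (-(3 / 2) : ℝ) * deriv g y := by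
      rw [← Real.rpow_add_one (hpos y).ne']; norm_num
    have e2 : (deriv g y) ^ (-(3 / 2) : ℝ) = (deriv g y) ^ (-(3 / 2) - 1 : ℝ) * deriv g y := by
      rw [← Real.rpow_add_one (hpos y).ne']; norm_num
    have hne := (hpos y).ne'
    rw [schwarzian, e1, e2]
    field_simp
    ring
  have hwmono : StrictMono w := by
    refine strictMono_of_deriv_pos fun y => ?_
    rw [(hwd y).deriv]
    have : 0 < (deriv g y) ^ (-(1 / 2) : ℝ) := Real.rpow_pos_of_pos (hpos y) _
    nlinarith [hS y, mul_pos this (neg_pos.2 (hS y))]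
  -- Since `1 / v² = g'`, the claim is that `k y > 0`. Here `k x = 0`, and `k'` is a positive
  -- multiple of the amount by which the tangent at `y` fails to reach `v x`.
  set k : ℝ → ℝ := fun y => g y - g x - (y - x) * (v x)⁻¹ * (v y)⁻¹ with hk
  have hkd : ∀ y, HasDerivAt k
      (deriv g y - (1 * (v x)⁻¹ * (v y)⁻¹ + (y - x) * (v x)⁻¹ * (-w y / v y ^ 2))) y := by
    intro y
    exact ((hd0 y).sub_const _).sub
      ((((hasDerivAt_id y).sub_const x).mul_const _).mul ((hvd y).inv (hvpos y).ne'))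
  have hkmono : StrictMonoOn k (Ici x) := by
    refine strictMonoOn_of_deriv_pos (convex_Ici x)
      (fun y _ => (hkd y).continuousAt.continuousWithinAt) fun y hy => ?_
    rw [interior_Ici, mem_Ioi] at hy
    obtain ⟨c, hc, hslope⟩ := exists_hasDerivAt_eq_slope v w hy
      (fun y _ => (hvd y).continuousAt.continuousWithinAt) fun y _ => hvd y
    have hlt : v y - v x < w y * (y - x) := by
      have h1 : v y - v x = w c * (y - x) := by
        rw [hslope]; field_simp [(sub_pos.2 hy).ne']
      rw [h1]
      exact mul_lt_mul_of_pos_right (hwmono hc.2) (sub_pos.2 hy)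
    rw [(hkd y).deriv]
    have e : deriv g y - (1 * (v x)⁻¹ * (v y)⁻¹ + (y - x) * (v x)⁻¹ * (-w y / v y ^ 2)) =
        (v y ^ 2)⁻¹ * (v x)⁻¹ * (w y * (y - x) - (v y - v x)) := by
      have e1 : deriv g y = (v y ^ 2)⁻¹ := eq_inv_of_mul_eq_one_right (hvsq y)
      have hx := (hvpos x).ne'
      have hy := (hvpos y).ne'
      rw [e1]
      field_simp
      ring
    rw [e]
    have := hvpos x
    have := hvpos y
    have := sub_pos.2 hlt
    positivity
  have hkx : k x = 0 := by simp [hk]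
  have h1 := hkmono self_mem_Ici (mem_Ici.2 hxy.le) hxy
  rw [hkx, hk] at h1
  simp only at h1
  have h2 : (y - x) * (v x)⁻¹ * (v y)⁻¹ < g y - g x := by linarith
  have h3 : 0 ≤ (y - x) * (v x)⁻¹ * (v y)⁻¹ := by
    have := hvpos x
    have := hvpos y
    have := sub_pos.2 hxy
    positivity
  have h4 := pow_lt_pow_left₀ h2 h3 two_ne_zero
  have ex : deriv g x = (v x ^ 2)⁻¹ := eq_inv_of_mul_eq_one_right (hvsq x)
  have ey : deriv g y = (v y ^ 2)⁻¹ := eq_inv_of_mul_eq_one_right (hvsq y)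
  calc deriv g x * deriv g y * (y - x) ^ 2 = ((y - x) * (v x)⁻¹ * (v y)⁻¹) ^ 2 := by
        rw [ex, ey]; ring
    _ < _ := h4

/-- Integrating the infinitesimal inequality twice, once in each endpoint of the pair, gives
distortion of the cross ratio. -/
theorem crossRatio_lt (hg : ContDiff ℝ 3 g) (hpos : ∀ y, 0 < deriv g y)
    (hS : ∀ y, schwarzian g y < 0) {p z y s : ℝ} (hpz : p < z) (hzy : z < y) (hys : y < s) :
    crossRatio p z y s < crossRatio (g p) (g z) (g y) (g s) := by
  have hd0 : ∀ y, HasDerivAt g (deriv g y) y := fun y =>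
    (hg.differentiable (by norm_num) y).hasDerivAt
  have hmono : StrictMono g := strictMono_of_deriv_pos hpos
  have hΨ : ∀ x, StrictMonoOn (fun y => deriv g x / (g y - g x) - 1 / (y - x)) (Ioi x) := by
    intro x
    have hder : ∀ y ∈ Ioi x, HasDerivAt (fun y => deriv g x / (g y - g x) - 1 / (y - x))
        ((0 * (g y - g x) - deriv g x * deriv g y) / (g y - g x) ^ 2 -
          (0 * (y - x) - 1 * 1) / (y - x) ^ 2) y := by
      intro y hy
      exact ((hasDerivAt_const y _).div ((hd0 y).sub_const _) (sub_pos.2 (hmono hy)).ne').sub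
        ((hasDerivAt_const y _).div ((hasDerivAt_id y).sub_const _) (sub_pos.2 hy).ne')
    refine strictMonoOn_of_deriv_pos (convex_Ioi x)
      (fun y hy => (hder y hy).continuousAt.continuousWithinAt) fun y hy => ?_
    rw [interior_Ioi] at hy
    rw [(hder y hy).deriv]
    have h1 := sq_mul_deriv_lt hg hpos hS hy
    have h2 : 0 < y - x := sub_pos.2 hy
    have h3 : 0 < g y - g x := sub_pos.2 (hmono hy)
    have : deriv g x * deriv g y / (g y - g x) ^ 2 < 1 / (y - x) ^ 2 := by
      rw [div_lt_div_iff₀ (by positivity) (by positivity)]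
      linarith
    calc (0 : ℝ) < 1 / (y - x) ^ 2 - deriv g x * deriv g y / (g y - g x) ^ 2 := by linarith
      _ = _ := by ring
  -- The derivative of `Φ` at `x` is the increment from `y` to `s` of the increasing function in
  -- `hΨ`. Comparing `Φ p` with `Φ z` gives a companion cross ratio inequality, equivalent to the
  -- claim through `(s - z)(y - p) = (s - p)(y - z) + (z - p)(s - y)`.
  set Φ : ℝ → ℝ := fun x => Real.log (s - x) - Real.log (y - x) - Real.log (g s - g x) +
    Real.log (g y - g x) with hΦdef
  have hΦder : ∀ x ∈ Iio y, HasDerivAt Φ (-1 / (s - x) - -1 / (y - x) -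
      -deriv g x / (g s - g x) + -deriv g x / (g y - g x)) x := by
    intro x hx
    have hxs : x < s := lt_trans hx hys
    exact (((((hasDerivAt_id x).const_sub s).log (sub_pos.2 hxs).ne').sub
      (((hasDerivAt_id x).const_sub y).log (sub_pos.2 hx).ne')).sub
      (((hd0 x).const_sub _).log (sub_pos.2 (hmono hxs)).ne')).add
      (((hd0 x).const_sub _).log (sub_pos.2 (hmono hx)).ne')
  have hΦ : StrictMonoOn Φ (Iio y) := by
    refine strictMonoOn_of_deriv_pos (convex_Iio y)
      (fun x hx => (hΦder x hx).continuousAt.continuousWithinAt) fun x hx => ?_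
    rw [interior_Iio] at hx
    rw [(hΦder x hx).deriv]
    have := hΨ x (mem_Ioi.2 hx) (mem_Ioi.2 (lt_trans hx hys)) hys
    simp only at this
    calc (0 : ℝ) < (deriv g x / (g s - g x) - 1 / (s - x)) -
        (deriv g x / (g y - g x) - 1 / (y - x)) := by linarith
      _ = _ := by ring
  have h1 := hΦ (mem_Iio.2 (hpz.trans hzy)) (mem_Iio.2 hzy) hpz
  have a1 : 0 < s - p := by linarith
  have a2 : 0 < y - p := by linarith
  have a3 : 0 < s - z := by linarith
  have a4 : 0 < y - z := by linarith
  have a5 : 0 < z - p := by linarith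
  have a6 : 0 < s - y := by linarith
  have b1 : 0 < g s - g p := sub_pos.2 (hmono (by linarith))
  have b2 : 0 < g y - g p := sub_pos.2 (hmono (by linarith))
  have b3 : 0 < g s - g z := sub_pos.2 (hmono (by linarith))
  have b4 : 0 < g y - g z := sub_pos.2 (hmono (by linarith))
  have b5 : 0 < g z - g p := sub_pos.2 (hmono (by linarith))
  have b6 : 0 < g s - g y := sub_pos.2 (hmono (by linarith))
  have h2 : Real.log ((s - p) * (y - z) * ((g y - g p) * (g s - g z))) <
      Real.log ((s - z) * (y - p) * ((g y - g z) * (g s - g p))) := by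
    rw [Real.log_mul (by positivity) (by positivity), Real.log_mul (by positivity) (by positivity),
      Real.log_mul (by positivity) (by positivity), Real.log_mul (by positivity) (by positivity),
      Real.log_mul (by positivity) (by positivity), Real.log_mul (by positivity) (by positivity)]
    simp only [hΦdef] at h1
    linarith
  have h3 := (Real.log_lt_log_iff (by positivity) (by positivity)).1 h2
  rw [crossRatio, crossRatio, div_lt_div_iff₀ (by positivity) (by positivity)]
  nlinarith

end Schwarzian

section

variable {a : ℝ} {f : UnitAddCircle → ℝ → ℝ} {s' s t t' : ℝ}

/-! ### The bounding graphs of the global attractor -/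


/-- The fibre map `f_{τ x} ∘ f_{τ² x} ∘ ⋯ ∘ f_{τⁿ x}` of the `n`-th iterate of the skew product that
ends over `x`. -/
def pullback (a : ℝ) (f : UnitAddCircle → ℝ → ℝ) : ℕ → UnitAddCircle → ℝ → ℝ
  | 0, _, z => z
  | n + 1, x, z => f (tau a x) (pullback a f n (tau a x) z)

lemma pullback_succ' (n : ℕ) (x : UnitAddCircle) (z : ℝ) :
    pullback a f (n + 1) x z = pullback a f n x (f ((tau a)^[n + 1] x) z) := by
  induction n generalizing x with
  | zero => rfl
  | succ n ih =>
    rw [pullback, ih, pullback, Function.iterate_succ_apply _ (n + 1)]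

lemma mem_range_skew_iterate (h0 : 0 < a) (h1 : a < 1) (n : ℕ)
    (θ : UnitAddCircle × UnitAddCircle) (y : ℝ) :
    (θ, y) ∈ (skew a f)^[n] '' univ ↔ ∃ z, pullback a f n θ.2 z = y := by
  induction n generalizing θ y with
  | zero => simp [pullback]
  | succ n ih =>
    rw [Function.iterate_succ', image_comp]
    constructor
    · rintro ⟨⟨θ', y'⟩, hp, he⟩
      obtain ⟨z, hz⟩ := (ih θ' y').1 hp
      simp only [skew, Prod.mk.injEq] at he
      refine ⟨z, ?_⟩
      rw [pullback, ← he.1, tau_baker h0 h1, hz, he.2]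
    · rintro ⟨z, hz⟩
      obtain ⟨θ', hb, hθ'⟩ := exists_baker_eq h0 h1 θ
      refine ⟨(θ', pullback a f n θ'.2 z), (ih _ _).2 ⟨z, rfl⟩, ?_⟩
      simp only [skew, Prod.mk.injEq]
      refine ⟨hb, ?_⟩
      rw [← hz, pullback, hθ']

lemma Standing.strictMono (hf : Standing a f s' s t t') (x : UnitAddCircle) :
    StrictMono (f x) := strictMono_of_deriv_pos (hf.deriv_pos x)

lemma Standing.continuous_fibre (hf : Standing a f s' s t t') (x : UnitAddCircle) :
    Continuous (f x) := 
  hf.continuous_f.comp (by fun_prop : Continuous fun y : ℝ => (x, y))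

lemma continuous_pullback (hf : Standing a f s' s t t') (n : ℕ) :
    Continuous fun p : UnitAddCircle × ℝ => pullback a f n p.1 p.2 := by
  induction n with
  | zero => exact continuous_snd
  | succ n ih =>
    have hτ : Continuous fun p : UnitAddCircle × ℝ => tau a p.1 :=
      (continuous_tau hf.a_pos hf.a_lt_one).comp continuous_fst
    exact hf.continuous_f.comp (hτ.prodMk (ih.comp (hτ.prodMk continuous_snd)))

lemma strictMono_pullback (hf : Standing a f s' s t t') (n : ℕ) (x : UnitAddCircle) :
    StrictMono (pullback a f n x) := by
  induction n generalizing x with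
  | zero => exact strictMono_id
  | succ n ih => exact (hf.strictMono _).comp (ih _)

/-- One fibre map already squeezes the line into `[-M, M]`, so the ranges of the pullbacks may be
replaced by their images of this interval; the converse is the intermediate value theorem. -/
lemma mem_globalAttractor_iff (hf : Standing a f s' s t t') {M : ℝ} (hM : ∀ x y, |f x y| ≤ M)
    (θ : UnitAddCircle × UnitAddCircle) (y : ℝ) :
    (θ, y) ∈ globalAttractor a f ↔
      ∀ n, pullback a f n θ.2 (-M) ≤ y ∧ y ≤ pullback a f n θ.2 M := by
  simp only [globalAttractor, mem_iInter, mem_range_skew_iterate hf.a_pos hf.a_lt_one]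
  constructor
  · intro h n
    obtain ⟨z, rfl⟩ := h (n + 1)
    rw [pullback_succ']
    exact ⟨(strictMono_pullback hf n _).monotone (abs_le.1 (hM _ _)).1,
      (strictMono_pullback hf n _).monotone (abs_le.1 (hM _ _)).2⟩
  · intro h n
    exact mem_range_of_exists_le_of_exists_ge
      ((continuous_pullback hf n).comp (by fun_prop : Continuous fun z : ℝ => (θ.2, z)))
      ⟨_, (h n).1⟩ ⟨_, (h n).2⟩

lemma pullback_neg_le (hf : Standing a f s' s t t') {M : ℝ} (hM : ∀ x y, |f x y| ≤ M)
    (x : UnitAddCircle) (m n : ℕ) : pullback a f m x (-M) ≤ pullback a f n x M := by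
  have hM0 : 0 ≤ M := (abs_nonneg _).trans (hM 0 0)
  have hanti : Antitone fun n => pullback a f n x M := antitone_nat_of_succ_le fun n => by
    rw [pullback_succ']
    exact (strictMono_pullback hf n x).monotone (abs_le.1 (hM _ _)).2
  have hmono : Monotone fun n => pullback a f n x (-M) := monotone_nat_of_le_succ fun n => by
    rw [pullback_succ']
    exact (strictMono_pullback hf n x).monotone (abs_le.1 (hM _ _)).1
  calc pullback a f m x (-M) ≤ pullback a f (max m n) x (-M) := hmono (le_max_left _ _)
    _ ≤ pullback a f (max m n) x M := (strictMono_pullback hf _ x).monotone (by linarith)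
    _ ≤ _ := hanti (le_max_right _ _)

lemma isGreatest_attractor (hf : Standing a f s' s t t') {M : ℝ} (hM : ∀ x y, |f x y| ≤ M)
    (θ : UnitAddCircle × UnitAddCircle) :
    IsGreatest {y | (θ, y) ∈ globalAttractor a f} (⨅ n, pullback a f n θ.2 M) := by
  have hb : BddBelow (range fun n => pullback a f n θ.2 M) :=
    ⟨pullback a f 0 θ.2 (-M), by rintro _ ⟨n, rfl⟩; exact pullback_neg_le hf hM _ _ _⟩
  constructor
  · rw [mem_ofPred_eq, mem_globalAttractor_iff hf hM]
    exact fun n => ⟨le_ciInf fun m => pullback_neg_le hf hM _ _ _, ciInf_le hb n⟩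
  · intro y hy
    rw [mem_ofPred_eq, mem_globalAttractor_iff hf hM] at hy
    exact le_ciInf fun n => (hy n).2

lemma isLeast_attractor (hf : Standing a f s' s t t') {M : ℝ} (hM : ∀ x y, |f x y| ≤ M)
    (θ : UnitAddCircle × UnitAddCircle) :
    IsLeast {y | (θ, y) ∈ globalAttractor a f} (⨆ n, pullback a f n θ.2 (-M)) := by
  have hb : BddAbove (range fun n => pullback a f n θ.2 (-M)) :=
    ⟨pullback a f 0 θ.2 M, by rintro _ ⟨n, rfl⟩; exact pullback_neg_le hf hM _ _ _⟩
  constructor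
  · rw [mem_ofPred_eq, mem_globalAttractor_iff hf hM]
    exact fun n => ⟨le_ciSup hb n, ciSup_le fun m => pullback_neg_le hf hM _ _ _⟩
  · intro y hy
    rw [mem_ofPred_eq, mem_globalAttractor_iff hf hM] at hy
    exact ciSup_le fun n => (hy n).1

lemma phiPlus_isGreatest (hf : Standing a f s' s t t') (θ : UnitAddCircle × UnitAddCircle) :
    IsGreatest {y | (θ, y) ∈ globalAttractor a f} (phiPlus a f θ) := by
  obtain ⟨M, hM⟩ := hf.bounded
  have h := isGreatest_attractor hf hM θ
  rwa [phiPlus, h.csSup_eq]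

lemma phiMinus_isLeast (hf : Standing a f s' s t t') (θ : UnitAddCircle × UnitAddCircle) :
    IsLeast {y | (θ, y) ∈ globalAttractor a f} (phiMinus a f θ) := by
  obtain ⟨M, hM⟩ := hf.bounded
  have h := isLeast_attractor hf hM θ
  rwa [phiMinus, h.csInf_eq]

lemma phiMinus_le_phiPlus (hf : Standing a f s' s t t') (θ : UnitAddCircle × UnitAddCircle) :
    phiMinus a f θ ≤ phiPlus a f θ := (phiMinus_isLeast hf θ).2 (phiPlus_isGreatest hf θ).1

lemma mem_globalAttractor_baker_iff (hf : Standing a f s' s t t')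
    (θ : UnitAddCircle × UnitAddCircle) (y : ℝ) :
    (baker a θ, y) ∈ globalAttractor a f ↔ ∃ z, (θ, z) ∈ globalAttractor a f ∧ f θ.2 z = y := by
  obtain ⟨M, hM⟩ := hf.bounded
  have hp : ∀ n z, pullback a f (n + 1) (baker a θ).2 z = f θ.2 (pullback a f n θ.2 z) := by
    intro n z
    rw [pullback, tau_baker hf.a_pos hf.a_lt_one]
  simp only [mem_globalAttractor_iff hf hM]
  constructor
  · intro h
    have h' := fun n => h (n + 1)
    simp only [hp] at h'
    obtain ⟨z, rfl⟩ := mem_range_of_exists_le_of_exists_ge (hf.continuous_fibre θ.2)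
      ⟨_, (h' 0).1⟩ ⟨_, (h' 0).2⟩
    exact ⟨z, fun n => ⟨(hf.strictMono _).le_iff_le.1 (h' n).1,
      (hf.strictMono _).le_iff_le.1 (h' n).2⟩, rfl⟩
  · rintro ⟨z, hz, rfl⟩ n
    cases n with
    | zero => exact abs_le.1 (hM _ _)
    | succ n =>
      rw [hp, hp]
      exact ⟨(hf.strictMono _).monotone (hz n).1, (hf.strictMono _).monotone (hz n).2⟩

lemma phiPlus_baker (hf : Standing a f s' s t t') (θ : UnitAddCircle × UnitAddCircle) :
    phiPlus a f (baker a θ) = f θ.2 (phiPlus a f θ) := by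
  refine (phiPlus_isGreatest hf _).unique ⟨?_, ?_⟩
  · exact (mem_globalAttractor_baker_iff hf _ _).2 ⟨_, (phiPlus_isGreatest hf θ).1, rfl⟩
  · intro y hy
    obtain ⟨z, hz, rfl⟩ := (mem_globalAttractor_baker_iff hf _ _).1 hy
    exact (hf.strictMono _).monotone ((phiPlus_isGreatest hf θ).2 hz)

lemma phiMinus_baker (hf : Standing a f s' s t t') (θ : UnitAddCircle × UnitAddCircle) :
    phiMinus a f (baker a θ) = f θ.2 (phiMinus a f θ) := by
  refine (phiMinus_isLeast hf _).unique ⟨?_, ?_⟩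
  · exact (mem_globalAttractor_baker_iff hf _ _).2 ⟨_, (phiMinus_isLeast hf θ).1, rfl⟩
  · intro y hy
    obtain ⟨z, hz, rfl⟩ := (mem_globalAttractor_baker_iff hf _ _).1 hy
    exact (hf.strictMono _).monotone ((phiMinus_isLeast hf θ).2 hz)

/-- Pullbacks ending over a base point involve only the `τ`-orbit of its second coordinate, so `φ⁺`
does not see `ξ`. -/
lemma phiPlus_congr (hf : Standing a f s' s t t') {θ θ' : UnitAddCircle × UnitAddCircle}
    (h : θ.2 = θ'.2) : phiPlus a f θ = phiPlus a f θ' := by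
  obtain ⟨M, hM⟩ := hf.bounded
  have e : ∀ θ, phiPlus a f θ = ⨅ n, pullback a f n θ.2 M := fun θ =>
    (phiPlus_isGreatest hf θ).unique (isGreatest_attractor hf hM θ)
  rw [e, e, h]

lemma phiMinus_congr (hf : Standing a f s' s t t') {θ θ' : UnitAddCircle × UnitAddCircle}
    (h : θ.2 = θ'.2) : phiMinus a f θ = phiMinus a f θ' := by
  obtain ⟨M, hM⟩ := hf.bounded
  have e : ∀ θ, phiMinus a f θ = ⨆ n, pullback a f n θ.2 (-M) := fun θ =>
    (phiMinus_isLeast hf θ).unique (isLeast_attractor hf hM θ)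
  rw [e, e, h]

lemma phiPlus_tau (hf : Standing a f s' s t t') (x : UnitAddCircle) :
    phiPlus a f (0, x) = f (tau a x) (phiPlus a f (0, tau a x)) := by
  obtain ⟨θ', hb, hθ'⟩ := exists_baker_eq hf.a_pos hf.a_lt_one (0, x)
  rw [← hb, phiPlus_baker hf, hθ']
  exact congrArg _ (phiPlus_congr hf hθ')

lemma phiMinus_tau (hf : Standing a f s' s t t') (x : UnitAddCircle) :
    phiMinus a f (0, x) = f (tau a x) (phiMinus a f (0, tau a x)) := by
  obtain ⟨θ', hb, hθ'⟩ := exists_baker_eq hf.a_pos hf.a_lt_one (0, x)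
  rw [← hb, phiMinus_baker hf, hθ']
  exact congrArg _ (phiMinus_congr hf hθ')

/-! ### Semicontinuity and measurability of the bounding graphs. -/

lemma upperSemicontinuous_phiPlus (hf : Standing a f s' s t t') :
    UpperSemicontinuous fun x : UnitAddCircle => phiPlus a f (0, x) := by
  obtain ⟨M, hM⟩ := hf.bounded
  have e : (fun x : UnitAddCircle => phiPlus a f (0, x)) = fun x => ⨅ n, pullback a f n x M :=
    funext fun x => (phiPlus_isGreatest hf (0, x)).unique (isGreatest_attractor hf hM (0, x))
  rw [e]
  refine upperSemicontinuous_ciInf (fun x => ⟨pullback a f 0 x (-M), ?_⟩) fun n =>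
    ((continuous_pullback hf n).comp
      (by fun_prop : Continuous fun x : UnitAddCircle => (x, M))).upperSemicontinuous
  rintro _ ⟨n, rfl⟩
  exact pullback_neg_le hf hM _ _ _

lemma lowerSemicontinuous_phiMinus (hf : Standing a f s' s t t') :
    LowerSemicontinuous fun x : UnitAddCircle => phiMinus a f (0, x) := by
  obtain ⟨M, hM⟩ := hf.bounded
  have e : (fun x : UnitAddCircle => phiMinus a f (0, x)) = fun x => ⨆ n, pullback a f n x (-M) :=
    funext fun x => (phiMinus_isLeast hf (0, x)).unique (isLeast_attractor hf hM (0, x))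
  rw [e]
  refine lowerSemicontinuous_ciSup (fun x => ⟨pullback a f 0 x M, ?_⟩) fun n =>
    ((continuous_pullback hf n).comp
      (by fun_prop : Continuous fun x : UnitAddCircle => (x, -M))).lowerSemicontinuous
  rintro _ ⟨n, rfl⟩
  exact pullback_neg_le hf hM _ _ _

lemma measurable_phiPlus (hf : Standing a f s' s t t') : Measurable (phiPlus a f) := by
  have e : phiPlus a f = (fun x => phiPlus a f (0, x)) ∘ Prod.snd :=
    funext fun θ => phiPlus_congr hf rfl
  rw [e]
  exact (upperSemicontinuous_phiPlus hf).measurable.comp measurable_snd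

lemma measurable_phiMinus (hf : Standing a f s' s t t') : Measurable (phiMinus a f) := by
  have e : phiMinus a f = (fun x => phiMinus a f (0, x)) ∘ Prod.snd :=
    funext fun θ => phiMinus_congr hf rfl
  rw [e]
  exact (lowerSemicontinuous_phiMinus hf).measurable.comp measurable_snd

end

section

variable {a : ℝ} {f : UnitAddCircle → ℝ → ℝ} {s' s t t' : ℝ}

/-! ### Estimates for the fibre maps on `J` -/

/-- The fibre maps as a function on the plane, periodic in the first variable. -/
def planeMap (f : UnitAddCircle → ℝ → ℝ) (p : ℝ × ℝ) : ℝ := f (p.1 : UnitAddCircle) p.2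

/-- The derivative of the fibre maps in the base direction. -/
def baseDeriv (f : UnitAddCircle → ℝ → ℝ) (u y : ℝ) : ℝ :=
  deriv (fun v : ℝ => f (v : UnitAddCircle) y) u

lemma Standing.s'_lt_t' (hf : Standing a f s' s t t') : s' < t' :=
  hf.s'_lt_s.trans (hf.s_le_t.trans_lt hf.t_lt_t')

lemma Standing.mem_J (hf : Standing a f s' s t t') {y : ℝ} (hy : y ∈ Icc s t) : y ∈ Icc s' t' :=
  ⟨hf.s'_lt_s.le.trans hy.1, hy.2.trans hf.t_lt_t'.le⟩

lemma Standing.mapsTo_Icc (hf : Standing a f s' s t t') (x : UnitAddCircle) {y : ℝ}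
    (hy : y ∈ Icc s' t') : f x y ∈ Icc s t := Ioo_subset_Icc_self (hf.mapsTo_J x y hy)

lemma Standing.uniqueDiffOn (hf : Standing a f s' s t t') :
    UniqueDiffOn ℝ ((univ : Set ℝ) ×ˢ Icc s' t') :=
  uniqueDiffOn_univ.prod (uniqueDiffOn_Icc hf.s'_lt_t')

lemma Standing.hasFDerivWithinAt (hf : Standing a f s' s t t') {u y : ℝ} (hy : y ∈ Icc s' t') :
    HasFDerivWithinAt (planeMap f)
      (fderivWithin ℝ (planeMap f) (univ ×ˢ Icc s' t') (u, y)) (univ ×ˢ Icc s' t') (u, y) :=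
  ((hf.contDiffOn_J.differentiableOn two_ne_zero) (u, y) ⟨mem_univ _, hy⟩).hasFDerivWithinAt

/-- At the ends of `J` only a derivative within the strip is available. Since `J` has unique
derivatives, it still agrees with the two-sided derivative of the fibre map. -/
lemma Standing.fderivWithin_apply (hf : Standing a f s' s t t') {u y : ℝ} (hy : y ∈ Icc s' t')
    (p : ℝ × ℝ) :
    fderivWithin ℝ (planeMap f) (univ ×ˢ Icc s' t') (u, y) p =
      baseDeriv f u y * p.1 + deriv (f u) y * p.2 := by
  set D := fderivWithin ℝ (planeMap f) (univ ×ˢ Icc s' t') (u, y) with hD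
  have h := hf.hasFDerivWithinAt (u := u) hy
  have h1 : D (1, 0) = baseDeriv f u y := by
    have hm : MapsTo (fun v : ℝ => (v, y)) univ (univ ×ˢ Icc s' t') :=
      fun v _ => ⟨mem_univ _, hy⟩
    have hd : HasDerivWithinAt (fun v : ℝ => (v, y)) (1, 0) univ u :=
      (hasDerivAt_id u).hasDerivWithinAt.prodMk (hasDerivWithinAt_const u univ y)
    have := HasFDerivWithinAt.comp_hasDerivWithinAt u h hd hm
    rw [hasDerivWithinAt_univ] at this
    exact this.deriv.symm
  have h2 : D (0, 1) = deriv (f u) y := by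
    have hm : MapsTo (fun v : ℝ => (u, v)) (Icc s' t') (univ ×ˢ Icc s' t') :=
      fun v hv => ⟨mem_univ _, hv⟩
    have hd : HasDerivWithinAt (fun v : ℝ => (u, v)) (0, 1) (Icc s' t') y :=
      (hasDerivWithinAt_const y _ u).prodMk (hasDerivAt_id y).hasDerivWithinAt
    have h2' := HasFDerivWithinAt.comp_hasDerivWithinAt y h hd hm
    have h3 : HasDerivWithinAt (f u) (deriv (f u) y) (Icc s' t') y :=
      ((hf.contDiff_fibre u).differentiable (by norm_num) y).hasDerivAt.hasDerivWithinAt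
    exact (uniqueDiffOn_Icc hf.s'_lt_t' y hy).eq_deriv _ h2' h3
  have e : p = p.1 • ((1, 0) : ℝ × ℝ) + p.2 • ((0, 1) : ℝ × ℝ) := by ext <;> simp
  conv_lhs => rw [e]
  rw [map_add, map_smul, map_smul, h1, h2, smul_eq_mul, smul_eq_mul]
  ring

lemma norm_pair_le (u y : ℝ) : ‖((u, y) : ℝ × ℝ)‖ ≤ |u| + |y| := by
  rw [Prod.norm_def]
  exact max_le (le_add_of_nonneg_right (abs_nonneg y)) (le_add_of_nonneg_left (abs_nonneg u))

lemma Standing.exists_fderivWithin_bounds (hf : Standing a f s' s t t') :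
    ∃ C, 0 ≤ C ∧ ∀ p ∈ Icc (0 : ℝ) 1 ×ˢ Icc s' t', ∀ q ∈ Icc (0 : ℝ) 1 ×ˢ Icc s' t',
      ‖fderivWithin ℝ (planeMap f) (univ ×ˢ Icc s' t') p‖ ≤ C ∧
      ‖fderivWithin ℝ (planeMap f) (univ ×ˢ Icc s' t') q -
        fderivWithin ℝ (planeMap f) (univ ×ˢ Icc s' t') p‖ ≤ C * ‖q - p‖ := by
  set S : Set (ℝ × ℝ) := univ ×ˢ Icc s' t' with hS
  set B : Set (ℝ × ℝ) := Icc (0 : ℝ) 1 ×ˢ Icc s' t' with hB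
  have hBS : B ⊆ S := prod_mono (subset_univ _) Subset.rfl
  have hBc : IsCompact B := isCompact_Icc.prod isCompact_Icc
  have hBconv : Convex ℝ B := (convex_Icc _ _).prod (convex_Icc _ _)
  have hD : ContDiffOn ℝ 1 (fun p => fderivWithin ℝ (planeMap f) S p) S :=
    hf.contDiffOn_J.fderivWithin hf.uniqueDiffOn (by norm_num)
  obtain ⟨C₁, hC₁⟩ := hBc.exists_bound_of_continuousOn (hD.continuousOn.mono hBS)
  have hD2 : ContinuousOn (fun p => fderivWithin ℝ (fun p => fderivWithin ℝ (planeMap f) S p) S p)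
      S := hD.continuousOn_fderivWithin hf.uniqueDiffOn le_rfl
  obtain ⟨C₂, hC₂⟩ := hBc.exists_bound_of_continuousOn
    (f := fun p => fderivWithin ℝ (fun p => fderivWithin ℝ (planeMap f) S p) S p) (hD2.mono hBS)
  refine ⟨max 0 (max C₁ C₂), le_max_left _ _, fun p hp q hq => ⟨?_, ?_⟩⟩
  · exact (hC₁ p hp).trans ((le_max_left _ _).trans (le_max_right _ _))
  · refine hBconv.norm_image_sub_le_of_norm_hasFDerivWithin_le
      (f' := fun p => fderivWithin ℝ (fun p => fderivWithin ℝ (planeMap f) S p) S p)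
      (fun x hx => ?_) (fun x hx => ?_) hp hq
    · exact ((hD.differentiableOn one_ne_zero) x (hBS hx)).hasFDerivWithinAt.mono hBS
    · exact (hC₂ x hx).trans ((le_max_right _ _).trans (le_max_right _ _))

lemma Standing.exists_lipschitz (hf : Standing a f s' s t t') :
    ∃ C, 0 ≤ C ∧ ∀ u ∈ Icc (0 : ℝ) 1, ∀ v ∈ Icc (0 : ℝ) 1, ∀ y ∈ Icc s' t', ∀ z ∈ Icc s' t',
      |f v z - f u y| ≤ C * (|v - u| + |z - y|) := by
  obtain ⟨C, hC0, hC⟩ := hf.exists_fderivWithin_bounds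
  refine ⟨C, hC0, fun u hu v hv y hy z hz => ?_⟩
  have hBconv : Convex ℝ (Icc (0 : ℝ) 1 ×ˢ Icc s' t') := (convex_Icc _ _).prod (convex_Icc _ _)
  have := hBconv.norm_image_sub_le_of_norm_hasFDerivWithin_le (f := planeMap f)
    (f' := fun p => fderivWithin ℝ (planeMap f) (univ ×ˢ Icc s' t') p) (C := C)
    (fun x hx => (hf.hasFDerivWithinAt hx.2).mono (prod_mono (subset_univ _) Subset.rfl))
    (fun x hx => (hC x hx x hx).1) (x := (u, y)) (y := (v, z)) ⟨hu, hy⟩ ⟨hv, hz⟩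
  refine this.trans (mul_le_mul_of_nonneg_left ?_ hC0)
  exact norm_pair_le (v - u) (z - y)

lemma Standing.exists_taylor (hf : Standing a f s' s t t') :
    ∃ C, 0 ≤ C ∧ ∀ u ∈ Icc (0 : ℝ) 1, ∀ v ∈ Icc (0 : ℝ) 1, ∀ y ∈ Icc s' t', ∀ z ∈ Icc s' t',
      |f v z - f u y - (baseDeriv f u y * (v - u) + deriv (f u) y * (z - y))| ≤
        C * (|v - u| + |z - y|) ^ 2 := by
  obtain ⟨C, hC0, hC⟩ := hf.exists_fderivWithin_bounds
  refine ⟨C, hC0, fun u hu v hv y hy z hz => ?_⟩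
  have hBconv : Convex ℝ (Icc (0 : ℝ) 1 ×ˢ Icc s' t') := (convex_Icc _ _).prod (convex_Icc _ _)
  have hp : ((u, y) : ℝ × ℝ) ∈ Icc (0 : ℝ) 1 ×ˢ Icc s' t' := ⟨hu, hy⟩
  have hq : ((v, z) : ℝ × ℝ) ∈ Icc (0 : ℝ) 1 ×ˢ Icc s' t' := ⟨hv, hz⟩
  have hseg := hBconv.segment_subset hp hq
  have := (convex_segment (u, y) (v, z)).norm_image_sub_le_of_norm_hasFDerivWithin_le'
    (f := planeMap f)
    (f' := fun p => fderivWithin ℝ (planeMap f) (univ ×ˢ Icc s' t') p)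
    (φ := fderivWithin ℝ (planeMap f) (univ ×ˢ Icc s' t') (u, y))
    (C := C * ‖((v, z) : ℝ × ℝ) - (u, y)‖)
    (fun x hx => (hf.hasFDerivWithinAt (hseg hx).2).mono
      (hseg.trans (prod_mono (subset_univ _) Subset.rfl)))
    (fun x hx => ((hC (u, y) hp x (hseg hx)).2).trans
      (mul_le_mul_of_nonneg_left (norm_sub_le_of_mem_segment hx) hC0))
    (left_mem_segment ℝ _ _) (right_mem_segment ℝ _ _)
  rw [hf.fderivWithin_apply hy] at this
  refine this.trans ?_
  rw [mul_assoc, ← sq]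
  refine mul_le_mul_of_nonneg_left (pow_le_pow_left₀ (norm_nonneg _) ?_ 2) hC0
  exact norm_pair_le (v - u) (z - y)

/-- In the hypothesis the rate and the fibre are tied by `τ`. Every pair of a rate `σ(ξ)` and a
fibre `x` occurs, at the preimage of `x` in the branch selected by `ξ`, so the bound decouples. -/
lemma Standing.exists_expansion (hf : Standing a f s' s t t') :
    ∃ c, 1 < c ∧ ∀ x ξ, ∀ y ∈ Icc s' t', c * sigma a ξ ≤ deriv (f x) y := by
  obtain ⟨c, hc, h⟩ := hf.partially_hyperbolic
  refine ⟨c, hc, fun x ξ y hy => ?_⟩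
  have h' := h ((branch a ξ (rep x) : ℝ) : UnitAddCircle) y hy
  rw [sigma_branch hf.a_pos hf.a_lt_one ξ (rep_mem x),
    tau_branch_of_Ico hf.a_pos hf.a_lt_one ξ (rep_mem x), coe_rep] at h'
  have hσ := sigma_pos hf.a_pos hf.a_lt_one ξ
  rw [inv_mul_eq_div, le_div_iff₀ hσ] at h'
  exact h'

lemma Standing.mul_sub_le (hf : Standing a f s' s t t') {κ : ℝ} {x : UnitAddCircle}
    (h : ∀ y ∈ Icc s' t', κ ≤ deriv (f x) y) {y z : ℝ} (hy : y ∈ Icc s' t') (hz : z ∈ Icc s' t')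
    (hyz : y ≤ z) : κ * (z - y) ≤ f x z - f x y := by
  have hd := (hf.contDiff_fibre x).differentiable (by norm_num)
  exact (convex_Icc s' t').mul_sub_le_image_sub_of_le_deriv hd.continuous.continuousOn
    hd.differentiableOn (fun w hw => h w (interior_subset hw)) y hy z hz hyz

/-! ### Fibre orbits and the separating graph -/

/-- The second coordinate of the `n`-th iterate of the skew product. -/
def orbit (a : ℝ) (f : UnitAddCircle → ℝ → ℝ) (n : ℕ) (θ : UnitAddCircle × UnitAddCircle)
    (y : ℝ) : ℝ := ((skew a f)^[n] (θ, y)).2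

lemma skew_iterate_fst (n : ℕ) (θ : UnitAddCircle × UnitAddCircle) (y : ℝ) :
    ((skew a f)^[n] (θ, y)).1 = (baker a)^[n] θ := by
  induction n with
  | zero => rfl
  | succ n ih => rw [Function.iterate_succ_apply', Function.iterate_succ_apply', ← ih]; rfl

lemma orbit_zero (θ : UnitAddCircle × UnitAddCircle) (y : ℝ) : orbit a f 0 θ y = y := rfl

lemma orbit_succ (n : ℕ) (θ : UnitAddCircle × UnitAddCircle) (y : ℝ) :
    orbit a f (n + 1) θ y = f ((baker a)^[n] θ).2 (orbit a f n θ y) := by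
  rw [orbit, Function.iterate_succ_apply', ← skew_iterate_fst (f := f) n θ y]; rfl

lemma orbit_succ' (n : ℕ) (θ : UnitAddCircle × UnitAddCircle) (y : ℝ) :
    orbit a f (n + 1) θ y = orbit a f n (baker a θ) (f θ.2 y) := by
  rw [orbit, Function.iterate_succ_apply]; rfl

lemma strictMono_orbit (hf : Standing a f s' s t t') (n : ℕ)
    (θ : UnitAddCircle × UnitAddCircle) : StrictMono (orbit a f n θ) := by
  induction n with
  | zero => exact strictMono_id
  | succ n ih =>
    intro y z hyz
    rw [orbit_succ, orbit_succ]
    exact hf.strictMono _ (ih hyz)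

lemma orbit_phiPlus (hf : Standing a f s' s t t') (n : ℕ) (θ : UnitAddCircle × UnitAddCircle) :
    orbit a f n θ (phiPlus a f θ) = phiPlus a f ((baker a)^[n] θ) := by
  induction n with
  | zero => rfl
  | succ n ih => rw [orbit_succ, ih, Function.iterate_succ_apply', phiPlus_baker hf]

lemma orbit_phiMinus (hf : Standing a f s' s t t') (n : ℕ) (θ : UnitAddCircle × UnitAddCircle) :
    orbit a f n θ (phiMinus a f θ) = phiMinus a f ((baker a)^[n] θ) := by
  induction n with
  | zero => rfl
  | succ n ih => rw [orbit_succ, ih, Function.iterate_succ_apply', phiMinus_baker hf]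

lemma orbit_mem_Icc (hf : Standing a f s' s t t') (n : ℕ) (θ : UnitAddCircle × UnitAddCircle)
    {y : ℝ} (hy : y ∈ Icc (phiMinus a f θ) (phiPlus a f θ)) :
    orbit a f n θ y ∈ Icc (phiMinus a f ((baker a)^[n] θ)) (phiPlus a f ((baker a)^[n] θ)) := by
  rw [← orbit_phiMinus hf, ← orbit_phiPlus hf]
  exact ⟨(strictMono_orbit hf n θ).monotone hy.1, (strictMono_orbit hf n θ).monotone hy.2⟩

lemma orbit_mem_I (hf : Standing a f s' s t t') (n : ℕ) (θ : UnitAddCircle × UnitAddCircle)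
    {y : ℝ} (hy : y ∈ Icc (phiMinus a f θ) (phiPlus a f θ)) : orbit a f n θ y ∈ Icc s t := by
  have := orbit_mem_Icc hf n θ hy
  exact ⟨(hf.phiMinus_mem _).1.trans this.1, this.2.trans (hf.phiPlus_mem _).2⟩

/-- The points of the attractor over `θ` that are forward asymptotic to `φ⁻`. -/
def asympSet (a : ℝ) (f : UnitAddCircle → ℝ → ℝ) (θ : UnitAddCircle × UnitAddCircle) : Set ℝ :=
  {y | y ∈ Icc (phiMinus a f θ) (phiPlus a f θ) ∧
    Tendsto (fun n : ℕ => |orbit a f n θ y - phiMinus a f ((baker a)^[n] θ)|) atTop (𝓝 0)}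

lemma phiStar_eq (θ : UnitAddCircle × UnitAddCircle) :
    phiStar a f θ = sSup (asympSet a f θ) := rfl

lemma phiMinus_mem_asympSet (hf : Standing a f s' s t t') (θ : UnitAddCircle × UnitAddCircle) :
    phiMinus a f θ ∈ asympSet a f θ := by
  refine ⟨⟨le_rfl, phiMinus_le_phiPlus hf θ⟩, ?_⟩
  simp [orbit_phiMinus hf]

lemma bddAbove_asympSet (θ : UnitAddCircle × UnitAddCircle) : BddAbove (asympSet a f θ) :=
  ⟨phiPlus a f θ, fun _ hy => hy.1.2⟩

lemma phiStar_mem (hf : Standing a f s' s t t') (θ : UnitAddCircle × UnitAddCircle) :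
    phiStar a f θ ∈ Icc (phiMinus a f θ) (phiPlus a f θ) :=
  ⟨le_csSup (bddAbove_asympSet θ) (phiMinus_mem_asympSet hf θ),
    csSup_le ⟨_, phiMinus_mem_asympSet hf θ⟩ fun _ hy => hy.1.2⟩

lemma phiStar_mem_I (hf : Standing a f s' s t t') (θ : UnitAddCircle × UnitAddCircle) :
    phiStar a f θ ∈ Icc s t :=
  ⟨(hf.phiMinus_mem θ).1.trans (phiStar_mem hf θ).1,
    (phiStar_mem hf θ).2.trans (hf.phiPlus_mem θ).2⟩

lemma mem_asympSet_of_le (hf : Standing a f s' s t t') {θ : UnitAddCircle × UnitAddCircle}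
    {y z : ℝ} (hz : z ∈ asympSet a f θ) (hy : phiMinus a f θ ≤ y) (hyz : y ≤ z) :
    y ∈ asympSet a f θ := by
  have hyI : y ∈ Icc (phiMinus a f θ) (phiPlus a f θ) := ⟨hy, hyz.trans hz.1.2⟩
  refine ⟨hyI, squeeze_zero (fun _ => abs_nonneg _) (fun n => ?_) hz.2⟩
  have h1 := (orbit_mem_Icc hf n θ hyI).1
  have h2 := (strictMono_orbit hf n θ).monotone hyz
  rw [abs_of_nonneg (sub_nonneg.2 h1), abs_of_nonneg (sub_nonneg.2 (h1.trans h2))]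
  linarith

lemma asympSet_baker (hf : Standing a f s' s t t') (θ : UnitAddCircle × UnitAddCircle) :
    asympSet a f (baker a θ) = f θ.2 '' asympSet a f θ := by
  have key : ∀ z, Tendsto (fun n : ℕ => |orbit a f n (baker a θ) (f θ.2 z) -
      phiMinus a f ((baker a)^[n] (baker a θ))|) atTop (𝓝 0) ↔
      Tendsto (fun n : ℕ => |orbit a f n θ z - phiMinus a f ((baker a)^[n] θ)|) atTop (𝓝 0) := by
    intro z
    rw [← tendsto_add_atTop_iff_nat (f := fun n : ℕ =>
      |orbit a f n θ z - phiMinus a f ((baker a)^[n] θ)|) 1]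
    simp only [orbit_succ', Function.iterate_succ_apply]
  have hI : ∀ z, f θ.2 z ∈ Icc (phiMinus a f (baker a θ)) (phiPlus a f (baker a θ)) ↔
      z ∈ Icc (phiMinus a f θ) (phiPlus a f θ) := by
    intro z
    rw [phiMinus_baker hf, phiPlus_baker hf, mem_Icc, mem_Icc, (hf.strictMono _).le_iff_le,
      (hf.strictMono _).le_iff_le]
  ext y
  constructor
  · rintro ⟨hy, hlim⟩
    obtain ⟨z, rfl⟩ := mem_range_of_exists_le_of_exists_ge (hf.continuous_fibre θ.2)
      ⟨_, (phiMinus_baker hf θ).symm.trans_le hy.1⟩ ⟨_, hy.2.trans_eq (phiPlus_baker hf θ)⟩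
    exact ⟨z, ⟨(hI z).1 hy, (key z).1 hlim⟩, rfl⟩
  · rintro ⟨z, ⟨hz, hlim⟩, rfl⟩
    exact ⟨(hI z).2 hz, (key z).2 hlim⟩

lemma phiStar_baker (hf : Standing a f s' s t t') (θ : UnitAddCircle × UnitAddCircle) :
    phiStar a f (baker a θ) = f θ.2 (phiStar a f θ) := by
  rw [phiStar_eq, phiStar_eq, asympSet_baker hf]
  exact ((hf.strictMono θ.2).monotone.map_csSup_of_continuousAt
    (hf.continuous_fibre θ.2).continuousAt ⟨_, phiMinus_mem_asympSet hf θ⟩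
    (bddAbove_asympSet θ)).symm

lemma measurable_orbit (hf : Standing a f s' s t t') (n : ℕ) :
    Measurable fun p : (UnitAddCircle × UnitAddCircle) × ℝ => orbit a f n p.1 p.2 := by
  have hs : Measurable (skew a f) :=
    ((measurable_baker hf.a_pos hf.a_lt_one).comp measurable_fst).prodMk
      (hf.continuous_f.measurable.comp
        ((measurable_snd.comp measurable_fst).prodMk measurable_snd))
  exact measurable_snd.comp (hs.iterate n)

lemma measurable_phiStar (hf : Standing a f s' s t t') : Measurable (phiStar a f) := by
  refine measurable_of_Ioi fun q => ?_
  -- The asymptotic set is an interval starting at `φ⁻`, so a supremum above `q` is witnessed by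
  -- `φ⁻` itself or by a rational point.
  have e : phiStar a f ⁻¹' Ioi q = {θ | q < phiMinus a f θ} ∪
      ⋃ r : ℚ, ⋃ _ : q < (r : ℝ), {θ | (r : ℝ) ∈ asympSet a f θ} := by
    ext θ
    simp only [mem_preimage, mem_Ioi, mem_union, mem_ofPred_eq, mem_iUnion, exists_prop]
    constructor
    · intro h
      by_contra! hc
      obtain ⟨y, hy, hqy⟩ := exists_lt_of_lt_csSup ⟨_, phiMinus_mem_asympSet hf θ⟩ h
      obtain ⟨r, hr1, hr2⟩ := exists_rat_btwn hqy
      exact hc.2 r hr1 (mem_asympSet_of_le hf hy (hc.1.trans hr1.le) hr2.le)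
    · rintro (h | ⟨r, hqr, hr⟩)
      · exact h.trans_le (phiStar_mem hf θ).1
      · exact hqr.trans_le (le_csSup (bddAbove_asympSet θ) hr)
  rw [e]
  refine (measurableSet_lt measurable_const (measurable_phiMinus hf)).union
    (MeasurableSet.iUnion fun r => MeasurableSet.iUnion fun _ => ?_)
  refine MeasurableSet.inter ?_ (measurableSet_tendsto (𝓝 0) fun n => ?_)
  · exact (measurableSet_le (measurable_phiMinus hf) measurable_const).inter
      (measurableSet_le measurable_const (measurable_phiPlus hf))
  · have h1 : Measurable fun θ => orbit a f n θ (r : ℝ) :=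
      (measurable_orbit hf n).comp (measurable_id.prodMk measurable_const)
    have h2 : Measurable fun θ => phiMinus a f ((baker a)^[n] θ) :=
      (measurable_phiMinus hf).comp ((measurable_baker hf.a_pos hf.a_lt_one).iterate n)
    exact (h1.sub h2).abs

/-! ### Orbits above the separating graph come close to `φ⁺` -/

/-- The ratio of the two cross ratios is continuous and larger than one on the compact set of
`ε`-separated quadruples, so its minimum there serves as `κ`. -/
lemma exists_uniform_crossRatio_expansion (hf : Standing a f s' s t t') {ε : ℝ} (hε : 0 < ε) :
    ∃ κ, 1 < κ ∧ ∀ x, ∀ p ∈ Icc s t, ∀ z ∈ Icc s t, ∀ y ∈ Icc s t, ∀ q ∈ Icc s t,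
      p + ε ≤ z → z + ε ≤ y → y + ε ≤ q →
      κ * crossRatio p z y q ≤ crossRatio (f x p) (f x z) (f x y) (f x q) := by
  set K : Set (UnitAddCircle × ℝ × ℝ × ℝ × ℝ) :=
    (univ ×ˢ Icc s t ×ˢ Icc s t ×ˢ Icc s t ×ˢ Icc s t) ∩
      {w | w.2.1 + ε ≤ w.2.2.1 ∧ w.2.2.1 + ε ≤ w.2.2.2.1 ∧ w.2.2.2.1 + ε ≤ w.2.2.2.2} with hK
  have hKc : IsCompact K := by
    refine IsCompact.inter_right (isCompact_univ.prod (isCompact_Icc.prod (isCompact_Icc.prod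
      (isCompact_Icc.prod isCompact_Icc)))) ?_
    simp only [ofPred_and]
    refine IsClosed.inter ?_ (IsClosed.inter ?_ ?_) <;>
      exact isClosed_le (by fun_prop) (by fun_prop)
  let N : UnitAddCircle × ℝ × ℝ × ℝ × ℝ → ℝ := fun w =>
    crossRatio (f w.1 w.2.1) (f w.1 w.2.2.1) (f w.1 w.2.2.2.1) (f w.1 w.2.2.2.2)
  let R : UnitAddCircle × ℝ × ℝ × ℝ × ℝ → ℝ := fun w =>
    crossRatio w.2.1 w.2.2.1 w.2.2.2.1 w.2.2.2.2
  have hRpos : ∀ w ∈ K, 0 < R w := by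
    rintro ⟨x, p, z, y, q⟩ ⟨-, h1, h2, h3⟩
    simp only at h1 h2 h3
    have a1 : 0 < q - p := by linarith
    have a2 : 0 < y - z := by linarith
    have a3 : 0 < z - p := by linarith
    have a4 : 0 < q - y := by linarith
    simp only [R, crossRatio]
    positivity
  have hcont : ContinuousOn (fun w => N w / R w) K := by
    have hfc : ∀ g : UnitAddCircle × ℝ × ℝ × ℝ × ℝ → ℝ, Continuous g →
        Continuous fun w => f w.1 (g w) := fun g hg =>
      hf.continuous_f.comp (continuous_fst.prodMk hg)
    have c1 := hfc (fun w => w.2.1) (by fun_prop)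
    have c2 := hfc (fun w => w.2.2.1) (by fun_prop)
    have c3 := hfc (fun w => w.2.2.2.1) (by fun_prop)
    have c4 := hfc (fun w => w.2.2.2.2) (by fun_prop)
    refine ContinuousOn.div ?_ ?_ fun w hw => (hRpos w hw).ne'
    · refine ContinuousOn.div (((c4.sub c1).mul (c3.sub c2)).continuousOn)
        (((c2.sub c1).mul (c4.sub c3)).continuousOn) ?_
      rintro ⟨x, p, z, y, q⟩ ⟨-, h1, h2, h3⟩
      simp only at h1 h2 h3
      have b1 : 0 < f x z - f x p := sub_pos.2 (hf.strictMono x (by linarith))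
      have b2 : 0 < f x q - f x y := sub_pos.2 (hf.strictMono x (by linarith))
      exact (mul_pos b1 b2).ne'
    · refine ContinuousOn.div (by fun_prop) (by fun_prop) ?_
      rintro ⟨x, p, z, y, q⟩ ⟨-, h1, h2, h3⟩
      simp only at h1 h2 h3
      have b1 : 0 < z - p := by linarith
      have b2 : 0 < q - y := by linarith
      exact (mul_pos b1 b2).ne'
  rcases K.eq_empty_or_nonempty with hemp | hne
  · refine ⟨2, by norm_num, fun x p hp z hz y hy q hq h1 h2 h3 => ?_⟩
    have : (x, p, z, y, q) ∈ K := ⟨⟨mem_univ _, hp, hz, hy, hq⟩, h1, h2, h3⟩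
    rw [hemp] at this
    exact absurd this (notMem_empty _)
  · obtain ⟨w₀, hw₀, hmin⟩ := hKc.exists_isMinOn hne hcont
    refine ⟨N w₀ / R w₀, ?_, fun x p hp z hz y hy q hq h1 h2 h3 => ?_⟩
    · rw [lt_div_iff₀ (hRpos _ hw₀), one_mul]
      obtain ⟨-, h1, h2, h3⟩ := hw₀
      exact crossRatio_lt (hf.contDiff_fibre _) (hf.deriv_pos _) (hf.schwarzian_neg _)
        (by linarith) (by linarith) (by linarith)
    · have hw : (x, p, z, y, q) ∈ K := ⟨⟨mem_univ _, hp, hz, hy, hq⟩, h1, h2, h3⟩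
      have := hmin hw
      simp only [mem_ofPred_eq] at this
      rwa [le_div_iff₀ (hRpos _ hw)] at this

/-- Only recurrent closeness is obtained, and it suffices for the limit taken in the Lipschitz
estimate. -/
theorem frequently_near_phiPlus (hf : Standing a f s' s t t')
    {θ : UnitAddCircle × UnitAddCircle} {y : ℝ} (hy : phiStar a f θ < y) (hy' : y ≤ phiPlus a f θ)
    {ε : ℝ} (hε : 0 < ε) :
    ∃ᶠ n in atTop, phiPlus a f ((baker a)^[n] θ) - orbit a f n θ y < ε := by
  rcases hy'.eq_or_lt with rfl | hys
  · refine Eventually.frequently (Eventually.of_forall fun n => ?_)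
    rw [orbit_phiPlus hf, sub_self]; exact hε
  by_contra hnot
  rw [not_frequently] at hnot
  -- An auxiliary point strictly above `φ*`: its orbit is not asymptotic to `φ⁻`, so it keeps a
  -- fixed distance from `φ⁻` infinitely often.
  obtain ⟨z, hz, hzy⟩ := exists_between hy
  have hpz : phiMinus a f θ < z := (phiStar_mem hf θ).1.trans_lt hz
  have hzI : z ∈ Icc (phiMinus a f θ) (phiPlus a f θ) := ⟨hpz.le, (hzy.trans hys).le⟩
  have hyI : y ∈ Icc (phiMinus a f θ) (phiPlus a f θ) := ⟨(hpz.trans hzy).le, hy'⟩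
  have hznot : ¬ Tendsto (fun n : ℕ => |orbit a f n θ z - phiMinus a f ((baker a)^[n] θ)|)
      atTop (𝓝 0) := fun h => (le_csSup (bddAbove_asympSet θ) ⟨hzI, h⟩).not_gt hz
  obtain ⟨ε', hε', hfreq⟩ : ∃ ε' > 0, ∃ᶠ n : ℕ in atTop,
      ε' ≤ orbit a f n θ z - phiMinus a f ((baker a)^[n] θ) := by
    by_contra! hc
    refine hznot (Metric.tendsto_nhds.2 fun δ hδ => ?_)
    filter_upwards [hc δ hδ] with n hn
    rw [Real.dist_eq, sub_zero, abs_abs,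
      abs_of_nonneg (sub_nonneg.2 (orbit_mem_Icc hf n θ hzI).1)]
    exact hn
  set P : ℕ → ℝ := fun n => orbit a f n θ (phiMinus a f θ) with hP
  set Z : ℕ → ℝ := fun n => orbit a f n θ z with hZ
  set Y : ℕ → ℝ := fun n => orbit a f n θ y with hY
  set Q : ℕ → ℝ := fun n => orbit a f n θ (phiPlus a f θ) with hQ
  have hPZ : ∀ n, P n < Z n := fun n => strictMono_orbit hf n θ hpz
  have hZY : ∀ n, Z n < Y n := fun n => strictMono_orbit hf n θ hzy
  have hYQ : ∀ n, Y n < Q n := fun n => strictMono_orbit hf n θ hys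
  have hPm : ∀ n, P n ∈ Icc s t := fun n =>
    orbit_mem_I hf n θ ⟨le_rfl, phiMinus_le_phiPlus hf θ⟩
  have hZm : ∀ n, Z n ∈ Icc s t := fun n => orbit_mem_I hf n θ hzI
  have hYm : ∀ n, Y n ∈ Icc s t := fun n => orbit_mem_I hf n θ hyI
  have hQm : ∀ n, Q n ∈ Icc s t := fun n =>
    orbit_mem_I hf n θ ⟨phiMinus_le_phiPlus hf θ, le_rfl⟩
  set B : ℕ → ℝ := fun n => crossRatio (P n) (Z n) (Y n) (Q n) with hB
  have hBpos : ∀ n, 0 < B n := by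
    intro n
    have a1 := sub_pos.2 (hPZ n)
    have a2 := sub_pos.2 (hZY n)
    have a3 := sub_pos.2 (hYQ n)
    have a4 : 0 < Q n - P n := by linarith
    simp only [hB, crossRatio]; positivity
  have hBsucc : ∀ n, B (n + 1) = crossRatio (f ((baker a)^[n] θ).2 (P n))
      (f ((baker a)^[n] θ).2 (Z n)) (f ((baker a)^[n] θ).2 (Y n))
      (f ((baker a)^[n] θ).2 (Q n)) := by
    intro n
    simp only [hB, hP, hZ, hY, hQ, orbit_succ]
  have hBmono : Monotone B := monotone_nat_of_le_succ fun n => by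
    rw [hBsucc]
    exact (crossRatio_lt (hf.contDiff_fibre _) (hf.deriv_pos _) (hf.schwarzian_neg _)
      (hPZ n) (hZY n) (hYQ n)).le
  set l := t - s with hl
  have hgood : ∃ᶠ n in atTop, ε' ≤ Z n - P n ∧ ε ≤ Q n - Y n := by
    refine (hfreq.and_eventually hnot).mono fun n hn => ⟨?_, ?_⟩
    · have := hn.1
      rwa [← orbit_phiMinus hf] at this
    · have := not_lt.1 hn.2
      rwa [← orbit_phiPlus hf] at this
  have hlpos : 0 < l := by
    have := hPZ 0; have := hPm 0; have := hZm 0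
    linarith [this.1, this.2, (hPm 0).1]
  have hBgood : ∀ n, ε' ≤ Z n - P n → ε ≤ Q n - Y n → B n ≤ l * l / (ε' * ε) := by
    intro n h1 h2
    simp only [hB, crossRatio]
    have i1 : Q n - P n ≤ l := by linarith [(hQm n).2, (hPm n).1]
    have i2 : Y n - Z n ≤ l := by linarith [(hYm n).2, (hZm n).1]
    have i3 := sub_pos.2 (hZY n)
    have i4 := sub_pos.2 (hPZ n)
    gcongr
  -- The cross ratio is bounded at good times, which recur, hence by monotonicity at all times.
  have hBbdd : ∀ n, B n ≤ l * l / (ε' * ε) := by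
    intro n
    obtain ⟨m, hnm, h1, h2⟩ := (frequently_atTop.1 hgood) n
    exact (hBmono hnm).trans (hBgood m h1 h2)
  -- The remaining gap cannot close at good times, because the cross ratio never falls below its
  -- initial value while its denominator stays bounded below.
  have hsep : ∀ n, ε' ≤ Z n - P n → ε ≤ Q n - Y n → B 0 * (ε' * ε) / l ≤ Y n - Z n := by
    intro n h1 h2
    have h3 : B 0 ≤ B n := hBmono (Nat.zero_le n)
    have i1 : Q n - P n ≤ l := by linarith [(hQm n).2, (hPm n).1]
    have i3 := sub_pos.2 (hZY n)
    have i4 := sub_pos.2 (hPZ n)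
    have i5 := sub_pos.2 (hYQ n)
    have h4 : B n * ((Z n - P n) * (Q n - Y n)) = (Q n - P n) * (Y n - Z n) := by
      simp only [hB, crossRatio]
      field_simp
    rw [div_le_iff₀ hlpos]
    calc B 0 * (ε' * ε) ≤ B n * ((Z n - P n) * (Q n - Y n)) := by
          have := hBpos n
          exact mul_le_mul h3 (mul_le_mul h1 h2 hε.le i4.le) (by positivity) this.le
      _ = (Q n - P n) * (Y n - Z n) := h4
      _ ≤ (Y n - Z n) * l := by rw [mul_comm]; gcongr
  set δ := min (min ε' ε) (B 0 * (ε' * ε) / l) with hδ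
  have hδpos : 0 < δ := lt_min (lt_min hε' hε) (by have := hBpos 0; positivity)
  obtain ⟨κ, hκ, hexp⟩ := exists_uniform_crossRatio_expansion hf hδpos
  have hlim : Tendsto B atTop (𝓝 (⨆ n, B n)) :=
    tendsto_atTop_ciSup hBmono ⟨_, by rintro _ ⟨n, rfl⟩; exact hBbdd n⟩
  set b := ⨆ n, B n with hb
  have hbpos : 0 < b :=
    (hBpos 0).trans_le (le_ciSup (f := B) ⟨_, by rintro _ ⟨n, rfl⟩; exact hBbdd n⟩ 0)
  -- A positive convergent sequence cannot be multiplied by at least `κ > 1` infinitely often.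
  have hlim2 : Tendsto (fun n => B (n + 1) - κ * B n) atTop (𝓝 (b - κ * b)) :=
    (hlim.comp (tendsto_add_atTop_nat 1)).sub (hlim.const_mul κ)
  have hneg : b - κ * b < 0 := by nlinarith
  obtain ⟨n, ⟨h1, h2⟩, h3⟩ := (hgood.and_eventually (hlim2.eventually_lt_const hneg)).exists
  have h4 := hsep n h1 h2
  have d1 : δ ≤ ε' := (min_le_left _ _).trans (min_le_left _ _)
  have d2 : δ ≤ ε := (min_le_left _ _).trans (min_le_right _ _)
  have d3 : δ ≤ B 0 * (ε' * ε) / l := min_le_right _ _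
  have := hexp ((baker a)^[n] θ).2 (P n) (hPm n) (Z n) (hZm n) (Y n) (hYm n) (Q n) (hQm n)
    (by linarith) (by linarith) (by linarith)
  rw [← hBsucc] at this
  exact absurd h3 (not_lt.2 (sub_nonneg.2 this))

end

section

variable {a : ℝ} {f : UnitAddCircle → ℝ → ℝ} {s' s t t' : ℝ}

/-! ### Lipschitz continuity of the separating graph along stable fibres -/

lemma baker_iterate_fst (n : ℕ) (θ : UnitAddCircle × UnitAddCircle) :
    ((baker a)^[n] θ).1 = (tau a)^[n] θ.1 := by
  induction n with
  | zero => rfl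
  | succ n ih => rw [Function.iterate_succ_apply', Function.iterate_succ_apply', ← ih]; rfl

lemma rep_baker_iterate_succ (h0 : 0 < a) (h1 : a < 1) (n : ℕ)
    (θ : UnitAddCircle × UnitAddCircle) :
    rep ((baker a)^[n + 1] θ).2 = branch a ((tau a)^[n] θ.1) (rep ((baker a)^[n] θ).2) := by
  rw [Function.iterate_succ_apply', rep_baker h0 h1, baker_iterate_fst]

lemma abs_rep_baker_iterate_sub_le (h0 : 0 < a) (h1 : a < 1) (n : ℕ) (ξ x x' : UnitAddCircle) :
    |rep ((baker a)^[n] (ξ, x)).2 - rep ((baker a)^[n] (ξ, x')).2| ≤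
      (max a (1 - a)) ^ n * |rep x - rep x'| := by
  induction n with
  | zero => simp
  | succ n ih =>
    rw [rep_baker_iterate_succ h0 h1, rep_baker_iterate_succ h0 h1, branch_sub, abs_mul,
      abs_of_pos (sigma_pos h0 h1 _), pow_succ', mul_assoc]
    exact mul_le_mul (sigma_le _) ih (abs_nonneg _) (h0.le.trans (le_max_left _ _))

/-- Points of the closures of two ordered graphs over a common base point, in the wrong order, make
the filled-in closures intersect. -/
lemma filledClosure_inter_nonempty {φ ψ : UnitAddCircle × UnitAddCircle → ℝ}
    {θ : UnitAddCircle × UnitAddCircle} (hle : ψ θ ≤ φ θ) {y z : ℝ}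
    (hy : (θ, y) ∈ closure (graphSet φ)) (hz : (θ, z) ∈ closure (graphSet ψ)) (hyz : y ≤ z) :
    (filledClosure φ ∩ filledClosure ψ).Nonempty := by
  have hφ : (θ, φ θ) ∈ closure (graphSet φ) := subset_closure rfl
  have hψ : (θ, ψ θ) ∈ closure (graphSet ψ) := subset_closure rfl
  rcases le_total (φ θ) z with h | h
  · exact ⟨(θ, φ θ), ⟨_, _, hφ, hφ, le_rfl, le_rfl⟩, ⟨_, _, hψ, hz, hle, h⟩⟩
  · exact ⟨(θ, z), ⟨_, _, hy, hφ, hyz, h⟩, ⟨_, _, hz, hz, le_rfl, le_rfl⟩⟩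

/-- A violation of the bound yields two orbits in converging fibres, the lower one recurrently near
`φ⁺` and the upper one asymptotic to `φ⁻`. Their limits contradict the disjointness of the filled-in
closures. -/
theorem exists_phiStar_lipschitz (hf : Standing a f s' s t t')
    (hA : filledClosure (phiPlus a f) ∩ filledClosure (phiMinus a f) = ∅) :
    ∃ K, 0 ≤ K ∧ ∀ ξ x x' : UnitAddCircle,
      |phiStar a f (ξ, x) - phiStar a f (ξ, x')| ≤ K * |rep x - rep x'| := by
  have h0 := hf.a_pos
  have h1 := hf.a_lt_one
  obtain ⟨c, hc, hexp⟩ := hf.exists_expansion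
  obtain ⟨C, hC0, hC⟩ := hf.exists_lipschitz
  set r := min a (1 - a) with hr
  have hrpos : 0 < r := lt_min h0 (by linarith)
  -- The slope at which the surplus expansion `(c - 1) σ K`, with `σ ≥ r`, pays for the variation
  -- `C` of the fibre maps in the base direction.
  set K := C / ((c - 1) * r) with hK
  have hc1 : 0 < c - 1 := by linarith
  have hK0 : 0 ≤ K := by positivity
  refine ⟨K, hK0, ?_⟩
  suffices key : ∀ ξ x x' : UnitAddCircle,
      phiStar a f (ξ, x') ≤ phiStar a f (ξ, x) + K * |rep x - rep x'| by
    intro ξ x x'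
    have i1 := key ξ x x'
    have i2 := key ξ x' x
    rw [abs_sub_comm (rep x')] at i2
    rw [abs_le]
    constructor <;> linarith
  intro ξ x x'
  by_contra! hlt
  set θ : UnitAddCircle × UnitAddCircle := (ξ, x) with hθ
  set θ' : UnitAddCircle × UnitAddCircle := (ξ, x') with hθ'
  -- If `φ* = φ⁺` at `θ`, there is no room above `φ*`; then `φ⁺` itself, whose orbit stays on the
  -- graph, is the witness.
  obtain ⟨y, hyI, hyK, hyfreq⟩ : ∃ y ∈ Icc (phiMinus a f θ) (phiPlus a f θ),
      y + K * |rep x - rep x'| < phiStar a f θ' ∧ ∀ ε > 0, ∃ᶠ n in atTop,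
        phiPlus a f ((baker a)^[n] θ) - orbit a f n θ y < ε := by
    rcases (phiStar_mem hf θ).2.eq_or_lt with h | h
    · refine ⟨phiPlus a f θ, ⟨phiMinus_le_phiPlus hf θ, le_rfl⟩, by rwa [← h], fun ε hε => ?_⟩
      refine Eventually.frequently (Eventually.of_forall fun n => ?_)
      rw [orbit_phiPlus hf, sub_self]; exact hε
    · obtain ⟨y, hy1, hy2⟩ := exists_between
        (lt_min h (by linarith : phiStar a f θ < phiStar a f θ' - K * |rep x - rep x'|))
      have hy3 := hy2.trans_le (min_le_left _ _)
      have hy4 := hy2.trans_le (min_le_right _ _)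
      exact ⟨y, ⟨(phiStar_mem hf θ).1.trans hy1.le, hy3.le⟩, by linarith,
        fun ε hε => frequently_near_phiPlus hf hy1 hy3.le hε⟩
  obtain ⟨y', hy', hyy'⟩ := exists_lt_of_lt_csSup ⟨_, phiMinus_mem_asympSet hf θ'⟩ hyK
  -- The cone `y' - y ≥ K |x - x'|` is forward invariant; only the order of the two orbits is needed
  -- in the limit.
  have hcone : ∀ n, K * |rep ((baker a)^[n] θ).2 - rep ((baker a)^[n] θ').2| ≤
      orbit a f n θ' y' - orbit a f n θ y := by
    intro n
    induction n with
    | zero => simp only [orbit_zero, Function.iterate_zero, id]; linarith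
    | succ n ih =>
      set U := rep ((baker a)^[n] θ).2 with hU
      set V := rep ((baker a)^[n] θ').2 with hV
      set Y := orbit a f n θ y with hY
      set Y' := orbit a f n θ' y' with hY'
      set η := (tau a)^[n] ξ with hη
      have hσ := sigma_pos h0 h1 η
      have hYJ : Y ∈ Icc s' t' := hf.mem_J (orbit_mem_I hf n θ hyI)
      have hY'J : Y' ∈ Icc s' t' := hf.mem_J (orbit_mem_I hf n θ' hy'.1)
      have hYY' : Y ≤ Y' := by
        have : 0 ≤ K * |U - V| := by positivity
        linarith
      rw [rep_baker_iterate_succ h0 h1, rep_baker_iterate_succ h0 h1, branch_sub, abs_mul,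
        abs_of_pos hσ, orbit_succ, orbit_succ]
      change K * (sigma a η * |U - V|) ≤
        f ((baker a)^[n] θ').2 Y' - f ((baker a)^[n] θ).2 Y
      rw [← coe_rep ((baker a)^[n] θ).2, ← coe_rep ((baker a)^[n] θ').2, ← hU, ← hV]
      have e1 := hf.mul_sub_le (x := (V : UnitAddCircle)) (fun w hw => hexp _ η w hw) hYJ hY'J hYY'
      have e2 := hC V (Ico_subset_Icc_self (rep_mem _)) U (Ico_subset_Icc_self (rep_mem _)) Y hYJ
        Y hYJ
      rw [sub_self, abs_zero, add_zero] at e2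
      have e3 := (abs_le.1 e2).2
      have hC' : C * |U - V| ≤ (c - 1) * sigma a η * (K * |U - V|) := by
        have : C = (c - 1) * r * K := by rw [hK]; field_simp
        calc C * |U - V| = (c - 1) * r * (K * |U - V|) := by rw [← mul_assoc, ← this]
          _ ≤ _ := by
            have := le_sigma (a := a) η
            gcongr
      have e4 : c * sigma a η * (K * |U - V|) ≤ c * sigma a η * (Y' - Y) :=
        mul_le_mul_of_nonneg_left ih (by positivity)
      nlinarith
  -- Times along which the lower orbit approaches `φ⁺`; compactness then makes base points and
  -- heights converge as well.
  obtain ⟨m, hm, hm'⟩ := extraction_forall_of_frequently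
    (fun k : ℕ => hyfreq (1 / ((k : ℝ) + 1)) (by positivity))
  have hcomp : IsCompact ((univ : Set UnitAddCircle) ×ˢ Icc s t ×ˢ Icc s t) :=
    isCompact_univ.prod (isCompact_Icc.prod isCompact_Icc)
  obtain ⟨⟨x₀, y₀, z₀⟩, -, k, hk, hlim⟩ := hcomp.tendsto_subseq
    (x := fun i => (((baker a)^[m i] θ).2, orbit a f (m i) θ y, orbit a f (m i) θ' y'))
    (fun i => ⟨mem_univ _, orbit_mem_I hf _ _ hyI, orbit_mem_I hf _ _ hy'.1⟩)
  have hmk : Tendsto (fun i => m (k i)) atTop atTop :=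
    hm.tendsto_atTop.comp hk.tendsto_atTop
  have hx : Tendsto (fun i => ((baker a)^[m (k i)] θ).2) atTop (𝓝 x₀) :=
    (continuous_fst.tendsto _).comp hlim
  have hy : Tendsto (fun i => orbit a f (m (k i)) θ y) atTop (𝓝 y₀) :=
    ((continuous_fst.comp continuous_snd).tendsto _).comp hlim
  have hz : Tendsto (fun i => orbit a f (m (k i)) θ' y') atTop (𝓝 z₀) :=
    ((continuous_snd.comp continuous_snd).tendsto _).comp hlim
  have hle : y₀ ≤ z₀ := le_of_tendsto_of_tendsto' hy hz fun i => by
    have := hcone (m (k i))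
    have h2 : 0 ≤ K * |rep ((baker a)^[m (k i)] θ).2 - rep ((baker a)^[m (k i)] θ').2| := by
      positivity
    linarith
  have hx' : Tendsto (fun i => ((baker a)^[m (k i)] θ').2) atTop (𝓝 x₀) := by
    have hd : Tendsto (fun n => rep ((baker a)^[n] θ').2 - rep ((baker a)^[n] θ).2) atTop
        (𝓝 0) := by
      refine squeeze_zero_norm (fun n => abs_rep_baker_iterate_sub_le h0 h1 n ξ x' x) ?_
      rw [← zero_mul |rep x' - rep x|]
      exact (tendsto_pow_atTop_nhds_zero_of_lt_one (h0.le.trans (le_max_left _ _))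
        (max_lt h1 (by linarith))).mul_const _
    have h2 := hx.add ((continuous_coe.tendsto 0).comp (hd.comp hmk))
    have h3 : ((0 : ℝ) : UnitAddCircle) = 0 := rfl
    rw [h3, add_zero] at h2
    refine h2.congr fun i => ?_
    simp only [Function.comp]
    rw [AddCircle.coe_sub, coe_rep, coe_rep, add_sub_cancel]
  have hp : Tendsto (fun i => phiPlus a f (0, ((baker a)^[m (k i)] θ).2)) atTop (𝓝 y₀) := by
    have hd : Tendsto (fun i => phiPlus a f ((baker a)^[m (k i)] θ) - orbit a f (m (k i)) θ y)
        atTop (𝓝 0) := by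
      refine squeeze_zero (fun i => sub_nonneg.2 (orbit_mem_Icc hf _ _ hyI).2)
        (fun i => (hm' (k i)).le) ?_
      exact tendsto_one_div_add_atTop_nhds_zero_nat.comp hk.tendsto_atTop
    have h2 := hd.add hy
    rw [zero_add] at h2
    refine h2.congr fun i => ?_
    rw [sub_add_cancel]
    exact phiPlus_congr hf rfl
  have hmi : Tendsto (fun i => phiMinus a f (0, ((baker a)^[m (k i)] θ').2)) atTop (𝓝 z₀) := by
    have hd := (tendsto_zero_iff_abs_tendsto_zero _).2 (hy'.2.comp hmk)
    have h2 := hz.sub hd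
    rw [sub_zero] at h2
    refine h2.congr fun i => ?_
    rw [sub_sub_cancel]
    exact phiMinus_congr hf rfl
  have hcl1 : ((0, x₀), y₀) ∈ closure (graphSet (phiPlus a f)) :=
    mem_closure_of_tendsto ((tendsto_const_nhds.prodMk_nhds hx).prodMk_nhds hp)
      (Eventually.of_forall fun i => rfl)
  have hcl2 : ((0, x₀), z₀) ∈ closure (graphSet (phiMinus a f)) :=
    mem_closure_of_tendsto ((tendsto_const_nhds.prodMk_nhds hx').prodMk_nhds hmi)
      (Eventually.of_forall fun i => rfl)
  have := filledClosure_inter_nonempty (phiMinus_le_phiPlus hf _) hcl1 hcl2 hle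
  rw [hA] at this
  exact Set.not_nonempty_empty this

end

/-! ### An invariant graph below an upper semicontinuous invariant graph -/

/-- The closure of the graph of a function on the circle. -/
def graphClosure (ψ : UnitAddCircle → ℝ) : Set (UnitAddCircle × ℝ) := closure {p | p.2 = ψ p.1}

lemma norm_coe_le (u : ℝ) : ‖(u : UnitAddCircle)‖ ≤ |u| := by
  rw [UnitAddCircle.norm_eq]
  simpa using round_le u 0

lemma coe_int (n : ℤ) : ((n : ℝ) : UnitAddCircle) = 0 := by
  rw [AddCircle.coe_eq_zero_iff]
  exact ⟨n, by simp⟩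

lemma mem_graphClosure_iff {ψ : UnitAddCircle → ℝ} {u y : ℝ} :
    ((u : UnitAddCircle), y) ∈ graphClosure ψ ↔
      ∀ ε > 0, ∃ v : ℝ, |v - u| < ε ∧ |ψ v - y| < ε := by
  rw [graphClosure, Metric.mem_closure_iff]
  refine forall₂_congr fun ε hε => ?_
  constructor
  · rintro ⟨⟨x, z⟩, hz, hd⟩
    simp only [mem_ofPred_eq] at hz
    subst hz
    rw [Prod.dist_eq, max_lt_iff] at hd
    obtain ⟨w, -, rfl⟩ := exists_coe_eq x
    refine ⟨w - round (w - u), ?_, ?_⟩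
    · have := hd.1
      rw [dist_comm, dist_eq_norm, ← AddCircle.coe_sub, UnitAddCircle.norm_eq] at this
      rwa [sub_right_comm]
    · have e : ((w - (round (w - u) : ℤ) : ℝ) : UnitAddCircle) = w := by
        rw [AddCircle.coe_sub, coe_int, sub_zero]
      rw [e]
      have := hd.2
      rwa [dist_comm] at this
  · rintro ⟨v, h1, h2⟩
    refine ⟨(v, ψ v), rfl, ?_⟩
    rw [Prod.dist_eq, max_lt_iff]
    refine ⟨?_, by rwa [dist_comm]⟩
    rw [dist_comm, dist_eq_norm, ← AddCircle.coe_sub]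
    exact (norm_coe_le _).trans_lt h1

/-- An upper semicontinuous graph `ψ` over the circle, invariant under a skew product with monotone
fibre maps `g`, and an invariant measurable graph `ℓ ≤ ψ` over the torus whose restriction to each
`ξ`-plane extends to a Lipschitz function `L ξ`. -/
structure GraphPair (a : ℝ) (g : UnitAddCircle → ℝ → ℝ) (ψ : UnitAddCircle → ℝ)
    (l : UnitAddCircle × UnitAddCircle → ℝ) (L : UnitAddCircle → ℝ → ℝ) (C K : ℝ) : Prop where
  a_pos : 0 < a
  a_lt_one : a < 1
  strictMono : ∀ x, StrictMono (g x)
  continuous : Continuous fun p : UnitAddCircle × ℝ => g p.1 p.2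
  C_pos : 0 < C
  K_nonneg : 0 ≤ K
  gap_le : ∀ θ : UnitAddCircle × UnitAddCircle,
    g θ.2 (ψ θ.2) - g θ.2 (l θ) ≤ C * (ψ θ.2 - l θ)
  upper_tau : ∀ x, ψ x = g (tau a x) (ψ (tau a x))
  upperSemicontinuous : UpperSemicontinuous ψ
  lower_baker : ∀ θ, l (baker a θ) = g θ.2 (l θ)
  measurable : Measurable l
  le : ∀ θ : UnitAddCircle × UnitAddCircle, l θ ≤ ψ θ.2
  lipschitz : ∀ ξ u v, |L ξ u - L ξ v| ≤ K * |u - v|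
  eq : ∀ ξ, ∀ u ∈ Ico (0 : ℝ) 1, L ξ u = l (ξ, (u : UnitAddCircle))

/-! ### Extending gap estimates to the endpoints, and planes in which the graphs touch. -/

namespace GraphPair

variable {a : ℝ} {g : UnitAddCircle → ℝ → ℝ} {ψ : UnitAddCircle → ℝ}
  {l : UnitAddCircle × UnitAddCircle → ℝ} {L : UnitAddCircle → ℝ → ℝ} {C K : ℝ}

lemma continuous_L (h : GraphPair a g ψ l L C K) (ξ : UnitAddCircle) : Continuous (L ξ) := by
  refine (LipschitzWith.of_dist_le_mul (K := ⟨K, h.K_nonneg⟩) fun u v => ?_).continuous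
  exact h.lipschitz ξ u v

lemma L_branch (h : GraphPair a g ψ l L C K) (ξ : UnitAddCircle) {u : ℝ}
    (hu : u ∈ Icc (0 : ℝ) 1) : L (tau a ξ) (branch a ξ u) = g u (L ξ u) := by
  have hEq : EqOn (fun u => L (tau a ξ) (branch a ξ u)) (fun u : ℝ => g u (L ξ u))
      (Ico (0 : ℝ) 1) := by
    intro u hu
    simp only
    rw [h.eq _ _ (branch_mem_Ico h.a_pos h.a_lt_one ξ hu), h.eq ξ u hu,
      ← h.lower_baker (ξ, (u : UnitAddCircle)), baker, rep_coe hu]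
  have hc1 : Continuous fun u => L (tau a ξ) (branch a ξ u) :=
    (h.continuous_L _).comp (continuous_branch a ξ)
  have hc2 : Continuous fun u : ℝ => g u (L ξ u) :=
    h.continuous.comp (continuous_coe.prodMk (h.continuous_L ξ))
  have := hEq.closure hc1 hc2
  rw [closure_Ico zero_ne_one] at this
  exact this hu

/-- The closure of an invariant graph is carried forward near the seam of the circle too: a local
section of `τ` lifts nearby graph points to graph points near the image. -/
lemma push_mem (h : GraphPair a g ψ l L C K) (ξ : UnitAddCircle) {u y : ℝ}
    (hu : u = 0 ∨ u = 1) (hy : ((u : UnitAddCircle), y) ∈ graphClosure ψ) :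
    (((branch a ξ u : ℝ) : UnitAddCircle), g u y) ∈ graphClosure ψ := by
  have hu0 : (u : UnitAddCircle) = ((0 : ℝ) : UnitAddCircle) := by
    rcases hu with rfl | rfl
    · rfl
    · exact coe_one
  rw [hu0, mem_graphClosure_iff] at hy
  rw [mem_graphClosure_iff]
  intro ε hε
  have hcont : Continuous fun p : ℝ × ℝ => g p.1 p.2 :=
    h.continuous.comp ((continuous_coe.comp continuous_fst).prodMk continuous_snd)
  obtain ⟨δ, hδ, hδε⟩ := Metric.continuous_iff.1 hcont (0, y) ε hε
  obtain ⟨v, hv1, hv2⟩ := hy (min δ (min ε 1)) (by positivity)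
  rw [sub_zero] at hv1
  obtain ⟨v', hv', hτ⟩ := exists_local_section h.a_pos h.a_lt_one ξ hu
    (hv1.trans_le ((min_le_right _ _).trans (min_le_right _ _)))
  refine ⟨v', hv'.trans_lt (hv1.trans_le ((min_le_right _ _).trans (min_le_left _ _))), ?_⟩
  rw [h.upper_tau, hτ, hu0]
  refine hδε (v, ψ v) ?_
  rw [Prod.dist_eq, max_lt_iff, Real.dist_eq, Real.dist_eq, sub_zero]
  exact ⟨hv1.trans_le (min_le_left _ _), hv2.trans_le (min_le_left _ _)⟩

/-- At an interior base point, nearby graph points lie in the same coordinate chart, where `L ξ` is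
Lipschitz, so a pointwise gap passes to the closure. -/
lemma add_le_of_mem_Ioo (h : GraphPair a g ψ l L C K) {ξ : UnitAddCircle} {κ : ℝ}
    (hκ : ∀ x, κ ≤ ψ x - l (ξ, x)) {u y : ℝ} (hu : u ∈ Ioo (0 : ℝ) 1)
    (hy : ((u : UnitAddCircle), y) ∈ graphClosure ψ) : L ξ u + κ ≤ y := by
  rw [mem_graphClosure_iff] at hy
  by_contra! hc
  have hK := h.K_nonneg
  have hd : 0 < (L ξ u + κ - y) / (K + 1) := div_pos (by linarith) (by linarith)
  have hu0 := hu.1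
  have hu1 : 0 < 1 - u := by linarith [hu.2]
  -- The first two bounds keep `v` in the unit interval; the third leaves room for both the height
  -- error and the Lipschitz error `K |v - u|`.
  obtain ⟨v, h1, h2⟩ := hy (min (min u (1 - u)) ((L ξ u + κ - y) / (K + 1))) (by positivity)
  have h3 := h1.trans_le ((min_le_left _ _).trans (min_le_left _ _))
  have h4 := h1.trans_le ((min_le_left _ _).trans (min_le_right _ _))
  have h5 := h1.trans_le (min_le_right _ _)
  have h6 := h2.trans_le (min_le_right _ _)
  rw [lt_div_iff₀ (by linarith)] at h5 h6
  rw [abs_lt] at h3 h4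
  have hv : v ∈ Ico (0 : ℝ) 1 := ⟨by linarith, by linarith⟩
  have e := hκ v
  rw [← h.eq ξ v hv] at e
  have e2 := (abs_le.1 (h.lipschitz ξ v u)).1
  have e3 := (abs_lt.1 h1).1
  have h7 := h2.trans_le (min_le_right _ _)
  have h8 := h1.trans_le (min_le_right _ _)
  have e4 := (abs_lt.1 h7).2
  have e5 : K * |v - u| ≤ K * ((L ξ u + κ - y) / (K + 1)) :=
    mul_le_mul_of_nonneg_left h8.le hK
  have e6 : K * ((L ξ u + κ - y) / (K + 1)) + (L ξ u + κ - y) / (K + 1) = L ξ u + κ - y := by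
    field_simp
  linarith

/-- Over the point `0` of the circle the closure of `ψ` is approached from both sides, while `L ξ`
at an endpoint follows one side only. Pushing forward moves the endpoint to the interior point `a`
as soon as the orbit of `ξ` changes interval; this happens after finitely many steps unless `ξ = 0`.
Monotonicity of the fibre maps pulls the relation back. -/
lemma extend_to_endpoints (h : GraphPair a g ψ l L C K) {r : ℝ → ℝ → Prop}
    (hr : ∀ x y z, r (g x y) (g x z) → r y z) {P : UnitAddCircle → Prop}
    (hP : ∀ ξ, P ξ → P (tau a ξ))
    (hint : ∀ ξ, P ξ → ∀ u ∈ Ioo (0 : ℝ) 1, ∀ y, ((u : UnitAddCircle), y) ∈ graphClosure ψ →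
      r (L ξ u) y)
    {ξ : UnitAddCircle} (hξ : P ξ) (hξ0 : ξ ≠ 0) {u y : ℝ} (hu : u ∈ Icc (0 : ℝ) 1)
    (hy : ((u : UnitAddCircle), y) ∈ graphClosure ψ) : r (L ξ u) y := by
  have ha : a ∈ Ioo (0 : ℝ) 1 := ⟨h.a_pos, h.a_lt_one⟩
  have step : ∀ (ξ : UnitAddCircle) (u y : ℝ), (u = 0 ∨ u = 1) → ((u : UnitAddCircle), y) ∈ graphClosure ψ →
      (∀ y, (((branch a ξ u : ℝ) : UnitAddCircle), y) ∈ graphClosure ψ →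
        r (L (tau a ξ) (branch a ξ u)) y) → r (L ξ u) y := by
    intro ξ u y hu hy H
    have := H _ (h.push_mem ξ hu hy)
    rw [h.L_branch ξ (by rcases hu with rfl | rfl <;> simp)] at this
    exact hr _ _ _ this
  rcases hu.1.eq_or_lt with rfl | hu0
  · refine induction_until_ge h.a_pos h.a_lt_one
      (P := fun ξ => P ξ → ∀ y, (((0 : ℝ) : UnitAddCircle), y) ∈ graphClosure ψ → r (L ξ 0) y)
      (fun ξ hlt hPξ y hy => step ξ 0 y (Or.inl rfl) hy ?_)
      (fun ξ hlt ih hPξ y hy => step ξ 0 y (Or.inl rfl) hy ?_) hξ0 hξ y hy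
    · have e : branch a ξ 0 = a := by simp [branch, hlt]
      rw [e]; exact hint _ (hP _ hPξ) a ha
    · have e : branch a ξ 0 = 0 := by simp [branch, hlt]
      rw [e]; exact ih (hP _ hPξ)
  rcases hu.2.eq_or_lt with rfl | hu1
  · refine induction_until_lt h.a_pos h.a_lt_one
      (P := fun ξ => P ξ → ∀ y, (((1 : ℝ) : UnitAddCircle), y) ∈ graphClosure ψ → r (L ξ 1) y)
      (fun ξ hlt hPξ y hy => step ξ 1 y (Or.inr rfl) hy ?_)
      (fun ξ hlt ih hPξ y hy => step ξ 1 y (Or.inr rfl) hy ?_) ξ hξ y hy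
    · have e : branch a ξ 1 = a := by simp [branch, hlt]
      rw [e]; exact hint _ (hP _ hPξ) a ha
    · have e : branch a ξ 1 = 1 := by simp [branch, hlt]
      rw [e]; exact ih (hP _ hPξ)
  · exact hint ξ hξ u ⟨hu0, hu1⟩ y hy

/-- The planes in which the two graphs come arbitrarily close. -/
def touchSet (ψ : UnitAddCircle → ℝ) (l : UnitAddCircle × UnitAddCircle → ℝ) :
    Set UnitAddCircle :=
  {ξ | ∀ ε > 0, ∃ x, ψ x - l (ξ, x) < ε}

lemma measurableSet_touchSet (h : GraphPair a g ψ l L C K) : MeasurableSet (touchSet ψ l) := by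
  have hK := h.K_nonneg
  -- Upper semicontinuity of `ψ` and continuity of `L ξ` make the condition of having gap less than
  -- a given bound open to the right within `[0, 1)`, so rational base points suffice.
  have e : touchSet ψ l = ⋂ n : ℕ, ⋃ q : ℚ,
      {ξ | ψ ((q : ℝ) : UnitAddCircle) - l (ξ, ((q : ℝ) : UnitAddCircle)) < 1 / ((n : ℝ) + 1)} := by
    ext ξ
    simp only [mem_iInter, mem_iUnion, mem_ofPred_eq]
    constructor
    · intro hξ n
      obtain ⟨x, hx⟩ := hξ (1 / ((n : ℝ) + 1)) (by positivity)
      obtain ⟨u, hu, rfl⟩ := exists_coe_eq x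
      set d := (1 / ((n : ℝ) + 1) - (ψ u - l (ξ, u))) / 2 with hd
      have hd0 : 0 < d := by rw [hd]; linarith
      have h1 : ∀ᶠ v : ℝ in 𝓝 u, ψ v < ψ u + d :=
        (continuous_coe.tendsto u).eventually
          (h.upperSemicontinuous _ _ (lt_add_of_pos_right _ hd0))
      have h2 : ∀ᶠ v : ℝ in 𝓝 u, K * |u - v| < d := by
        have hc : Continuous fun v : ℝ => K * |u - v| := by fun_prop
        have ht := hc.tendsto u
        simp only [sub_self, abs_zero, mul_zero] at ht
        exact ht.eventually_lt_const hd0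
      have h3 : ∀ᶠ v : ℝ in 𝓝 u, v < 1 := eventually_lt_nhds hu.2
      obtain ⟨w, hw, hsub⟩ := mem_nhdsGT_iff_exists_Ioo_subset.1
        (mem_nhdsWithin_of_mem_nhds (h1.and (h2.and h3)))
      obtain ⟨q, hq1, hq2⟩ := exists_rat_btwn (mem_Ioi.1 hw)
      obtain ⟨i1, i2, i3⟩ := hsub ⟨hq1, hq2⟩
      have hqm : (q : ℝ) ∈ Ico (0 : ℝ) 1 := ⟨hu.1.trans hq1.le, i3⟩
      refine ⟨q, ?_⟩
      have i4 := (abs_le.1 (h.lipschitz ξ u q)).2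
      rw [h.eq ξ u hu, h.eq ξ q hqm] at i4
      linarith
    · intro hξ ε hε
      obtain ⟨n, hn⟩ := exists_nat_one_div_lt hε
      obtain ⟨q, hq⟩ := hξ n
      exact ⟨_, hq.trans hn⟩
  rw [e]
  refine MeasurableSet.iInter fun n => MeasurableSet.iUnion fun q =>
    measurableSet_lt (measurable_const.sub (h.measurable.comp ?_)) measurable_const
  exact measurable_id.prodMk measurable_const

lemma gap_baker_le (h : GraphPair a g ψ l L C K) (θ : UnitAddCircle × UnitAddCircle) :
    ψ (baker a θ).2 - l (baker a θ) ≤ C * (ψ θ.2 - l θ) := by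
  rw [h.upper_tau, tau_baker h.a_pos h.a_lt_one, h.lower_baker]
  exact h.gap_le θ

lemma tau_mem_touchSet (h : GraphPair a g ψ l L C K) {ξ : UnitAddCircle}
    (hξ : ξ ∈ touchSet ψ l) : tau a ξ ∈ touchSet ψ l := by
  intro ε hε
  obtain ⟨x, hx⟩ := hξ (ε / C) (div_pos hε h.C_pos)
  refine ⟨(baker a (ξ, x)).2, ?_⟩
  have := h.gap_baker_le (ξ, x)
  rw [lt_div_iff₀ h.C_pos] at hx
  calc ψ (baker a (ξ, x)).2 - l (tau a ξ, (baker a (ξ, x)).2) ≤ C * (ψ x - l (ξ, x)) := this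
    _ < ε := by linarith

/-- Almost every ξ has preimages of every order in the touching set. The branches used along the way
can follow any prescribed `x`, and each forward step contracts horizontal distances by at most `max
a (1 - a)` and multiplies gaps by at most `C`. -/
lemma ae_dense_touching (h : GraphPair a g ψ l L C K) (hfull : ∀ᵐ ξ, ξ ∈ touchSet ψ l) :
    ∀ᵐ ξ, ∀ n : ℕ, ∀ x, ∀ ε > 0, ∃ x', |rep x - rep x'| ≤ (max a (1 - a)) ^ n ∧
      ψ x' - l (ξ, x') < ε := by
  have h0 := h.a_pos
  have h1 := h.a_lt_one
  rw [ae_all_iff]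
  intro n
  induction n with
  | zero =>
    filter_upwards [hfull] with ξ hξ x ε hε
    obtain ⟨x', hx'⟩ := hξ ε hε
    refine ⟨x', ?_, hx'⟩
    rw [pow_zero, abs_le]
    have := rep_mem x
    have := rep_mem x'
    constructor <;> linarith [(rep_mem x).1, (rep_mem x).2, (rep_mem x').1, (rep_mem x').2]
  | succ n ih =>
    filter_upwards [ae_comp_branch h0 h1 ih 0, ae_comp_branch h0 h1 ih (a : UnitAddCircle)] with
      ξ hξ hξ' x ε hε
    -- The preimage of `ξ` whose plane is mapped onto the strip containing `x`; an almost touching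
    -- point near `τ x` in that plane is pushed to one near `x`.
    set η : UnitAddCircle := ((branch a x (rep ξ) : ℝ) : UnitAddCircle) with hη
    have hrep : rep η = branch a x (rep ξ) := rep_coe (branch_mem_Ico h0 h1 _ (rep_mem _))
    have hτ : tau a η = ξ := by
      rw [hη, tau_branch_of_Ico h0 h1 x (rep_mem _), coe_rep]
    have hsel : branch a η = branch a x := branch_congr (by
      rw [hrep]; exact branch_lt_iff h0 h1 x (rep_mem _))
    have hPη : ∀ x, ∀ ε > 0, ∃ x', |rep x - rep x'| ≤ (max a (1 - a)) ^ n ∧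
        ψ x' - l (η, x') < ε := by
      by_cases hx : rep x < a
      · have : branch a x = branch a 0 := branch_congr (by simp [hx, rep_zero, h0])
        rw [hη, this]; exact hξ
      · have : branch a x = branch a (a : UnitAddCircle) :=
          branch_congr (by simp [hx, rep_coe (⟨h0.le, h1⟩ : a ∈ Ico (0 : ℝ) 1)])
        rw [hη, this]; exact hξ'
    obtain ⟨x', hx', hgap⟩ := hPη (tau a x) (ε / C) (div_pos hε h.C_pos)
    refine ⟨(baker a (η, x')).2, ?_, ?_⟩
    · rw [rep_baker h0 h1, ← branch_rep_tau h0 h1 x, ← hsel]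
      simp only
      rw [branch_sub, abs_mul, abs_of_pos (sigma_pos h0 h1 _), pow_succ']
      exact mul_le_mul (sigma_le _) hx' (abs_nonneg _) (h0.le.trans (le_max_left _ _))
    · have := h.gap_baker_le (η, x')
      rw [lt_div_iff₀ h.C_pos] at hgap
      calc ψ (baker a (η, x')).2 - l (ξ, (baker a (η, x')).2)
          = ψ (baker a (η, x')).2 - l (baker a (η, x')) := by rw [← hτ]; rfl
        _ ≤ C * (ψ x' - l (η, x')) := this
        _ < ε := by linarith

lemma ae_ne_zero : ∀ᵐ ξ : UnitAddCircle, ξ ≠ 0 := by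
  rw [ae_circle_iff]
  filter_upwards [Measure.ae_ne (volume : Measure ℝ) 0] with u hu hm h
  refine hu ?_
  rw [← rep_coe hm, h, rep_zero]

/-- Either the lower graph stays strictly below the closure of the upper graph in almost every
plane, or in almost every plane it is the lower boundary of this closure. -/
theorem dichotomy (h : GraphPair a g ψ l L C K) :
    (∀ᵐ ξ, ∀ u ∈ Icc (0 : ℝ) 1, ∀ y, ((u : UnitAddCircle), y) ∈ graphClosure ψ → L ξ u < y) ∨
    (∀ᵐ ξ, ∀ u ∈ Icc (0 : ℝ) 1,
      IsLeast {y | ((u : UnitAddCircle), y) ∈ graphClosure ψ} (L ξ u)) := by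
  have h0 := h.a_pos
  have h1 := h.a_lt_one
  rcases null_or_conull_of_forward_invariant h0 h1 h.measurableSet_touchSet
    (fun ξ hξ => h.tau_mem_touchSet hξ) with hnull | hfull
  · left
    filter_upwards [ae_iterate_tau h0 h1 hnull, ae_ne_zero] with ξ hξ hξ0 u hu y hy
    refine h.extend_to_endpoints (r := (· < ·)) (fun x y z => (h.strictMono x).lt_iff_lt.1)
      (P := fun ξ => ∀ n, (tau a)^[n] ξ ∉ touchSet ψ l)
      (fun ξ hξ n => by rw [← Function.iterate_succ_apply]; exact hξ (n + 1)) ?_ hξ hξ0 hu hy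
    intro ξ hξ u hu y hy
    have := hξ 0
    simp only [touchSet, Function.iterate_zero, id, mem_ofPred_eq, not_forall, not_exists,
      not_lt] at this
    obtain ⟨κ, hκ, hgap⟩ := this
    linarith [h.add_le_of_mem_Ioo hgap hu hy, show (0 : ℝ) < κ from hκ]
  · right
    filter_upwards [h.ae_dense_touching hfull, ae_ne_zero] with ξ hξ hξ0 u hu
    constructor
    · have hcl : IsClosed {u : ℝ | ((u : UnitAddCircle), L ξ u) ∈ graphClosure ψ} :=
        isClosed_closure.preimage (continuous_coe.prodMk (h.continuous_L ξ))
      -- Nearby base points with almost zero gap give values of `ψ` close to `L ξ`, so the graph of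
      -- `L ξ` lies in the closure.
      have hsub : Ico (0 : ℝ) 1 ⊆ {u : ℝ | ((u : UnitAddCircle), L ξ u) ∈ graphClosure ψ} := by
        intro u hu
        rw [mem_ofPred_eq, mem_graphClosure_iff]
        intro ε hε
        have hK := h.K_nonneg
        have hd : 0 < ε / (2 * (K + 1)) := by positivity
        obtain ⟨n, hn⟩ := exists_pow_lt_of_lt_one hd (max_lt h1 (by linarith : 1 - a < 1))
        obtain ⟨x, hx1, hx2⟩ := hξ n u (ε / 2) (half_pos hε)
        obtain ⟨v, hv, rfl⟩ := exists_coe_eq x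
        rw [rep_coe hu, rep_coe hv] at hx1
        have hx3 : |u - v| < ε / (2 * (K + 1)) := hx1.trans_lt hn
        have e1 : (K + 1) * (ε / (2 * (K + 1))) = ε / 2 := by field_simp
        have hx4 : (K + 1) * |u - v| < ε / 2 := by
          rw [← e1]; exact mul_lt_mul_of_pos_left hx3 (by linarith)
        have hx5 := abs_nonneg (u - v)
        refine ⟨v, ?_, ?_⟩
        · rw [abs_sub_comm]; nlinarith
        · have i1 := h.le (ξ, v)
          have i2 := abs_le.1 (h.lipschitz ξ u v)
          rw [h.eq ξ v hv] at i2
          rw [abs_lt]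
          simp only at i1
          constructor <;> nlinarith [i2.1, i2.2]
      have := hcl.closure_subset_iff.2 hsub
      rw [closure_Ico zero_ne_one] at this
      exact this hu
    · intro y hy
      refine h.extend_to_endpoints (r := (· ≤ ·)) (fun x y z => (h.strictMono x).le_iff_le.1)
        (P := fun _ => True) (fun _ _ => trivial) ?_ trivial hξ0 hu hy
      intro ξ _ u hu y hy
      have := h.add_le_of_mem_Ioo (κ := 0) (fun x => sub_nonneg.2 (h.le (ξ, x))) hu hy
      linarith

end GraphPair

section

variable {a : ℝ} {f : UnitAddCircle → ℝ → ℝ} {s' s t t' : ℝ}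

/-! ### The strong stable direction -/

lemma Standing.skewLift_mem (hf : Standing a f s' s t t') {p : UnitAddCircle × ℝ × ℝ}
    (hp : p.2 ∈ Icc (0 : ℝ) 1 ×ˢ Icc s' t') :
    (skewLift a f p).2 ∈ Icc (0 : ℝ) 1 ×ˢ Icc s' t' :=
  ⟨branch_mem_Icc hf.a_pos hf.a_lt_one _ hp.1, hf.mem_J (hf.mapsTo_Icc _ hp.2)⟩

lemma Standing.skewLift_iterate_mem (hf : Standing a f s' s t t') {p : UnitAddCircle × ℝ × ℝ}
    (hp : p.2 ∈ Icc (0 : ℝ) 1 ×ˢ Icc s' t') (n : ℕ) :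
    ((skewLift a f)^[n] p).2 ∈ Icc (0 : ℝ) 1 ×ˢ Icc s' t' := by
  induction n with
  | zero => exact hp
  | succ n ih => rw [Function.iterate_succ_apply']; exact hf.skewLift_mem ih

lemma Standing.exists_slopeA_bound (hf : Standing a f s' s t t') :
    ∃ C, 0 ≤ C ∧ ∀ p : UnitAddCircle × ℝ × ℝ, p.2 ∈ Icc (0 : ℝ) 1 ×ˢ Icc s' t' →
      |slopeA f p| ≤ C := by
  obtain ⟨C, hC0, hC⟩ := hf.exists_fderivWithin_bounds
  obtain ⟨c, hc, hexp⟩ := hf.exists_expansion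
  have hσ := sigma_pos hf.a_pos hf.a_lt_one 0
  refine ⟨C / (c * sigma a 0), by positivity, fun p hp => ?_⟩
  have h1 := (hC p.2 hp p.2 hp).1
  have h2 := ContinuousLinearMap.le_opNorm
    (fderivWithin ℝ (planeMap f) (univ ×ˢ Icc s' t') (p.2.1, p.2.2)) (1, 0)
  rw [hf.fderivWithin_apply hp.2] at h2
  have h3 : ‖((1, 0) : ℝ × ℝ)‖ = 1 := by simp [Prod.norm_def]
  rw [h3, mul_one, mul_zero, add_zero, mul_one] at h2
  have h4 : |baseDeriv f p.2.1 p.2.2| ≤ C := h2.trans h1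
  have h5 := hexp p.2.1 0 p.2.2 hp.2
  rw [slopeA, abs_div, abs_of_pos (hf.deriv_pos _ _)]
  exact div_le_div₀ hC0 h4 (by positivity) h5

lemma Standing.exists_gam_bound (hf : Standing a f s' s t t') :
    ∃ ρ, 0 ≤ ρ ∧ ρ < 1 ∧ ∀ p : UnitAddCircle × ℝ × ℝ, p.2 ∈ Icc (0 : ℝ) 1 ×ˢ Icc s' t' →
      |Gam a f p| ≤ ρ := by
  obtain ⟨c, hc, hexp⟩ := hf.exists_expansion
  refine ⟨c⁻¹, by positivity, inv_lt_one_of_one_lt₀ hc, fun p hp => ?_⟩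
  have h5 := hexp p.2.1 p.1 p.2.2 hp.2
  have hσ := sigma_pos hf.a_pos hf.a_lt_one p.1
  have hd := hf.deriv_pos p.2.1 p.2.2
  rw [Gam, abs_div, abs_of_pos hσ, abs_of_pos hd, div_le_iff₀ hd, inv_mul_eq_div,
    le_div_iff₀ (by linarith)]
  linarith

lemma Standing.exists_term_bound (hf : Standing a f s' s t t') :
    ∃ C ρ, 0 ≤ C ∧ 0 ≤ ρ ∧ ρ < 1 ∧ ∀ p : UnitAddCircle × ℝ × ℝ,
      p.2 ∈ Icc (0 : ℝ) 1 ×ˢ Icc s' t' → ∀ k : ℕ,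
      ‖(∏ j ∈ Finset.range k, Gam a f ((skewLift a f)^[j] p)) * slopeA f ((skewLift a f)^[k] p)‖ ≤
        C * ρ ^ k := by
  obtain ⟨C, hC0, hC⟩ := hf.exists_slopeA_bound
  obtain ⟨ρ, hρ0, hρ1, hρ⟩ := hf.exists_gam_bound
  refine ⟨C, ρ, hC0, hρ0, hρ1, fun p hp k => ?_⟩
  rw [Real.norm_eq_abs, abs_mul, Finset.abs_prod, mul_comm]
  refine mul_le_mul (hC _ (hf.skewLift_iterate_mem hp k)) ?_
    (Finset.prod_nonneg fun _ _ => abs_nonneg _) hC0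
  calc ∏ j ∈ Finset.range k, |Gam a f ((skewLift a f)^[j] p)|
      ≤ ∏ _j ∈ Finset.range k, ρ := Finset.prod_le_prod (fun _ _ => abs_nonneg _)
        fun j _ => hρ _ (hf.skewLift_iterate_mem hp j)
    _ = ρ ^ k := by simp

lemma Standing.exists_X₃_bound (hf : Standing a f s' s t t') :
    ∃ C, 0 ≤ C ∧ ∀ p : UnitAddCircle × ℝ × ℝ, p.2 ∈ Icc (0 : ℝ) 1 ×ˢ Icc s' t' →
      |X₃ a f p| ≤ C := by
  obtain ⟨C, ρ, hC0, hρ0, hρ1, h⟩ := hf.exists_term_bound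
  refine ⟨C * (1 - ρ)⁻¹, mul_nonneg hC0 (inv_nonneg.2 (by linarith)), fun p hp => ?_⟩
  rw [X₃, abs_neg]
  exact tsum_of_norm_bounded ((hasSum_geometric_of_lt_one hρ0 hρ1).mul_left C) (h p hp)

/-- The invariance of the strong stable direction. -/
lemma Standing.deriv_mul_X₃ (hf : Standing a f s' s t t') {p : UnitAddCircle × ℝ × ℝ}
    (hp : p.2 ∈ Icc (0 : ℝ) 1 ×ˢ Icc s' t') :
    baseDeriv f p.2.1 p.2.2 + deriv (f p.2.1) p.2.2 * X₃ a f p =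
      sigma a p.1 * X₃ a f (skewLift a f p) := by
  obtain ⟨C, ρ, hC0, hρ0, hρ1, h⟩ := hf.exists_term_bound
  have hsum : Summable fun k : ℕ =>
      (∏ j ∈ Finset.range k, Gam a f ((skewLift a f)^[j] p)) * slopeA f ((skewLift a f)^[k] p) :=
    Summable.of_norm_bounded ((summable_geometric_of_lt_one hρ0 hρ1).mul_left C) (h p hp)
  -- Splitting off the term `k = 0` of the series gives the cohomological equation for the slope.
  have hX : X₃ a f p = -slopeA f p + Gam a f p * X₃ a f (skewLift a f p) := by
    rw [X₃, hsum.tsum_eq_zero_add, X₃, mul_neg, ← tsum_mul_left]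
    simp only [Finset.prod_range_succ', Function.iterate_succ_apply, Function.iterate_zero, id,
      Finset.range_zero, Finset.prod_empty, one_mul, neg_add]
    congr 2
    refine tsum_congr fun k => ?_
    ring
  have hd := (hf.deriv_pos p.2.1 p.2.2).ne'
  rw [hX, slopeA, Gam, baseDeriv]
  field_simp
  ring

/-! ### Smoothness of invariant Lipschitz graphs -/

/-- A graph over the circle that is invariant under the skew product, takes values in `J` and is
Lipschitz on the unit interval. -/
structure InvariantGraph (a : ℝ) (f : UnitAddCircle → ℝ → ℝ) (s' t' : ℝ)
    (h : UnitAddCircle → ℝ) (K : ℝ) : Prop where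
  mem : ∀ x, h x ∈ Icc s' t'
  tau : ∀ x, h x = f (tau a x) (h (tau a x))
  K_nonneg : 0 ≤ K
  lipschitz : ∀ u ∈ Icc (0 : ℝ) 1, ∀ v ∈ Icc (0 : ℝ) 1,
    |h (v : UnitAddCircle) - h (u : UnitAddCircle)| ≤ K * |v - u|

namespace InvariantGraph

variable {h : UnitAddCircle → ℝ} {K : ℝ}

lemma apply_branch (hf : Standing a f s' s t t') (hh : InvariantGraph a f s' t' h K)
    (ξ : UnitAddCircle) {u : ℝ} (hu : u ∈ Icc (0 : ℝ) 1) :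
    h ((branch a ξ u : ℝ) : UnitAddCircle) = f u (h u) := by
  rw [hh.tau, tau_branch hf.a_pos hf.a_lt_one ξ hu]

lemma skewLift_eq (hf : Standing a f s' s t t') (hh : InvariantGraph a f s' t' h K)
    (ξ : UnitAddCircle) {u : ℝ} (hu : u ∈ Icc (0 : ℝ) 1) :
    skewLift a f (ξ, u, h u) =
      (BakerSkew.tau a ξ, branch a ξ u, h ((branch a ξ u : ℝ) : UnitAddCircle)) := by
  rw [hh.apply_branch hf ξ hu]; rfl

/-- The remainder `R` at `(u, v)` satisfies `d R = R' - T`, where `R'` is the remainder at the image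
points, at distance `σ |v - u|`, and `T` is a quadratic Taylor error. As `d ≥ cσ`, each step
multiplies the linear part of the bound by `1 / c`, so only the quadratic part survives. -/
lemma exists_quadratic_bound (hf : Standing a f s' s t t')
    (hh : InvariantGraph a f s' t' h K) :
    ∃ C, 0 ≤ C ∧ ∀ ξ, ∀ u ∈ Icc (0 : ℝ) 1, ∀ v ∈ Icc (0 : ℝ) 1,
      |h v - h u - X₃ a f (ξ, u, h u) * (v - u)| ≤ C * |v - u| ^ 2 := by
  have h0 := hf.a_pos
  have h1 := hf.a_lt_one
  obtain ⟨X, hX0, hX⟩ := hf.exists_X₃_bound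
  obtain ⟨C, hC0, hC⟩ := hf.exists_taylor
  obtain ⟨c, hc, hexp⟩ := hf.exists_expansion
  have hK := hh.K_nonneg
  set r := min a (1 - a) with hr
  have hrpos : 0 < r := lt_min h0 (by linarith)
  have hc1 : 0 < c - 1 := by linarith
  set C₃ := C * (1 + K) ^ 2 with hC₃
  -- Chosen so that the quadratic bound reproduces itself: `C₄ σ² + C₃ ≤ C₄ c σ`, using `r ≤ σ ≤ 1`.
  set C₄ := C₃ / (r * (c - 1)) with hC₄
  have hC₃0 : 0 ≤ C₃ := by positivity
  have hC₄0 : 0 ≤ C₄ := by positivity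
  have hC₃₄ : C₃ = C₄ * (r * (c - 1)) := by rw [hC₄]; field_simp
  refine ⟨C₄, hC₄0, ?_⟩
  have key : ∀ n : ℕ, ∀ ξ, ∀ u ∈ Icc (0 : ℝ) 1, ∀ v ∈ Icc (0 : ℝ) 1,
      |h v - h u - X₃ a f (ξ, u, h u) * (v - u)| ≤
        (c⁻¹) ^ n * ((K + X) * |v - u|) + C₄ * |v - u| ^ 2 := by
    intro n
    induction n with
    | zero =>
      intro ξ u hu v hv
      have i1 := hh.lipschitz u hu v hv
      have i2 := hX (ξ, u, h u) ⟨hu, hh.mem _⟩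
      calc |h v - h u - X₃ a f (ξ, u, h u) * (v - u)|
          ≤ |h v - h u| + |X₃ a f (ξ, u, h u) * (v - u)| := abs_sub _ _
        _ ≤ K * |v - u| + X * |v - u| := by
          rw [abs_mul]
          gcongr
        _ ≤ _ := by
          rw [pow_zero, one_mul, ← add_mul]
          exact le_add_of_nonneg_right (by positivity)
    | succ n ih =>
      intro ξ u hu v hv
      set σ := sigma a ξ with hσdef
      have hσ : 0 < σ := sigma_pos h0 h1 ξ
      have hσ1 : σ ≤ 1 := (sigma_le ξ).trans (max_le h1.le (by linarith))
      have hσr : r ≤ σ := le_sigma ξ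
      set Δ := |v - u| with hΔ
      have hΔ0 : 0 ≤ Δ := abs_nonneg _
      set d := deriv (f u) (h u) with hd
      have hdpos : 0 < d := hf.deriv_pos _ _
      have hdc : c * σ ≤ d := hexp u ξ (h u) (hh.mem _)
      have hinv := hf.deriv_mul_X₃ (p := (ξ, u, h u)) ⟨hu, hh.mem _⟩
      rw [hh.skewLift_eq hf ξ hu] at hinv
      simp only at hinv
      have hT := hC u hu v hv (h u) (hh.mem _) (h v) (hh.mem _)
      have hT' : C * (|v - u| + |h v - h u|) ^ 2 ≤ C₃ * Δ ^ 2 := by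
        have : |v - u| + |h v - h u| ≤ (1 + K) * Δ := by
          have := hh.lipschitz u hu v hv
          rw [add_mul, one_mul]
          exact add_le_add le_rfl this
        rw [hC₃, mul_assoc, ← mul_pow]
        gcongr
      have hR := ih (BakerSkew.tau a ξ) (branch a ξ u) (branch_mem_Icc h0 h1 ξ hu)
        (branch a ξ v) (branch_mem_Icc h0 h1 ξ hv)
      rw [branch_sub, abs_mul, abs_of_pos hσ, hh.apply_branch hf ξ hu, hh.apply_branch hf ξ hv]
        at hR
      rw [hh.apply_branch hf ξ hu] at hinv
      set R := h v - h u - X₃ a f (ξ, u, h u) * (v - u) with hRdef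
      set T := f v (h v) - f u (h u) -
        (baseDeriv f u (h u) * (v - u) + deriv (f u) (h u) * (h v - h u)) with hTdef
      have e : d * R = (f v (h v) - f u (h u) -
          X₃ a f (BakerSkew.tau a ξ, branch a ξ u, f u (h u)) * (σ * (v - u))) - T := by
        rw [hRdef, hTdef]
        linear_combination (-(v - u)) * hinv
      have e1 : d * |R| ≤ ((c⁻¹) ^ n * ((K + X) * (σ * Δ)) + C₄ * (σ * Δ) ^ 2) + C₃ * Δ ^ 2 := by
        have e' : d * |R| = |d * R| := by rw [abs_mul, abs_of_pos hdpos]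
        rw [e', e]
        exact (abs_sub _ _).trans (add_le_add hR (hT.trans hT'))
      have e2 : (c⁻¹) ^ n * ((K + X) * (σ * Δ)) + C₄ * (σ * Δ) ^ 2 + C₃ * Δ ^ 2 ≤
          (c * σ) * ((c⁻¹) ^ (n + 1) * ((K + X) * Δ) + C₄ * Δ ^ 2) := by
        have e3 : (c * σ) * ((c⁻¹) ^ (n + 1) * ((K + X) * Δ)) =
            (c⁻¹) ^ n * ((K + X) * (σ * Δ)) := by
          rw [pow_succ]; field_simp
        rw [mul_add, e3, hC₃₄, add_assoc]
        refine add_le_add le_rfl ?_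
        have e4 : σ ^ 2 + r * (c - 1) ≤ c * σ := by nlinarith
        calc C₄ * (σ * Δ) ^ 2 + C₄ * (r * (c - 1)) * Δ ^ 2
            = (C₄ * Δ ^ 2) * (σ ^ 2 + r * (c - 1)) := by ring
          _ ≤ (C₄ * Δ ^ 2) * (c * σ) := by gcongr
          _ = _ := by ring
      have hcσ : 0 < c * σ := by positivity
      have e5 : (c * σ) * |R| ≤ d * |R| := by gcongr
      exact le_of_mul_le_mul_left (e5.trans (e1.trans e2)) hcσ
  intro ξ u hu v hv
  have hlim : Tendsto (fun n : ℕ => (c⁻¹) ^ n * ((K + X) * |v - u|) + C₄ * |v - u| ^ 2) atTop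
      (𝓝 (0 * ((K + X) * |v - u|) + C₄ * |v - u| ^ 2)) :=
    ((tendsto_pow_atTop_nhds_zero_of_lt_one (by positivity)
      (inv_lt_one_of_one_lt₀ hc)).mul_const _).add_const _
  have := ge_of_tendsto' hlim fun n => key n ξ u hu v hv
  simpa using this

lemma hasDerivWithinAt (hf : Standing a f s' s t t') (hh : InvariantGraph a f s' t' h K)
    (ξ : UnitAddCircle) {u : ℝ} (hu : u ∈ Icc (0 : ℝ) 1) :
    HasDerivWithinAt (fun v : ℝ => h v) (X₃ a f (ξ, u, h u)) (Icc 0 1) u := by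
  obtain ⟨C, hC0, hC⟩ := hh.exists_quadratic_bound hf
  rw [hasDerivWithinAt_iff_isLittleO]
  have h1 : (fun v : ℝ => h v - h u - (v - u) • X₃ a f (ξ, u, h u)) =O[𝓝[Icc 0 1] u]
      fun v => (v - u) ^ 2 := by
    refine Asymptotics.IsBigO.of_bound C ?_
    filter_upwards [self_mem_nhdsWithin] with v hv
    rw [norm_pow, Real.norm_eq_abs, Real.norm_eq_abs, smul_eq_mul, mul_comm (v - u)]
    exact hC ξ u hu v hv
  refine h1.trans_isLittleO ?_
  have h2 : (fun v : ℝ => (v - u) ^ 2) =o[𝓝 u] fun v => v - u := by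
    have h3 : Tendsto (fun v : ℝ => v - u) (𝓝 u) (𝓝 0) := by
      have : Continuous fun v : ℝ => v - u := by fun_prop
      simpa using this.tendsto u
    have h4 := (Asymptotics.isLittleO_pow_id (𝕜 := ℝ) one_lt_two).comp_tendsto h3
    exact h4
  exact h2.mono nhdsWithin_le_nhds

/-- The graph does not involve `ξ` and its derivative is unique, so the slope along it is the same
in every plane. -/
lemma X₃_eq (hf : Standing a f s' s t t') (hh : InvariantGraph a f s' t' h K)
    (ξ ξ' : UnitAddCircle) {u : ℝ} (hu : u ∈ Icc (0 : ℝ) 1) :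
    X₃ a f (ξ, u, h u) = X₃ a f (ξ', u, h u) :=
  (uniqueDiffOn_Icc zero_lt_one u hu).eq_deriv _ (hh.hasDerivWithinAt hf ξ hu)
    (hh.hasDerivWithinAt hf ξ' hu)

/-- Adding the quadratic estimates based at `u` and at `v` cancels the values of `h` and leaves the
slope difference times `v - u`. -/
lemma exists_X₃_lipschitz (hf : Standing a f s' s t t') (hh : InvariantGraph a f s' t' h K) :
    ∃ C, 0 ≤ C ∧ ∀ u ∈ Icc (0 : ℝ) 1, ∀ v ∈ Icc (0 : ℝ) 1,
      |X₃ a f (0, v, h v) - X₃ a f (0, u, h u)| ≤ C * |v - u| := by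
  obtain ⟨C, hC0, hC⟩ := hh.exists_quadratic_bound hf
  refine ⟨2 * C, by positivity, fun u hu v hv => ?_⟩
  rcases eq_or_ne v u with rfl | hne
  · simp
  have hpos : 0 < |v - u| := abs_pos.2 (sub_ne_zero.2 hne)
  have i1 := hC 0 u hu v hv
  have i2 := hC 0 v hv u hu
  rw [abs_sub_comm u v] at i2
  refine le_of_mul_le_mul_right ?_ hpos
  rw [← abs_mul]
  calc |(X₃ a f (0, v, h v) - X₃ a f (0, u, h u)) * (v - u)|
      = |(h v - h u - X₃ a f (0, u, h u) * (v - u)) +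
          (h u - h v - X₃ a f (0, v, h v) * (u - v))| := by congr 1; ring
    _ ≤ C * |v - u| ^ 2 + C * |v - u| ^ 2 := (abs_add_le _ _).trans (add_le_add i1 i2)
    _ = 2 * C * |v - u| * |v - u| := by ring

/-- The one-sided derivatives of an invariant graph at the discontinuity of the baker map agree. -/
lemma X₃_zero_eq_one (hf : Standing a f s' s t t') (hh : InvariantGraph a f s' t' h K) :
    X₃ a f (0, 0, h ((0 : ℝ) : UnitAddCircle)) = X₃ a f (0, 1, h ((1 : ℝ) : UnitAddCircle)) := by
  have h0 := hf.a_pos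
  have h1 := hf.a_lt_one
  have m0 : (0 : ℝ) ∈ Icc (0 : ℝ) 1 := ⟨le_rfl, zero_le_one⟩
  have m1 : (1 : ℝ) ∈ Icc (0 : ℝ) 1 := ⟨zero_le_one, le_rfl⟩
  have ma : a ∈ Icc (0 : ℝ) 1 := ⟨h0.le, h1.le⟩
  have e10 : ((1 : ℝ) : UnitAddCircle) = ((0 : ℝ) : UnitAddCircle) := coe_one
  have hbd : ∀ y, baseDeriv f 1 y = baseDeriv f 0 y := by
    intro y
    have h2 := deriv_comp_add_const (fun v : ℝ => f (v : UnitAddCircle) y) 1 0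
    simp only [coe_add_one, zero_add] at h2
    exact h2.symm
  have hrec : ∀ ξ, ∀ u ∈ Icc (0 : ℝ) 1,
      baseDeriv f u (h u) + deriv (f u) (h u) * X₃ a f (0, u, h u) =
      sigma a ξ * X₃ a f (0, branch a ξ u, h ((branch a ξ u : ℝ) : UnitAddCircle)) := by
    intro ξ u hu
    have := hf.deriv_mul_X₃ (p := (ξ, u, h u)) ⟨hu, hh.mem _⟩
    rw [hh.skewLift_eq hf ξ hu] at this
    rw [hh.X₃_eq hf 0 ξ hu, hh.X₃_eq hf 0 (BakerSkew.tau a ξ) (branch_mem_Icc h0 h1 ξ hu)]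
    exact this
  have r0 : rep (0 : UnitAddCircle) < a := by rw [rep_zero]; exact h0
  have ra : ¬ rep (a : UnitAddCircle) < a := by
    rw [rep_coe (⟨h0.le, h1⟩ : a ∈ Ico (0 : ℝ) 1)]; exact lt_irrefl _
  have b1 : branch a 0 0 = 0 := by simp [branch, r0]
  have b2 : branch a 0 1 = a := by simp [branch, r0]
  have b3 : branch a (a : UnitAddCircle) 0 = a := by simp [branch, ra]
  have b4 : branch a (a : UnitAddCircle) 1 = 1 := by simp [branch, ra]
  have s1 : sigma a 0 = a := by simp [sigma, r0]
  have s2 : sigma a (a : UnitAddCircle) = 1 - a := by simp [sigma, ra]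
  -- The invariance relation for both branches at both endpoints. Writing `p`, `q`, `x` for the
  -- slopes at `0`, `1`, `a`, they give `a p = (1 - a) x` and `(1 - a) q = a x`.
  have q1 := hrec 0 0 m0
  have q2 := hrec 0 1 m1
  have q3 := hrec (a : UnitAddCircle) 0 m0
  have q4 := hrec (a : UnitAddCircle) 1 m1
  rw [b1, s1] at q1
  rw [b2, s1, hbd, e10] at q2
  rw [b3, s2] at q3
  rw [b4, s2, hbd, e10] at q4
  rw [e10]
  obtain ⟨c, hc, hexp⟩ := hf.exists_expansion
  have d1 := hexp ((0 : ℝ) : UnitAddCircle) 0 _ (hh.mem ((0 : ℝ) : UnitAddCircle))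
  rw [s1] at d1
  generalize deriv (f ((0 : ℝ) : UnitAddCircle)) (h ((0 : ℝ) : UnitAddCircle)) = d at *
  generalize baseDeriv f 0 (h ((0 : ℝ) : UnitAddCircle)) = e at *
  generalize X₃ a f (0, 0, h ((0 : ℝ) : UnitAddCircle)) = p at *
  generalize X₃ a f (0, 1, h ((0 : ℝ) : UnitAddCircle)) = q at *
  generalize X₃ a f (0, a, h (a : UnitAddCircle)) = x at *
  have hda : a < d := by nlinarith
  have h1' : 0 < 1 - a := by linarith
  have hp : p = (1 - a) * x / a := by field_simp; linarith
  have hq : q = a * x / (1 - a) := by field_simp; linarith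
  -- What remains is `(d - a) p = (d - (1 - a)) q`. Since `d > a > a (1 - a)`, either `a = 1 / 2` or
  -- `x = 0`, and both give `p = q`.
  have hprod : (1 - 2 * a) * (d - a * (1 - a)) * x = 0 := by
    have e1 : (d - a) * p = (d - (1 - a)) * q := by linarith
    rw [hp, hq] at e1
    field_simp at e1
    linear_combination e1
  rcases mul_eq_zero.1 hprod with h2 | h2
  · rcases mul_eq_zero.1 h2 with h3 | h3
    · have : a = 1 / 2 := by linarith
      rw [hp, hq, this]; norm_num
    · nlinarith
  · rw [hp, hq, h2]; simp

lemma hasDerivAt (hf : Standing a f s' s t t') (hh : InvariantGraph a f s' t' h K) (u : ℝ) :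
    HasDerivAt (fun v : ℝ => h v)
      (X₃ a f (0, Int.fract u, h ((Int.fract u : ℝ) : UnitAddCircle))) u := by
  have hshift : ∀ n : ℤ, (fun v : ℝ => h ((v - n : ℝ) : UnitAddCircle)) = fun v : ℝ => h v := by
    intro n; funext v
    rw [AddCircle.coe_sub, coe_int, sub_zero]
  have hmain : ∀ w ∈ Ico (0 : ℝ) 1, HasDerivAt (fun v : ℝ => h v) (X₃ a f (0, w, h w)) w := by
    intro w hw
    rcases hw.1.eq_or_lt with rfl | hw0
    · have hR := hh.hasDerivWithinAt hf 0 (u := 0) ⟨le_rfl, zero_le_one⟩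
      have hL := hh.hasDerivWithinAt hf 0 (u := 1) ⟨zero_le_one, le_rfl⟩
      rw [← hh.X₃_zero_eq_one hf] at hL
      generalize X₃ a f (0, 0, h ((0 : ℝ) : UnitAddCircle)) = P at hL hR ⊢
      have n0 : Icc (0 : ℝ) 1 ∈ 𝓝[Ici 0] (0 : ℝ) := Icc_mem_nhdsGE zero_lt_one
      have n1 : Icc (0 : ℝ) 1 ∈ 𝓝[Iic 1] (1 : ℝ) := Icc_mem_nhdsLE zero_lt_one
      have hR' : HasDerivWithinAt (fun v : ℝ => h v) P (Ici 0) 0 := hR.mono_of_mem_nhdsWithin n0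
      have hL' : HasDerivWithinAt (fun v : ℝ => h v) P (Iic 1) 1 := hL.mono_of_mem_nhdsWithin n1
      -- The left derivative at `0` is the one at `1`, by periodicity.
      have hL'' : HasDerivWithinAt (fun v : ℝ => h v) P (Iic 0) 0 := by
        have hm : MapsTo (fun v : ℝ => v + 1) (Iic 0) (Iic 1) := by
          intro v hv
          simp only [mem_Iic] at hv ⊢
          linarith
        have hd : HasDerivWithinAt (fun v : ℝ => v + 1) 1 (Iic 0) 0 :=
          ((hasDerivAt_id (0 : ℝ)).add_const 1).hasDerivWithinAt
        have hL1 : HasDerivWithinAt (fun v : ℝ => h v) P (Iic 1) ((0 : ℝ) + 1) := by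
          rw [zero_add]; exact hL'
        have := hL1.comp (0 : ℝ) hd hm
        simpa [Function.comp_def, coe_add_one] using this
      have := hL''.union hR'
      rwa [Iic_union_Ici, hasDerivWithinAt_univ] at this
    · exact (hh.hasDerivWithinAt hf 0 (Ico_subset_Icc_self hw)).hasDerivAt
        (Icc_mem_nhds hw0 hw.2)
  have h1 := hmain (Int.fract u) ⟨Int.fract_nonneg u, Int.fract_lt_one u⟩
  have h2 : HasDerivAt (fun v : ℝ => h v)
      (X₃ a f (0, Int.fract u, h ((Int.fract u : ℝ) : UnitAddCircle))) (u - ⌊u⌋) := h1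
  have h3 := h2.comp_sub_const u (⌊u⌋ : ℝ)
  rwa [hshift] at h3

theorem isC1Lip (hf : Standing a f s' s t t') (hh : InvariantGraph a f s' t' h K) :
    IsC1Lip h := by
  obtain ⟨C, hC0, hC⟩ := hh.exists_X₃_lipschitz hf
  set X : ℝ → ℝ := fun u => X₃ a f (0, u, h (u : UnitAddCircle)) with hX
  have hX01 : X 0 = X 1 := hh.X₃_zero_eq_one hf
  have hderiv : (deriv fun u : ℝ => h (u : UnitAddCircle)) = fun u => X (Int.fract u) :=
    funext fun u => (hh.hasDerivAt hf u).deriv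
  have m0 : (0 : ℝ) ∈ Icc (0 : ℝ) 1 := ⟨le_rfl, zero_le_one⟩
  have m1 : (1 : ℝ) ∈ Icc (0 : ℝ) 1 := ⟨zero_le_one, le_rfl⟩
  have hfr : ∀ u : ℝ, Int.fract u ∈ Icc (0 : ℝ) 1 := fun u =>
    ⟨Int.fract_nonneg u, (Int.fract_lt_one u).le⟩
  have hle : ∀ u v : ℝ, u ≤ v → |X (Int.fract v) - X (Int.fract u)| ≤ C * |v - u| := by
    intro u v huv
    have f1 := Int.fract_nonneg u
    have f2 := Int.fract_lt_one u
    have f3 := Int.fract_nonneg v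
    have g1 := Int.floor_add_fract u
    have g2 := Int.floor_add_fract v
    rcases (Int.floor_mono huv).eq_or_lt with heq | hlt
    · have := hC _ (hfr u) _ (hfr v)
      have e : Int.fract v - Int.fract u = v - u := by
        rw [heq] at g1; linarith
      rwa [e] at this
    -- If an integer separates the points, the estimate passes through it, where the slopes at `1`
    -- and `0` agree.
    · have hcast : (⌊u⌋ : ℝ) + 1 ≤ ⌊v⌋ := by exact_mod_cast hlt
      have i1 : |X 1 - X (Int.fract u)| ≤ C * |1 - Int.fract u| := hC _ (hfr u) 1 m1
      have i2 : |X (Int.fract v) - X 0| ≤ C * |Int.fract v - 0| := hC 0 m0 _ (hfr v)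
      rw [abs_of_nonneg (by linarith : 0 ≤ 1 - Int.fract u)] at i1
      rw [sub_zero, abs_of_nonneg f3] at i2
      rw [abs_of_nonneg (sub_nonneg.2 huv)]
      calc |X (Int.fract v) - X (Int.fract u)|
          = |(X (Int.fract v) - X 0) + (X 1 - X (Int.fract u))| := by rw [hX01]; congr 1; ring
        _ ≤ C * Int.fract v + C * (1 - Int.fract u) := (abs_add_le _ _).trans (add_le_add i2 i1)
        _ = C * (Int.fract v + (1 - Int.fract u)) := by ring
        _ ≤ C * (v - u) := mul_le_mul_of_nonneg_left (by linarith) hC0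
  have hLip : LipschitzWith ⟨C, hC0⟩ (deriv fun u : ℝ => h (u : UnitAddCircle)) := by
    refine LipschitzWith.of_dist_le_mul fun u v => ?_
    rw [hderiv, Real.dist_eq, Real.dist_eq]
    rcases le_total u v with huv | huv
    · rw [abs_sub_comm, abs_sub_comm u v]; exact hle u v huv
    · exact hle v u huv
  exact ⟨contDiff_one_iff_deriv.2 ⟨fun u => (hh.hasDerivAt hf u).differentiableAt,
    hLip.continuous⟩, _, hLip⟩

/-! ### Strong stable fibres -/

lemma isFibreSolution (hf : Standing a f s' s t t') (hh : InvariantGraph a f s' t' h K)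
    (ξ : UnitAddCircle) {x : ℝ} (hx : x ∈ Icc (0 : ℝ) 1) :
    IsFibreSolution a f s' t' ξ x (h x) (Icc 0 1) (fun u : ℝ => h u) where
  subset_unit := Subset.rfl
  interval := ordConnected_Icc
  mem := hx
  initial := rfl
  mapsTo := fun _ _ => hh.mem _
  hasDeriv := fun _ hu => hh.hasDerivWithinAt hf ξ hu

lemma skewLift_iterate_fst (p : UnitAddCircle × ℝ × ℝ) (n : ℕ) :
    ((skewLift a f)^[n] p).1 = (BakerSkew.tau a)^[n] p.1 := by
  induction n with
  | zero => rfl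
  | succ n ih => rw [Function.iterate_succ_apply', Function.iterate_succ_apply', ← ih]; rfl

/-- Two fibres through a common point coincide: a fibre that meets an invariant Lipschitz graph is
contained in it. -/
theorem eqOn_of_isFibreSolution (hf : Standing a f s' s t t')
    (hh : InvariantGraph a f s' t' h K) {ξ : UnitAddCircle} {x : ℝ} {D : Set ℝ} {l : ℝ → ℝ}
    (hl : IsFibreSolution a f s' t' ξ x (h x) D l) : EqOn l (fun u : ℝ => h u) D := by
  have h0 := hf.a_pos
  have h1 := hf.a_lt_one
  obtain ⟨X, hX0, hX⟩ := hf.exists_X₃_bound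
  obtain ⟨c, hc, hexp⟩ := hf.exists_expansion
  set κ : ℕ → ℝ := fun n => ∏ j ∈ Finset.range n, sigma a ((BakerSkew.tau a)^[j] ξ) with hκ
  have hκpos : ∀ n, 0 < κ n := fun n => Finset.prod_pos fun j _ => sigma_pos h0 h1 _
  have hκs : ∀ n, κ (n + 1) = κ n * sigma a ((BakerSkew.tau a)^[n] ξ) := fun n =>
    Finset.prod_range_succ _ _
  set p : ℕ → ℝ → UnitAddCircle × ℝ × ℝ := fun n u => (skewLift a f)^[n] (ξ, u, l u) with hp
  have hp1 : ∀ n u, (p n u).1 = (BakerSkew.tau a)^[n] ξ := fun n u => skewLift_iterate_fst _ n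
  have hps : ∀ n u, p (n + 1) u = skewLift a f (p n u) := fun n u =>
    Function.iterate_succ_apply' _ _ _
  have hmem : ∀ n, ∀ u ∈ D, (p n u).2 ∈ Icc (0 : ℝ) 1 ×ˢ Icc s' t' := fun n u hu =>
    hf.skewLift_iterate_mem (p := (ξ, u, l u)) ⟨hl.subset_unit hu, hl.mapsTo u hu⟩ n
  have hU : ∀ n u v, (p n u).2.1 - (p n v).2.1 = κ n * (u - v) := by
    intro n u v
    induction n with
    | zero => simp [hp, hκ]
    | succ n ih =>
      rw [hps, hps, hκs]
      simp only [skewLift]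
      rw [hp1, hp1, branch_sub, ih]
      ring
  -- By invariance of the strong stable direction, the images of a fibre have slope `X₃` too;
  -- relative to the original parameter both coordinates scale with `κ n`.
  have hder : ∀ n, ∀ u ∈ D, HasDerivWithinAt (fun u => (p n u).2.2)
      (κ n * X₃ a f (p n u)) D u := by
    intro n
    induction n with
    | zero =>
      intro u hu
      simpa [hp, hκ] using hl.hasDeriv u hu
    | succ n ih =>
      intro u hu
      have hUd : HasDerivWithinAt (fun u => (p n u).2.1) (κ n) D u := by
        have e : (fun v => (p n v).2.1) = fun v => κ n * v + (p n 0).2.1 := by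
          funext v; linarith [hU n v 0]
        rw [e]
        simpa using (((hasDerivAt_id u).const_mul (κ n)).add_const
          (p n 0).2.1).hasDerivWithinAt
      have hm : MapsTo (fun u => (p n u).2) D (univ ×ˢ Icc s' t') := fun v hv =>
        ⟨mem_univ _, (hmem n v hv).2⟩
      have hd : HasDerivWithinAt (fun u => (p n u).2) (κ n, κ n * X₃ a f (p n u)) D u :=
        hUd.prodMk (ih u hu)
      have hF := hf.hasFDerivWithinAt (u := (p n u).2.1) (hmem n u hu).2
      have := HasFDerivWithinAt.comp_hasDerivWithinAt u hF hd hm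
      rw [hf.fderivWithin_apply (hmem n u hu).2] at this
      have e : baseDeriv f (p n u).2.1 (p n u).2.2 * κ n +
          deriv (f (p n u).2.1) (p n u).2.2 * (κ n * X₃ a f (p n u)) =
          κ (n + 1) * X₃ a f (p (n + 1) u) := by
        have hinv := hf.deriv_mul_X₃ (hmem n u hu)
        rw [hκs, hps, ← hp1 n u]
        linear_combination κ n * hinv
      simp only at this
      rw [e] at this
      have e2 : (fun u => (p (n + 1) u).2.2) = planeMap f ∘ fun u => (p n u).2 := by
        funext v; rw [hps]; rfl
      rw [e2]
      exact this
  have hY : ∀ n, ∀ u ∈ D, |(p n u).2.2 - (p n x).2.2| ≤ κ n * X * |u - x| := by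
    intro n u hu
    exact (hl.interval.convex).norm_image_sub_le_of_norm_hasDerivWithin_le (hder n)
      (fun v hv => by
        rw [Real.norm_eq_abs, abs_mul, abs_of_pos (hκpos n)]
        exact mul_le_mul_of_nonneg_left (hX _ (hmem n v hv)) (hκpos n).le) hl.mem hu
  have hYx : ∀ n, (p n x).2.2 = h ((p n x).2.1 : ℝ) := by
    intro n
    induction n with
    | zero => exact hl.initial
    | succ n ih =>
      rw [hps]
      simp only [skewLift]
      rw [hh.apply_branch hf _ (hmem n x hl.mem).1, ih]
  -- Vertical distance to the invariant graph grows at least like `cⁿ κ n`, while fibre and graph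
  -- leave their common point with bounded slope over a width `κ n |u - x|`. Hence the distance is
  -- zero, with no regularity of `X₃` required.
  have hexpand : ∀ n, ∀ u ∈ D,
      c ^ n * κ n * |l u - h u| ≤ |(p n u).2.2 - h ((p n u).2.1 : ℝ)| := by
    intro n u hu
    induction n with
    | zero => simp [hp, hκ]
    | succ n ih =>
      have hm := hmem n u hu
      have hσ := sigma_pos h0 h1 ((BakerSkew.tau a)^[n] ξ)
      have hb : ∀ y ∈ Icc s' t', c * sigma a ((BakerSkew.tau a)^[n] ξ) ≤
          deriv (f ((p n u).2.1 : ℝ)) y := fun y hy => hexp _ _ y hy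
      have hstep : c * sigma a ((BakerSkew.tau a)^[n] ξ) *
          |(p n u).2.2 - h ((p n u).2.1 : ℝ)| ≤
          |f ((p n u).2.1 : ℝ) (p n u).2.2 - f ((p n u).2.1 : ℝ) (h ((p n u).2.1 : ℝ))| := by
        rcases le_total (p n u).2.2 (h ((p n u).2.1 : ℝ)) with hle | hle
        · have := hf.mul_sub_le hb hm.2 (hh.mem _) hle
          rw [abs_sub_comm, abs_of_nonneg (sub_nonneg.2 hle), abs_sub_comm (f _ _)]
          exact this.trans (le_abs_self _)
        · have := hf.mul_sub_le hb (hh.mem _) hm.2 hle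
          rw [abs_of_nonneg (sub_nonneg.2 hle)]
          exact this.trans (le_abs_self _)
      rw [hps]
      simp only [skewLift]
      rw [hh.apply_branch hf _ hm.1]
      refine le_trans ?_ hstep
      rw [hκs, pow_succ]
      calc c ^ n * c * (κ n * sigma a ((BakerSkew.tau a)^[n] ξ)) * |l u - h u|
          = c * sigma a ((BakerSkew.tau a)^[n] ξ) * (c ^ n * κ n * |l u - h u|) := by ring
        _ ≤ _ := mul_le_mul_of_nonneg_left ih (by positivity)
  intro u hu
  have hbound : ∀ n : ℕ, c ^ n * |l u - h u| ≤ (X + K) * |u - x| := by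
    intro n
    have i1 := hexpand n u hu
    have i2 := hY n u hu
    have i3 := hh.lipschitz _ (hmem n u hu).1 _ (hmem n x hl.mem).1
    rw [abs_sub_comm ((p n x).2.1), hU, abs_mul, abs_of_pos (hκpos n)] at i3
    rw [hYx] at i2
    have i4 := abs_sub_le (p n u).2.2 (h ((p n x).2.1 : ℝ)) (h ((p n u).2.1 : ℝ))
    refine le_of_mul_le_mul_left ?_ (hκpos n)
    calc κ n * (c ^ n * |l u - h u|) = c ^ n * κ n * |l u - h u| := by ring
      _ ≤ κ n * X * |u - x| + K * (κ n * |u - x|) := i1.trans (i4.trans (add_le_add i2 i3))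
      _ = κ n * ((X + K) * |u - x|) := by ring
  by_contra hne
  have hpos : 0 < |l u - h u| := abs_pos.2 (sub_ne_zero.2 hne)
  obtain ⟨n, hn⟩ := pow_unbounded_of_one_lt ((X + K) * |u - x| / |l u - h u|) hc
  rw [div_lt_iff₀ hpos] at hn
  exact absurd (hbound n) (not_le.2 hn)

/-- The restriction of an invariant Lipschitz graph to a `ξ`-plane is a strong stable fibre. -/
theorem isStrongStableFibre (hf : Standing a f s' s t t') (hh : InvariantGraph a f s' t' h K)
    (ξ : UnitAddCircle) :
    IsStrongStableFibre a f s' t' ξ {q | q.1 ∈ Icc (0 : ℝ) 1 ∧ q.2 = h (q.1 : UnitAddCircle)} := by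
  have m0 : (0 : ℝ) ∈ Icc (0 : ℝ) 1 := ⟨le_rfl, zero_le_one⟩
  exact ⟨0, m0, h ((0 : ℝ) : UnitAddCircle), hh.mem _, Icc 0 1, fun u : ℝ => h u,
    hh.isFibreSolution hf ξ m0,
    fun D' l' hl' => ⟨hl'.subset_unit, hh.eqOn_of_isFibreSolution hf hl'⟩, rfl⟩

/-- A strong stable fibre that meets an invariant Lipschitz graph is its restriction. -/
theorem eq_of_isStrongStableFibre (hf : Standing a f s' s t t')
    (hh : InvariantGraph a f s' t' h K) {ξ : UnitAddCircle} {γ : Set (ℝ × ℝ)}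
    (hγ : IsStrongStableFibre a f s' t' ξ γ) {u : ℝ} (hu : (u, h (u : UnitAddCircle)) ∈ γ) :
    γ = {q | q.1 ∈ Icc (0 : ℝ) 1 ∧ q.2 = h (q.1 : UnitAddCircle)} := by
  obtain ⟨x, hx, y, hy, D, l, hl, hmax, rfl⟩ := hγ
  obtain ⟨huD, hul⟩ := hu
  simp only at huD hul
  have hsol : IsFibreSolution a f s' t' ξ u (h u) D l :=
    ⟨hl.subset_unit, hl.interval, huD, hul.symm, hl.mapsTo, hl.hasDeriv⟩
  have hEq := hh.eqOn_of_isFibreSolution hf hsol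
  have hyx : y = h x := hl.initial.symm.trans (hEq hl.mem)
  subst hyx
  have hD : D = Icc 0 1 := hl.subset_unit.antisymm (hmax _ _ (hh.isFibreSolution hf ξ hx)).1
  ext q
  constructor
  · rintro ⟨h1, h2⟩
    exact ⟨hl.subset_unit h1, h2.trans (hEq h1)⟩
  · rintro ⟨h1, h2⟩
    rw [← hD] at h1
    exact ⟨h1, h2.trans (hEq h1).symm⟩

end InvariantGraph

end

section

variable {a : ℝ} {f : UnitAddCircle → ℝ → ℝ} {s' s t t' : ℝ}

/-! ### Conditional measures -/

instance isProbabilityMeasure_circle : IsProbabilityMeasure (volume : Measure UnitAddCircle) :=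
  ⟨UnitAddCircle.measure_univ⟩

lemma measurable_lift (hf : Standing a f s' s t t') :
    Measurable fun θ : UnitAddCircle × UnitAddCircle => (θ.1, (θ.2, phiStar a f θ)) :=
  measurable_fst.prodMk (measurable_snd.prodMk (measurable_phiStar hf))

lemma measurable_planeLift (hf : Standing a f s' s t t') (ξ : UnitAddCircle) :
    Measurable fun x : UnitAddCircle => (x, phiStar a f (ξ, x)) :=
  measurable_id.prodMk ((measurable_phiStar hf).comp (measurable_const.prodMk measurable_id))

/-- The lifted measure is the composition product of Lebesgue measure with the plane-wise lifts, and
disintegrations are a.e. unique. -/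
theorem ae_condMeasure_eq (hf : Standing a f s' s t t') :
    ∀ᵐ ξ, condMeasure a f ξ =
      Measure.map (fun x : UnitAddCircle => (x, phiStar a f (ξ, x))) volume := by
  have hF : Measurable fun p : UnitAddCircle × UnitAddCircle => (p.2, phiStar a f p) :=
    measurable_snd.prodMk (measurable_phiStar hf)
  let κ : Kernel UnitAddCircle (UnitAddCircle × ℝ) :=
    (Kernel.id ×ₖ Kernel.const UnitAddCircle (volume : Measure UnitAddCircle)).map
      (fun p : UnitAddCircle × UnitAddCircle => (p.2, phiStar a f p))
  have hκmarkov : IsMarkovKernel κ := Kernel.IsMarkovKernel.map _ hF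
  have hκ : ∀ ξ, κ ξ = Measure.map (fun x : UnitAddCircle => (x, phiStar a f (ξ, x))) volume := by
    intro ξ
    rw [Kernel.map_apply _ hF, Kernel.prod_apply, Kernel.id_apply, Kernel.const_apply,
      Measure.dirac_prod, Measure.map_map hF measurable_prodMk_left]
    rfl
  have hfst : (liftedMeasure a f).fst = volume := by
    rw [liftedMeasure, Measure.fst_map_prodMk (measurable_snd.prodMk (measurable_phiStar hf))]
    exact measurePreserving_fst.map_eq
  have heq : liftedMeasure a f = (liftedMeasure a f).fst ⊗ₘ κ := by
    rw [hfst]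
    ext S hS
    rw [Measure.compProd_apply hS, liftedMeasure, Measure.map_apply (measurable_lift hf) hS]
    change (volume.prod volume) _ = _
    rw [Measure.prod_apply (measurable_lift hf hS)]
    refine lintegral_congr fun ξ => ?_
    rw [hκ, Measure.map_apply (measurable_planeLift hf ξ) (measurable_prodMk_left hS)]
    rfl
  have := eq_condKernel_of_measure_eq_compProd κ heq
  rw [hfst] at this
  filter_upwards [this] with ξ hξ
  rw [condMeasure, ← hξ, hκ]

lemma support_map_subset_closure {X Y : Type*} [MeasurableSpace X] [TopologicalSpace Y]
    [MeasurableSpace Y] [OpensMeasurableSpace Y] {μ : Measure X} {F : X → Y}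
    (hF : AEMeasurable F μ) : (Measure.map F μ).support ⊆ closure (range F) := by
  refine Measure.support_subset_of_isClosed isClosed_closure ?_
  rw [mem_ae_iff, Measure.map_apply_of_aemeasurable hF isClosed_closure.measurableSet.compl]
  convert measure_empty (μ := μ)
  rw [Set.eq_empty_iff_forall_notMem]
  exact fun x hx => hx (subset_closure (mem_range_self x))

/-! ### Fibres of the filled-in closures -/

/-- Forgetting `ξ` is an open continuous projection, so taking its preimage commutes with closure.
-/
lemma mem_closure_graphSet_iff {φ : UnitAddCircle × UnitAddCircle → ℝ}
    (hφ : ∀ θ, φ θ = φ (0, θ.2)) (θ : UnitAddCircle × UnitAddCircle) (y : ℝ) :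
    (θ, y) ∈ closure (graphSet φ) ↔ (θ.2, y) ∈ graphClosure fun x => φ (0, x) := by
  have hopen : IsOpenMap (Prod.map Prod.snd id : (UnitAddCircle × UnitAddCircle) × ℝ →
      UnitAddCircle × ℝ) := isOpenMap_snd.prodMap IsOpenMap.id
  have hcont : Continuous (Prod.map Prod.snd id : (UnitAddCircle × UnitAddCircle) × ℝ →
      UnitAddCircle × ℝ) := continuous_snd.prodMap continuous_id
  have e : graphSet φ = Prod.map Prod.snd id ⁻¹' {p : UnitAddCircle × ℝ | p.2 = φ (0, p.1)} := by
    ext p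
    simp only [graphSet, mem_ofPred_eq, mem_preimage, Prod.map_fst, Prod.map_snd, id]
    rw [hφ p.1]
  rw [e, ← hopen.preimage_closure_eq_closure_preimage hcont]
  rfl

lemma mem_graphClosure_neg_iff {φ : UnitAddCircle → ℝ} (x : UnitAddCircle) (y : ℝ) :
    (x, y) ∈ graphClosure (fun x => -φ x) ↔ (x, -y) ∈ graphClosure φ := by
  obtain ⟨u, -, rfl⟩ := exists_coe_eq x
  rw [mem_graphClosure_iff, mem_graphClosure_iff]
  refine forall₂_congr fun ε hε => exists_congr fun v => ?_
  have : |-φ v - y| = |φ v - -y| := by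
    rw [← abs_neg]; congr 1; ring
  rw [this]

lemma isCompact_graphClosure {φ : UnitAddCircle → ℝ} {b c : ℝ} (hφ : ∀ x, φ x ∈ Icc b c)
    (x : UnitAddCircle) : IsCompact {y | (x, y) ∈ graphClosure φ} := by
  have hsub : graphClosure φ ⊆ univ ×ˢ Icc b c := by
    refine closure_minimal ?_ (isClosed_univ.prod isClosed_Icc)
    rintro ⟨x, y⟩ hxy
    have hy : y = φ x := hxy
    exact ⟨mem_univ _, by rw [hy]; exact hφ x⟩
  refine isCompact_Icc.of_isClosed_subset (s := Icc b c) ?_ fun y hy => (hsub hy).2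
  exact isClosed_closure.preimage (by fun_prop : Continuous fun y : ℝ => (x, y))

lemma nonempty_graphClosure (φ : UnitAddCircle → ℝ) (x : UnitAddCircle) :
    {y | (x, y) ∈ graphClosure φ}.Nonempty := ⟨φ x, subset_closure rfl⟩

lemma phiPlus_eq (hf : Standing a f s' s t t') (θ : UnitAddCircle × UnitAddCircle) :
    phiPlus a f θ = phiPlus a f (0, θ.2) := phiPlus_congr hf rfl

lemma phiMinus_eq (hf : Standing a f s' s t t') (θ : UnitAddCircle × UnitAddCircle) :
    phiMinus a f θ = phiMinus a f (0, θ.2) := phiMinus_congr hf rfl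

lemma phiPlusMinus_isLeast (hf : Standing a f s' s t t')
    (θ : UnitAddCircle × UnitAddCircle) :
    IsLeast {y | (θ.2, y) ∈ graphClosure fun x => phiPlus a f (0, x)} (phiPlusMinus a f θ) := by
  obtain ⟨m, hm⟩ := (isCompact_graphClosure (fun x => hf.phiPlus_mem (0, x)) θ.2).exists_isLeast
    (nonempty_graphClosure _ _)
  have h2 : IsLeast {y | (θ, y) ∈ filledClosure (phiPlus a f)} m := by
    constructor
    · have := (mem_closure_graphSet_iff (phiPlus_eq hf) θ m).2 hm.1
      exact ⟨m, m, this, this, le_rfl, le_rfl⟩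
    · rintro y ⟨y₁, y₂, h1, -, h3, -⟩
      exact (hm.2 ((mem_closure_graphSet_iff (phiPlus_eq hf) θ y₁).1 h1)).trans h3
  rwa [phiPlusMinus, h2.csInf_eq]

lemma phiMinusPlus_isGreatest (hf : Standing a f s' s t t')
    (θ : UnitAddCircle × UnitAddCircle) :
    IsGreatest {y | (θ.2, y) ∈ graphClosure fun x => phiMinus a f (0, x)}
      (phiMinusPlus a f θ) := by
  obtain ⟨m, hm⟩ := (isCompact_graphClosure (fun x => hf.phiMinus_mem (0, x))
    θ.2).exists_isGreatest (nonempty_graphClosure _ _)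
  have h2 : IsGreatest {y | (θ, y) ∈ filledClosure (phiMinus a f)} m := by
    constructor
    · have := (mem_closure_graphSet_iff (phiMinus_eq hf) θ m).2 hm.1
      exact ⟨m, m, this, this, le_rfl, le_rfl⟩
    · rintro y ⟨y₁, y₂, -, h1, -, h3⟩
      exact h3.trans (hm.2 ((mem_closure_graphSet_iff (phiMinus_eq hf) θ y₂).1 h1))
  rwa [phiMinusPlus, h2.csSup_eq]

/-! ### The dichotomy -/

/-- Lipschitz extensions to the closed unit interval of the restrictions of `φ*` to the
`ξ`-planes. -/
structure PlaneExtension (a : ℝ) (f : UnitAddCircle → ℝ → ℝ) (L : UnitAddCircle → ℝ → ℝ)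
    (K : ℝ) : Prop where
  K_nonneg : 0 ≤ K
  lipschitz : ∀ ξ u v, |L ξ u - L ξ v| ≤ K * |u - v|
  eq : ∀ ξ, ∀ u ∈ Ico (0 : ℝ) 1, L ξ u = phiStar a f (ξ, (u : UnitAddCircle))

lemma exists_planeExtension (hf : Standing a f s' s t t')
    (hA : filledClosure (phiPlus a f) ∩ filledClosure (phiMinus a f) = ∅) :
    ∃ L K, PlaneExtension a f L K := by
  obtain ⟨K, hK0, hK⟩ := exists_phiStar_lipschitz hf hA
  have hext : ∀ ξ, ∃ g : ℝ → ℝ, LipschitzWith ⟨K, hK0⟩ g ∧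
      EqOn (fun u : ℝ => phiStar a f (ξ, (u : UnitAddCircle))) g (Ico 0 1) := by
    intro ξ
    refine LipschitzOnWith.extend_real (LipschitzOnWith.of_dist_le_mul fun u hu v hv => ?_)
    have := hK ξ u v
    rw [rep_coe hu, rep_coe hv] at this
    exact this
  choose L hL hLeq using hext
  exact ⟨L, K, hK0, fun ξ u v => (hL ξ).dist_le_mul u v, fun ξ u hu => (hLeq ξ hu).symm⟩

lemma PlaneExtension.continuous {L : UnitAddCircle → ℝ → ℝ} {K : ℝ}
    (hL : PlaneExtension a f L K) (ξ : UnitAddCircle) : Continuous (L ξ) := by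
  refine (LipschitzWith.of_dist_le_mul (K := ⟨K, hL.K_nonneg⟩) fun u v => ?_).continuous
  exact hL.lipschitz ξ u v

lemma Standing.exists_fibre_lipschitz (hf : Standing a f s' s t t') :
    ∃ C, 0 < C ∧ ∀ x, ∀ y ∈ Icc s t, ∀ z ∈ Icc s t, |f x z - f x y| ≤ C * |z - y| := by
  obtain ⟨C, hC0, hC⟩ := hf.exists_lipschitz
  refine ⟨C + 1, by linarith, fun x y hy z hz => ?_⟩
  obtain ⟨u, hu, rfl⟩ := exists_coe_eq x
  have := hC u (Ico_subset_Icc_self hu) u (Ico_subset_Icc_self hu) y (hf.mem_J hy) z (hf.mem_J hz)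
  rw [sub_self, abs_zero, zero_add] at this
  exact this.trans (mul_le_mul_of_nonneg_right (by linarith) (abs_nonneg _))

lemma PlaneExtension.exists_graphPair_phiPlus (hf : Standing a f s' s t t')
    {L : UnitAddCircle → ℝ → ℝ} {K : ℝ} (hL : PlaneExtension a f L K) :
    ∃ C, GraphPair a f (fun x => phiPlus a f (0, x)) (phiStar a f) L C K := by
  obtain ⟨C, hC0, hC⟩ := hf.exists_fibre_lipschitz
  have hle : ∀ θ, phiStar a f θ ≤ phiPlus a f (0, θ.2) := fun θ =>
    (phiStar_mem hf θ).2.trans_eq (phiPlus_eq hf θ)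
  refine ⟨C, hf.a_pos, hf.a_lt_one, hf.strictMono, hf.continuous_f, hC0, hL.K_nonneg,
    fun θ => ?_, phiPlus_tau hf, upperSemicontinuous_phiPlus hf, phiStar_baker hf,
    measurable_phiStar hf, hle, hL.lipschitz, hL.eq⟩
  have := hC θ.2 _ (phiStar_mem_I hf θ) _ (hf.phiPlus_mem (0, θ.2))
  rw [abs_of_nonneg (sub_nonneg.2 (hle θ))] at this
  exact (le_abs_self _).trans this

/-- The reflection `y ↦ -y` turns the lower semicontinuous graph below `φ*` into an upper
semicontinuous one above it. Since `GraphPair` asks only for monotone fibre maps, no Schwarzian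
condition needs to be transported. -/
lemma PlaneExtension.exists_graphPair_phiMinus (hf : Standing a f s' s t t')
    {L : UnitAddCircle → ℝ → ℝ} {K : ℝ} (hL : PlaneExtension a f L K) :
    ∃ C, GraphPair a (fun x y => -f x (-y)) (fun x => -phiMinus a f (0, x))
      (fun θ => -phiStar a f θ) (fun ξ u => -L ξ u) C K := by
  obtain ⟨C, hC0, hC⟩ := hf.exists_fibre_lipschitz
  have hle : ∀ θ, phiMinus a f (0, θ.2) ≤ phiStar a f θ := fun θ =>
    (phiMinus_eq hf θ).symm.trans_le (phiStar_mem hf θ).1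
  refine ⟨C, hf.a_pos, hf.a_lt_one, fun x y z hyz => neg_lt_neg (hf.strictMono x (neg_lt_neg hyz)),
    ?_, hC0, hL.K_nonneg, fun θ => ?_, fun x => ?_, ?_, fun θ => ?_, (measurable_phiStar hf).neg,
    fun θ => neg_le_neg (hle θ), fun ξ u v => ?_, fun ξ u hu => ?_⟩
  · exact (hf.continuous_f.comp (continuous_fst.prodMk continuous_snd.neg)).neg
  · have := hC θ.2 _ (hf.phiMinus_mem (0, θ.2)) _ (phiStar_mem_I hf θ)
    rw [abs_of_nonneg (sub_nonneg.2 (hle θ))] at this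
    have := (le_abs_self _).trans this
    simp only [neg_neg]
    linarith
  · rw [neg_neg, ← phiMinus_tau hf]
  · intro x y hy
    have := lowerSemicontinuous_phiMinus hf x (-y) (by linarith)
    exact this.mono fun z hz => by linarith
  · rw [neg_neg, phiStar_baker hf]
  · rw [neg_sub_neg, abs_sub_comm]; exact hL.lipschitz ξ u v
  · rw [hL.eq ξ u hu]

lemma caseA1_of_gap (hf : Standing a f s' s t t') {L : UnitAddCircle → ℝ → ℝ} {K : ℝ}
    (hL : PlaneExtension a f L K)
    (hplus : ∀ᵐ ξ, ∀ u ∈ Icc (0 : ℝ) 1, ∀ y,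
      ((u : UnitAddCircle), y) ∈ graphClosure (fun x => phiPlus a f (0, x)) → L ξ u < y)
    (hminus : ∀ᵐ ξ, ∀ u ∈ Icc (0 : ℝ) 1, ∀ y,
      ((u : UnitAddCircle), y) ∈ graphClosure (fun x => -phiMinus a f (0, x)) → -L ξ u < y) :
    CaseA1 a f := by
  filter_upwards [hplus, hminus, ae_condMeasure_eq hf] with ξ h1 h2 hcond q hq
  rw [hcond] at hq
  -- The extended curve over the closed interval is compact, so it contains the support, including
  -- the limit at `u = 1`.
  have hsub : closure (range fun x : UnitAddCircle => (x, phiStar a f (ξ, x))) ⊆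
      (fun u : ℝ => ((u : UnitAddCircle), L ξ u)) '' Icc 0 1 := by
    refine closure_minimal ?_ (isCompact_Icc.image
      (continuous_coe.prodMk (hL.continuous ξ))).isClosed
    rintro _ ⟨x, rfl⟩
    obtain ⟨u, hu, rfl⟩ := exists_coe_eq x
    exact ⟨u, Ico_subset_Icc_self hu, by simp only [hL.eq ξ u hu]⟩
  obtain ⟨u, hu, rfl⟩ :=
    hsub (support_map_subset_closure (measurable_planeLift hf ξ).aemeasurable hq)
  have hlt : ∀ y, ((ξ, (u : UnitAddCircle)), y) ∈ closure (graphSet (phiPlus a f)) →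
      L ξ u < y := fun y hy => h1 u hu y ((mem_closure_graphSet_iff (phiPlus_eq hf) _ _).1 hy)
  have hgt : ∀ y, ((ξ, (u : UnitAddCircle)), y) ∈ closure (graphSet (phiMinus a f)) →
      y < L ξ u := by
    intro y hy
    have h3 := (mem_closure_graphSet_iff (phiMinus_eq hf) _ _).1 hy
    have := h2 u hu (-y) ((mem_graphClosure_neg_iff _ _).2 (by rwa [neg_neg]))
    linarith
  refine ⟨?_, ?_, ?_, ?_⟩
  · rintro ⟨y₁, y₂, -, hy, -, hle⟩
    exact absurd (hgt _ hy) (not_lt.2 hle)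
  · rintro ⟨y₁, y₂, hy, -, hle, -⟩
    exact absurd (hlt _ hy) (not_lt.2 hle)
  · rintro y ⟨y₁, y₂, -, hy, -, hle⟩
    exact hle.trans_lt (hgt _ hy)
  · rintro y ⟨y₁, y₂, hy, -, hle, -⟩
    exact (hlt _ hy).trans_le hle

lemma continuous_of_isC1Lip {h : UnitAddCircle → ℝ} (hh : IsC1Lip h) : Continuous h :=
  (QuotientAddGroup.isQuotientMap_mk (AddSubgroup.zmultiples (1 : ℝ))).continuous_iff.2
    hh.1.continuous

/-- A graph that is independent of `ξ` and agrees with `φ*` in almost every plane is an invariant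
Lipschitz graph. -/
lemma PlaneExtension.invariantGraph (hf : Standing a f s' s t t') {L : UnitAddCircle → ℝ → ℝ}
    {K : ℝ} (hL : PlaneExtension a f L K) {h : UnitAddCircle → ℝ}
    (heq : ∀ᵐ ξ, ∀ u ∈ Icc (0 : ℝ) 1, L ξ u = h (u : UnitAddCircle)) :
    InvariantGraph a f s' t' h K := by
  obtain ⟨ξ₀, hξ₀⟩ := heq.exists
  obtain ⟨C, hpair⟩ := hL.exists_graphPair_phiPlus hf
  refine ⟨fun x => ?_, fun x => ?_, hL.K_nonneg, fun u hu v hv => ?_⟩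
  · obtain ⟨u, hu, rfl⟩ := exists_coe_eq x
    rw [← hξ₀ u (Ico_subset_Icc_self hu), hL.eq ξ₀ u hu]
    exact hf.mem_J (phiStar_mem_I hf _)
  -- The identity must hold for every `x`, so `ξ` is chosen such that both its plane and the plane
  -- of its preimage in the branch of `x` carry `h`.
  · obtain ⟨ξ, h1, h2⟩ := (heq.and (ae_comp_branch hf.a_pos hf.a_lt_one heq x)).exists
    set η : UnitAddCircle := ((branch a x (rep ξ) : ℝ) : UnitAddCircle) with hη
    have hτ : BakerSkew.tau a η = ξ := by
      rw [hη, tau_branch_of_Ico hf.a_pos hf.a_lt_one x (rep_mem _), coe_rep]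
    have hsel : branch a η = branch a x := branch_congr (by
      rw [hη, rep_coe (branch_mem_Ico hf.a_pos hf.a_lt_one _ (rep_mem _))]
      exact branch_lt_iff hf.a_pos hf.a_lt_one x (rep_mem _))
    have hm : rep (tau a x) ∈ Icc (0 : ℝ) 1 := Ico_subset_Icc_self (rep_mem _)
    have e := hpair.L_branch η hm
    rw [hτ, hsel, branch_rep_tau hf.a_pos hf.a_lt_one,
      h1 _ (Ico_subset_Icc_self (rep_mem _)), h2 _ hm, coe_rep, coe_rep] at e
    exact e
  · rw [← hξ₀ u hu, ← hξ₀ v hv]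
    exact hL.lipschitz ξ₀ v u

/-- Agreement with a ξ-independent graph turns `φ*` into an invariant Lipschitz graph. A fibre
supporting the conditional measure must meet that graph, hence equals its restriction. -/
lemma PlaneExtension.isStableCarrier (hf : Standing a f s' s t t') {L : UnitAddCircle → ℝ → ℝ}
    {K : ℝ} (hL : PlaneExtension a f L K) {φ : UnitAddCircle × UnitAddCircle → ℝ}
    (hφ : ∀ θ, φ θ = φ (0, θ.2))
    (heq : ∀ᵐ ξ, ∀ u ∈ Icc (0 : ℝ) 1, L ξ u = φ (ξ, (u : UnitAddCircle))) :
    IsStableCarrier a f s' t' φ := by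
  set h : UnitAddCircle → ℝ := fun x => φ (0, x) with hh
  have heq' : ∀ᵐ ξ, ∀ u ∈ Icc (0 : ℝ) 1, L ξ u = h (u : UnitAddCircle) := by
    filter_upwards [heq] with ξ hξ u hu
    rw [hξ u hu, hφ]
  have hinv := hL.invariantGraph hf heq'
  have hC1 := hinv.isC1Lip hf
  have hcont := continuous_of_isC1Lip hC1
  have hstar : ∀ᵐ ξ, ∀ x, phiStar a f (ξ, x) = h x := by
    filter_upwards [heq'] with ξ hξ x
    obtain ⟨u, hu, rfl⟩ := exists_coe_eq x
    rw [← hξ u (Ico_subset_Icc_self hu), hL.eq ξ u hu]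
  refine ⟨?_, ⟨h, hφ, hC1⟩, ?_⟩
  · have hS : MeasurableSet {p : UnitAddCircle × (UnitAddCircle × ℝ) | p.2.2 = φ (p.1, p.2.1)} := by
      have e : {p : UnitAddCircle × (UnitAddCircle × ℝ) | p.2.2 = φ (p.1, p.2.1)} =
          {p | p.2.2 = h p.2.1} := by
        ext p
        simp only [mem_ofPred_eq]
        rw [hφ]
      rw [e]
      exact (isClosed_eq (by fun_prop) (by fun_prop)).measurableSet
    rw [liftedMeasure, Measure.map_apply (measurable_lift hf) hS.compl]
    have hae : ∀ᵐ θ : UnitAddCircle × UnitAddCircle, ∀ x, phiStar a f (θ.1, x) = h x :=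
      (Measure.quasiMeasurePreserving_fst (μ := (volume : Measure UnitAddCircle))
        (ν := (volume : Measure UnitAddCircle))).ae hstar
    refine measure_mono_null ?_ (ae_iff.1 hae)
    intro θ hθ hc
    refine hθ ?_
    simp only [mem_ofPred_eq]
    rw [hφ]
    exact hc θ.2
  · filter_upwards [ae_condMeasure_eq hf, hstar] with ξ hcond hξ
    have hset : {q : ℝ × ℝ | q.1 ∈ Icc (0 : ℝ) 1 ∧ q.2 = φ (ξ, (q.1 : UnitAddCircle))} =
        {q | q.1 ∈ Icc (0 : ℝ) 1 ∧ q.2 = h (q.1 : UnitAddCircle)} := by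
      ext q
      simp only [mem_ofPred_eq]
      rw [hφ]
    rw [hset]
    refine ⟨hinv.isStrongStableFibre hf ξ, ?_, fun γ' hγ' hsupp => ?_⟩
    · have hcl : IsClosed {q : UnitAddCircle × ℝ | q.2 = h q.1} :=
        isClosed_eq (by fun_prop) (by fun_prop)
      have hsub : {q : UnitAddCircle × ℝ | q.2 = h q.1} ⊆
          (fun q : ℝ × ℝ => (((q.1 : UnitAddCircle)), q.2)) ''
            {q | q.1 ∈ Icc (0 : ℝ) 1 ∧ q.2 = h (q.1 : UnitAddCircle)} := by
        rintro ⟨x, y⟩ hxy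
        obtain ⟨u, hu, rfl⟩ := exists_coe_eq x
        exact ⟨(u, y), ⟨Ico_subset_Icc_self hu, hxy⟩, rfl⟩
      refine measure_mono_null (compl_subset_compl.2 hsub) ?_
      rw [hcond, Measure.map_apply (measurable_planeLift hf ξ) hcl.measurableSet.compl]
      convert measure_empty (μ := (volume : Measure UnitAddCircle))
      rw [Set.eq_empty_iff_forall_notMem]
      exact fun x hx => hx (hξ x)
    · have h1 : ∀ᵐ q ∂(condMeasure a f ξ),
          q ∈ (fun q : ℝ × ℝ => (((q.1 : UnitAddCircle)), q.2)) '' γ' := hsupp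
      rw [hcond] at h1
      obtain ⟨x, ⟨u, y⟩, hmem, hxy⟩ :=
        (ae_of_ae_map (measurable_planeLift hf ξ).aemeasurable h1).exists
      simp only [Prod.mk.injEq] at hxy
      obtain ⟨rfl, rfl⟩ := hxy
      rw [hξ] at hmem
      exact hinv.eq_of_isStrongStableFibre hf hγ' hmem

lemma phiPlusMinus_eq (hf : Standing a f s' s t t') (θ : UnitAddCircle × UnitAddCircle) :
    phiPlusMinus a f θ = phiPlusMinus a f (0, θ.2) :=
  (phiPlusMinus_isLeast hf θ).unique (phiPlusMinus_isLeast hf (0, θ.2))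

lemma phiMinusPlus_eq (hf : Standing a f s' s t t') (θ : UnitAddCircle × UnitAddCircle) :
    phiMinusPlus a f θ = phiMinusPlus a f (0, θ.2) :=
  (phiMinusPlus_isGreatest hf θ).unique (phiMinusPlus_isGreatest hf (0, θ.2))

theorem caseA1_or_caseA2 (hf : Standing a f s' s t t')
    (hA : filledClosure (phiPlus a f) ∩ filledClosure (phiMinus a f) = ∅) :
    CaseA1 a f ∨ CaseA2 a f s' t' := by
  obtain ⟨L, K, hL⟩ := exists_planeExtension hf hA
  obtain ⟨C, hplus⟩ := hL.exists_graphPair_phiPlus hf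
  obtain ⟨C', hminus⟩ := hL.exists_graphPair_phiMinus hf
  rcases hplus.dichotomy with h1 | h1
  · rcases hminus.dichotomy with h2 | h2
    · exact Or.inl (caseA1_of_gap hf hL h1 h2)
    · refine Or.inr (Or.inr (hL.isStableCarrier hf (phiMinusPlus_eq hf) ?_))
      filter_upwards [h2] with ξ hξ u hu
      refine IsGreatest.unique ?_ (phiMinusPlus_isGreatest hf (ξ, (u : UnitAddCircle)))
      obtain ⟨m1, m2⟩ := hξ u hu
      constructor
      · have := (mem_graphClosure_neg_iff (φ := fun x => phiMinus a f (0, x))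
          (u : UnitAddCircle) (-L ξ u)).1 m1
        rwa [neg_neg] at this
      · intro y hy
        have := m2 ((mem_graphClosure_neg_iff (φ := fun x => phiMinus a f (0, x)) _ (-y)).2
          (by rwa [neg_neg]))
        linarith
  · refine Or.inr (Or.inl (hL.isStableCarrier hf (phiPlusMinus_eq hf) ?_))
    filter_upwards [h1] with ξ hξ u hu
    exact (hξ u hu).unique (phiPlusMinus_isLeast hf (ξ, (u : UnitAddCircle)))

/-! ### The two cases exclude each other. -/

lemma not_caseA1_of_isStableCarrier {φ : UnitAddCircle × UnitAddCircle → ℝ}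
    (hcar : IsStableCarrier a f s' t' φ)
    (hφ : ∀ θ, (θ, φ θ) ∈ filledClosure (phiPlus a f) ∨
      (θ, φ θ) ∈ filledClosure (phiMinus a f)) : ¬ CaseA1 a f := by
  intro hA1
  obtain ⟨-, ⟨h, hh, hC1⟩, hγ⟩ := hcar
  have hcont := continuous_of_isC1Lip hC1
  obtain ⟨ξ, h1, h2⟩ := (Filter.Eventually.and hA1 hγ).exists
  have hsupp := h2.2.1
  have hprob : IsProbabilityMeasure (condMeasure a f ξ) := by
    unfold condMeasure; infer_instance
  -- A probability measure has nonempty support, and here the support lies on the closed graph of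
  -- `h`, hence inside one of the two filled-in closures.
  obtain ⟨q, hq⟩ := Measure.nonempty_support hprob.ne_zero
  have hcl : IsClosed {q : UnitAddCircle × ℝ | q.2 = h q.1} :=
    isClosed_eq (by fun_prop) (by fun_prop)
  have hqG : q.2 = h q.1 := by
    refine Measure.support_subset_of_isClosed hcl ?_ hq
    rw [mem_ae_iff]
    refine measure_mono_null (compl_subset_compl.2 ?_) hsupp
    rintro _ ⟨⟨u, y⟩, ⟨-, hy⟩, rfl⟩
    exact hy.trans (hh _)
  have hq2 : q.2 = φ (ξ, q.1) := hqG.trans (hh (ξ, q.1)).symm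
  have h3 := h1 q hq
  rw [hq2] at h3
  rcases hφ (ξ, q.1) with h4 | h4
  · exact h3.2.1 h4
  · exact h3.1 h4

theorem not_caseA1_and_caseA2 (hf : Standing a f s' s t t') :
    ¬ (CaseA1 a f ∧ CaseA2 a f s' t') := by
  rintro ⟨h1, h2 | h2⟩
  · refine not_caseA1_of_isStableCarrier h2 (fun θ => Or.inl ?_) h1
    have := (mem_closure_graphSet_iff (phiPlus_eq hf) θ _).2 (phiPlusMinus_isLeast hf θ).1
    exact ⟨_, _, this, this, le_rfl, le_rfl⟩
  · refine not_caseA1_of_isStableCarrier h2 (fun θ => Or.inr ?_) h1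
    have := (mem_closure_graphSet_iff (phiMinus_eq hf) θ _).2 (phiMinusPlus_isGreatest hf θ).1
    exact ⟨_, _, this, this, le_rfl, le_rfl⟩

end

end BakerSkew

end

theorem mainTheorem7 (a : ℝ) (f : UnitAddCircle → ℝ → ℝ) (s' s t t' : ℝ)
    (hf : BakerSkew.Standing a f s' s t t')
    (hA : BakerSkew.filledClosure (BakerSkew.phiPlus a f) ∩
      BakerSkew.filledClosure (BakerSkew.phiMinus a f) = ∅) :
    (BakerSkew.CaseA1 a f ∨ BakerSkew.CaseA2 a f s' t') ∧
      ¬ (BakerSkew.CaseA1 a f ∧ BakerSkew.CaseA2 a f s' t') :=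
  ⟨BakerSkew.caseA1_or_caseA2 hf hA, BakerSkew.not_caseA1_and_caseA2 hf⟩
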